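/- All graphs are finite and simple. A set $S$ of vertices of a graph $G$ is in general position (respectively, monophonic position) if no shortest path (respectively, no induced path) of $G$ contains more than two vertices of $S$. The gp-number (respectively, mp-number) of $G$ is the largest size of a set of vertices of $G$ in general position (respectively, monophonic position). For integers $2 \le a \le b$ let $\mu(a,b)$ be the least order of a graph with mp-number $a$ and gp-number $b$ (such a graph exists). Then: - for every $a \ge 2$, $\mu(a,a) = a$; - $\mu(2,3) = 5$, and for every $b \ge 4$, $\mu(2,b) \le \lceil 3b/2 \rceil + 1$, with equality for $4 \le b \le 8$; - if $3 \le a < b$ and $b/2 \le a$, then $\mu(a,b) = b+2$; - if $3 \le a < b/2$, then $\mu(a,b) \le b - a + 2 + \lceil b/2 \rceil$. -/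

import Mathlib

namespace SimpleGraph

variable {V : Type*}

/-- A geodesic: a shortest path between its two ends. -/
def Walk.IsGeodesic {G : SimpleGraph V} {u v : V} (p : G.Walk u v) : Prop :=
  p.IsPath ∧ p.length = G.dist u v

/-- A monophonic (induced) path: a path without chords. -/
def Walk.IsMonophonic {G : SimpleGraph V} {u v : V} (p : G.Walk u v) : Prop :=
  p.IsPath ∧ p.IsChordless

/-- `S` is in general position: no geodesic of `G` contains more than two elements of `S`. -/
def IsGPSet (G : SimpleGraph V) (S : Set V) : Prop :=
  ∀ ⦃u v : V⦄ (p : G.Walk u v), p.IsGeodesic → (S ∩ {x | x ∈ p.support}).ncard ≤ 2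

/-- `S` is in monophonic position: no induced path of `G` contains more than two
elements of `S`. -/
def IsMPSet (G : SimpleGraph V) (S : Set V) : Prop :=
  ∀ ⦃u v : V⦄ (p : G.Walk u v), p.IsMonophonic → (S ∩ {x | x ∈ p.support}).ncard ≤ 2

/-- The gp-number of a finite graph: the largest size of a set in general position. -/
noncomputable def gpNumber [Finite V] (G : SimpleGraph V) : ℕ :=
  sSup {k | ∃ S : Set V, G.IsGPSet S ∧ S.ncard = k}

/-- The mp-number of a finite graph: the largest size of a set in monophonic position. -/
noncomputable def mpNumber [Finite V] (G : SimpleGraph V) : ℕ :=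
  sSup {k | ∃ S : Set V, G.IsMPSet S ∧ S.ncard = k}

/-- The orders of the finite graphs with mp-number `a` and gp-number `b`. -/
def positionOrders (a b : ℕ) : Set ℕ :=
  {n | ∃ G : SimpleGraph (Fin n), G.mpNumber = a ∧ G.gpNumber = b}

/-- `positionMu a b` is the least order of a graph with mp-number `a` and gp-number `b`
(meaningful only when such a graph exists). -/
noncomputable def positionMu (a b : ℕ) : ℕ :=
  sInf (positionOrders a b)

end SimpleGraph

/-!
Sequences `f 0, …, f n` of vertices replace walks throughout. A set is in monophonic position when
none of its vertices is interior to an induced path between two others (`isMPSet_iff`), and in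
general position when none of its vertices `v` satisfies `d(u, w) = d(u, v) + d(v, w)` for two
others (`isGPSet_iff`). Short geodesics give two local consequences for a set `S` in general
position: it induces no path on three vertices (`IsGPSet.adj_of_adj_adj`), and if `u ~ v` in `S`
and a vertex `w ∈ S` adjacent to neither has a common neighbour with `v`, it has one with `u`
(`IsGPSet.exists_common_neighbor`).

*General lower bounds.* A set in general position that misses at most one vertex is in monophonic
position (`IsGPSet.isMPSet_of_subsingleton_compl`), so a graph with different numbers `a < b` has
at least `b + 2` vertices.

*Constructions.* Complete graphs have equal numbers. For `a = 2` the examples are the pentagon,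
the cube minus a vertex, and the graphs `pagoda`, in which a middle layer of `b` vertices lies
between an apex and a lower layer of `⌈b / 2⌉` vertices: the middle layer has diameter two, while
any three vertices lie on an induced path. For `a ≥ 3` they are the graphs `spider`: a subdivided
star with `a` legs together with an apex. The apex is joined to all vertices whose distance from
the centre is not a multiple of three, and these form a largest set in general position; the
neighbours of the centre form a largest set in monophonic position.

*The value for `a = 2` and `4 ≤ b ≤ 8`.* Here any three vertices lie on an induced path
(`TriplesOnPaths`), in particular the graph is triangle-free, and a set `S` in general position
induces a matching. It is shown that a complement of `t = 2`, `3`, `4` vertices leaves room for at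
most `3`, `4`, `6` vertices of `S` (`TriplesOnPaths.ncard_le_complBound`), which gives the bound.
If `S` contains at most one edge, the vertices of `S` outside that edge are determined by their
neighbourhoods in the complement; three such neighbourhoods satisfy conditions that are necessary
for one of the vertices to be interior to an induced path between the others, and a search through
the families of subsets of a set with `t` elements, evaluated by the kernel, shows that there is
no larger family (`noFamily_check`, `noFamily_pair_check`). If `S` contains two edges and `t = 4`,
the complement either consists of one common neighbour for each pair of ends of the two edges
(`IsLinkedPair.false_of_three`), or of one neighbour of each of the four ends
(`TriplesOnPaths.false_of_unlinked`); in both cases the other vertices of `S` see so much of the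
complement that there are at most two of them.
-/

section

namespace SimpleGraph

variable {V : Type*} {G : SimpleGraph V}

/-! ### Induced paths and geodesics as sequences of vertices -/

/-- `f 0, f 1, …, f n` is an induced path of `G`: the vertices are distinct, and two of them are
adjacent exactly when they are consecutive. Values of `f` beyond `n` are irrelevant. -/
def IsInducedSeq (G : SimpleGraph V) (f : ℕ → V) (n : ℕ) : Prop :=
  ∀ i ≤ n, ∀ j ≤ n, (f i = f j → i = j) ∧ (G.Adj (f i) (f j) ↔ i + 1 = j ∨ j + 1 = i)

/-- `v` is an interior vertex of an induced path of `G` with ends `u` and `w`. -/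
def Between (G : SimpleGraph V) (u v w : V) : Prop :=
  ∃ (f : ℕ → V) (n j : ℕ), G.IsInducedSeq f n ∧ 0 < j ∧ j < n ∧ f 0 = u ∧ f j = v ∧ f n = w

theorem IsInducedSeq.between {f : ℕ → V} {n i j k : ℕ} (h : G.IsInducedSeq f n) (hij : i < j)
    (hjk : j < k) (hk : k ≤ n) : G.Between (f i) (f j) (f k) := by
  refine ⟨fun t => f (i + t), k - i, j - i, ?_, by omega, by omega, rfl, ?_, ?_⟩
  · intro a ha b hb
    have := h (i + a) (by omega) (i + b) (by omega)
    refine ⟨fun e => by have := this.1 e; omega,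
      this.2.trans ⟨fun _ => by omega, fun _ => by omega⟩⟩
  · simp only; congr 1; omega
  · simp only; congr 1; omega

theorem Between.symm {u v w : V} (h : G.Between u v w) : G.Between w v u := by
  obtain ⟨f, n, j, h, h0, hn, rfl, rfl, rfl⟩ := h
  refine ⟨fun t => f (n - t), n, n - j, ?_, by omega, by omega, rfl, ?_, ?_⟩
  · intro a ha b hb
    have := h (n - a) (by omega) (n - b) (by omega)
    refine ⟨fun e => by have := this.1 e; omega,
      this.2.trans ⟨fun _ => by omega, fun _ => by omega⟩⟩
  · simp only; congr 1; omega
  · simp only; congr 1; omega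

theorem exists_walk_of_seq {f : ℕ → V} {n : ℕ} (h : ∀ i < n, G.Adj (f i) (f (i + 1))) :
    ∃ p : G.Walk (f 0) (f n), p.length = n ∧ p.support = (List.range (n + 1)).map f ∧
      p.edges = (List.range n).map fun i => s(f i, f (i + 1)) := by
  induction n with
  | zero => exact ⟨.nil, by simp⟩
  | succ n ih =>
    obtain ⟨p, h1, h2, h3⟩ := ih fun i hi => h i (by omega)
    refine ⟨p.concat (h n (by omega)), by simp [h1], ?_, ?_⟩
    · rw [Walk.support_concat, h2, List.range_succ (n := n + 1)]; simp
    · rw [Walk.edges_concat, h3, List.range_succ (n := n)]; simp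

theorem exists_lt_lt_of_ne {P : ℕ → Prop} {i j k : ℕ} (hi : P i) (hj : P j) (hk : P k)
    (hij : i ≠ j) (hik : i ≠ k) (hjk : j ≠ k) : ∃ a b c, a < b ∧ b < c ∧ P a ∧ P b ∧ P c := by
  rcases lt_or_gt_of_ne hij with h1 | h1 <;> rcases lt_or_gt_of_ne hik with h2 | h2 <;>
    rcases lt_or_gt_of_ne hjk with h3 | h3
  any_goals omega
  all_goals first
    | exact ⟨i, j, k, ‹_›, ‹_›, ‹_›, ‹_›, ‹_›⟩
    | exact ⟨i, k, j, ‹_›, ‹_›, ‹_›, ‹_›, ‹_›⟩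
    | exact ⟨j, i, k, ‹_›, ‹_›, ‹_›, ‹_›, ‹_›⟩
    | exact ⟨j, k, i, ‹_›, ‹_›, ‹_›, ‹_›, ‹_›⟩
    | exact ⟨k, i, j, ‹_›, ‹_›, ‹_›, ‹_›, ‹_›⟩
    | exact ⟨k, j, i, ‹_›, ‹_›, ‹_›, ‹_›, ‹_›⟩

theorem isMPSet_iff {S : Set V} :
    G.IsMPSet S ↔ ∀ u ∈ S, ∀ v ∈ S, ∀ w ∈ S, ¬ G.Between u v w := by
  constructor
  · rintro h _ hu _ hv _ hw ⟨f, n, j, hf, h0, hn, rfl, rfl, rfl⟩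
    obtain ⟨p, -, h2, h3⟩ := exists_walk_of_seq (G := G) (f := f) (n := n)
      fun i hi => (hf i (by omega) (i + 1) (by omega)).2.2 (Or.inl rfl)
    have hp : p.IsMonophonic := by
      constructor
      · rw [Walk.isPath_def, h2, List.nodup_map_iff_inj_on List.nodup_range]
        intro a ha b hb e
        simp only [List.mem_range] at ha hb
        exact (hf a (by omega) b (by omega)).1 e
      · rw [Walk.isChordless_iff_forall_mem_edges, h2, h3]
        simp only [List.mem_map, List.mem_range]
        rintro _ _ ⟨a, ha, rfl⟩ ⟨b, hb, rfl⟩ hab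
        rcases (hf a (by omega) b (by omega)).2.1 hab with rfl | rfl
        · exact ⟨a, by omega, rfl⟩
        · exact ⟨b, by omega, Sym2.eq_swap⟩
    have h4 := h p hp
    have hsub : ({f 0, f j, f n} : Set V) ⊆ S ∩ {x | x ∈ p.support} := by
      rintro x (rfl | rfl | rfl)
      · exact ⟨hu, by simp⟩
      · refine ⟨hv, ?_⟩
        simp only [Set.mem_ofPred_eq, h2, List.mem_map, List.mem_range]
        exact ⟨j, by omega, rfl⟩
      · exact ⟨hw, by simp⟩
    have h5 := Set.ncard_le_ncard hsub ((List.finite_toSet p.support).subset Set.inter_subset_right)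
    rw [Set.ncard_eq_three.2 ⟨f 0, f j, f n, ?_, ?_, ?_, rfl⟩] at h5
    · omega
    · exact fun e => by have := (hf 0 (by omega) j (by omega)).1 e; omega
    · exact fun e => by have := (hf 0 (by omega) n (by omega)).1 e; omega
    · exact fun e => by have := (hf j (by omega) n (by omega)).1 e; omega
  · intro h u v p hp
    by_contra! hc
    obtain ⟨x, y, z, hx, hy, hz, hxy, hxz, hyz⟩ := (Set.two_lt_ncard_iff
      ((List.finite_toSet p.support).subset Set.inter_subset_right)).1 hc
    have hf : G.IsInducedSeq p.getVert p.length := by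
      intro i hi j hj
      refine ⟨fun e => hp.1.getVert_injOn hi hj e, fun hadj => ?_, ?_⟩
      · have := hp.2.mem_edges (p.getVert_mem_support i) (p.getVert_mem_support j) hadj
        rw [← Walk.adj_toSubgraph_iff_mem_edges, Walk.toSubgraph_adj_iff] at this
        obtain ⟨t, ht, htl⟩ := this
        have inj := hp.1.getVert_injOn
        rw [Sym2.eq_iff] at ht
        rcases ht with ⟨h1, h2⟩ | ⟨h1, h2⟩
        · have a := inj (x₁ := t) (x₂ := i) (by simp; omega) hi h1
          have b := inj (x₁ := t + 1) (x₂ := j) (by simp; omega) hj h2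
          omega
        · have a := inj (x₁ := t) (x₂ := j) (by simp; omega) hj h1
          have b := inj (x₁ := t + 1) (x₂ := i) (by simp; omega) hi h2
          omega
      · rintro (rfl | rfl)
        · exact p.adj_getVert_succ (by omega)
        · exact (p.adj_getVert_succ (by omega)).symm
    obtain ⟨i, rfl, hi⟩ := Walk.mem_support_iff_exists_getVert.1 hx.2
    obtain ⟨j, rfl, hj⟩ := Walk.mem_support_iff_exists_getVert.1 hy.2
    obtain ⟨k, rfl, hk⟩ := Walk.mem_support_iff_exists_getVert.1 hz.2
    have hij : i ≠ j := fun e => hxy (e ▸ rfl)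
    have hik : i ≠ k := fun e => hxz (e ▸ rfl)
    have hjk : j ≠ k := fun e => hyz (e ▸ rfl)
    obtain ⟨a, b, c, hab, hbc, ha, hb, hc⟩ := exists_lt_lt_of_ne
      (P := fun i => p.getVert i ∈ S ∧ i ≤ p.length) ⟨hx.1, hi⟩ ⟨hy.1, hj⟩ ⟨hz.1, hk⟩ hij hik hjk
    exact h _ ha.1 _ hb.1 _ hc.1 (hf.between hab hbc hc.2)

theorem isGPSet_iff {S : Set V} :
    G.IsGPSet S ↔ ∀ u ∈ S, ∀ v ∈ S, ∀ w ∈ S, u ≠ v → v ≠ w → G.Reachable u v → G.Reachable v w →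
      G.dist u w ≠ G.dist u v + G.dist v w := by
  constructor
  · intro h u hu v hv w hw huv hvw r1 r2 e
    obtain ⟨p, -, hp⟩ := r1.exists_path_of_dist
    obtain ⟨q, -, hq⟩ := r2.exists_path_of_dist
    have hl : (p.append q).length = G.dist u w := by rw [Walk.length_append]; omega
    have h4 := h (p.append q) ⟨Walk.isPath_of_length_eq_dist _ hl, hl⟩
    have hsub : ({u, v, w} : Set V) ⊆ S ∩ {x | x ∈ (p.append q).support} := by
      rintro x (rfl | rfl | rfl)
      · exact ⟨hu, by simp⟩
      · exact ⟨hv, by simp [Walk.mem_support_append_iff]⟩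
      · exact ⟨hw, by simp⟩
    have h5 := Set.ncard_le_ncard hsub
      ((List.finite_toSet (p.append q).support).subset Set.inter_subset_right)
    rw [Set.ncard_eq_three.2 ⟨u, v, w, huv, ?_, hvw, rfl⟩] at h5
    · omega
    · rintro rfl
      have := r1.pos_dist_of_ne huv
      simp at e
      omega
  · intro h u v p hp
    by_contra! hc
    obtain ⟨x, y, z, hx, hy, hz, hxy, hxz, hyz⟩ := (Set.two_lt_ncard_iff
      ((List.finite_toSet p.support).subset Set.inter_subset_right)).1 hc
    have hd : ∀ i j, i ≤ j → j ≤ p.length → G.dist (p.getVert i) (p.getVert j) = j - i := by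
      intro i j hij hj
      have h1 := dist_le p
      have h2 := hp.2
      have a := dist_le (p.take i)
      have b := dist_le (p.drop j)
      have c := dist_le ((p.drop i).take (j - i))
      have e : (p.drop i).getVert (j - i) = p.getVert j := by
        rw [Walk.drop_getVert]; congr 1; omega
      have r1 : G.Reachable u (p.getVert i) := ⟨p.take i⟩
      have r2 : G.Reachable (p.getVert j) v := ⟨p.drop j⟩
      have t1 := r1.dist_triangle_left (p.getVert j)
      have t2 := r2.dist_triangle_right u
      simp only [Walk.take_length, Walk.drop_length, e] at a b c
      omega
    obtain ⟨i, rfl, hi⟩ := Walk.mem_support_iff_exists_getVert.1 hx.2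
    obtain ⟨j, rfl, hj⟩ := Walk.mem_support_iff_exists_getVert.1 hy.2
    obtain ⟨k, rfl, hk⟩ := Walk.mem_support_iff_exists_getVert.1 hz.2
    have hij : i ≠ j := fun e => hxy (e ▸ rfl)
    have hik : i ≠ k := fun e => hxz (e ▸ rfl)
    have hjk : j ≠ k := fun e => hyz (e ▸ rfl)
    have re : ∀ a b, G.Reachable (p.getVert a) (p.getVert b) := fun a b =>
      (p.take a).reachable.symm.trans (p.take b).reachable
    obtain ⟨a, b, c, hab, hbc, ha, hb, hc⟩ := exists_lt_lt_of_ne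
      (P := fun i => p.getVert i ∈ S ∧ i ≤ p.length) ⟨hx.1, hi⟩ ⟨hy.1, hj⟩ ⟨hz.1, hk⟩ hij hik hjk
    have hne : ∀ i j, i < j → j ≤ p.length → p.getVert i ≠ p.getVert j := fun i j h1 h2 e => by
      have := hp.1.getVert_injOn (x₁ := i) (x₂ := j) (by simp; omega) h2 e
      omega
    refine h _ ha.1 _ hb.1 _ hc.1 (hne a b hab hb.2) (hne b c hbc hc.2) (re _ _) (re _ _) ?_
    rw [hd a c (by omega) hc.2, hd a b (by omega) hb.2, hd b c (by omega) hc.2]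
    omega

end SimpleGraph

end

section

namespace SimpleGraph

variable {V : Type*} {G : SimpleGraph V}

/-! ### The numbers `mpNumber` and `gpNumber` -/

section Numbers

variable [Finite V]

theorem bddAbove_ncard (P : Set V → Prop) : BddAbove {k | ∃ S : Set V, P S ∧ S.ncard = k} := by
  refine ⟨Nat.card V, ?_⟩
  rintro _ ⟨S, -, rfl⟩
  exact Set.ncard_le_card S

theorem IsMPSet.ncard_le {S : Set V} (h : G.IsMPSet S) : S.ncard ≤ G.mpNumber :=
  le_csSup (bddAbove_ncard _) ⟨S, h, rfl⟩

theorem IsGPSet.ncard_le {S : Set V} (h : G.IsGPSet S) : S.ncard ≤ G.gpNumber :=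
  le_csSup (bddAbove_ncard _) ⟨S, h, rfl⟩

theorem exists_isMPSet (G : SimpleGraph V) : ∃ S : Set V, G.IsMPSet S ∧ S.ncard = G.mpNumber :=
  Nat.sSup_mem (s := {k | ∃ S : Set V, G.IsMPSet S ∧ S.ncard = k})
    ⟨0, ∅, fun _ _ _ _ => by simp, by simp⟩ (bddAbove_ncard _)

theorem exists_isGPSet (G : SimpleGraph V) : ∃ S : Set V, G.IsGPSet S ∧ S.ncard = G.gpNumber :=
  Nat.sSup_mem (s := {k | ∃ S : Set V, G.IsGPSet S ∧ S.ncard = k})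
    ⟨0, ∅, fun _ _ _ _ => by simp, by simp⟩ (bddAbove_ncard _)

theorem mpNumber_eq {a : ℕ} {S : Set V} (hS : G.IsMPSet S) (ha : S.ncard = a)
    (h : ∀ M : Set V, G.IsMPSet M → M.ncard ≤ a) : G.mpNumber = a := by
  obtain ⟨M, hM, hM'⟩ := exists_isMPSet G
  have := h M hM
  have := hS.ncard_le
  omega

theorem gpNumber_eq {b : ℕ} {S : Set V} (hS : G.IsGPSet S) (hb : S.ncard = b)
    (h : ∀ M : Set V, G.IsGPSet M → M.ncard ≤ b) : G.gpNumber = b := by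
  obtain ⟨M, hM, hM'⟩ := exists_isGPSet G
  have := h M hM
  have := hS.ncard_le
  omega

theorem mpNumber_le_card (G : SimpleGraph V) : G.mpNumber ≤ Nat.card V := by
  obtain ⟨M, -, hM⟩ := exists_isMPSet G
  exact hM ▸ Set.ncard_le_card M

end Numbers

section Iso

variable {W : Type*} {H : SimpleGraph W}

theorem Between.map (e : G ≃g H) {u v w : V} (h : G.Between u v w) :
    H.Between (e u) (e v) (e w) := by
  obtain ⟨f, n, j, hf, h0, hn, rfl, rfl, rfl⟩ := h
  refine ⟨fun t => e (f t), n, j, fun a ha b hb => ?_, h0, hn, rfl, rfl, rfl⟩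
  rw [e.injective.eq_iff, e.map_adj_iff]
  exact hf a ha b hb

theorem IsMPSet.preimage (e : G ≃g H) {S : Set W} (h : H.IsMPSet S) : G.IsMPSet (e ⁻¹' S) :=
  isMPSet_iff.2 fun _ hu _ hv _ hw hb => isMPSet_iff.1 h _ hu _ hv _ hw (hb.map e)

theorem dist_map_le (e : G ≃g H) {u v : V} (h : G.Reachable u v) :
    H.dist (e u) (e v) ≤ G.dist u v := by
  obtain ⟨p, hp⟩ := h.exists_walk_length_eq_dist
  exact (dist_le (p.map e.toHom)).trans (by simp [hp])

theorem dist_iso (e : G ≃g H) (u v : V) : H.dist (e u) (e v) = G.dist u v := by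
  by_cases h : G.Reachable u v
  · refine le_antisymm (dist_map_le e h) ?_
    have := dist_map_le e.symm (u := e u) (v := e v) (Iso.reachable_iff.2 h)
    simpa using this
  · rw [dist_eq_zero_of_not_reachable h,
      dist_eq_zero_of_not_reachable (fun h' => h (Iso.reachable_iff.1 h'))]

theorem IsGPSet.preimage (e : G ≃g H) {S : Set W} (h : H.IsGPSet S) : G.IsGPSet (e ⁻¹' S) := by
  refine isGPSet_iff.2 fun u hu v hv w hw h1 h2 r1 r2 hd => ?_
  refine isGPSet_iff.1 h _ hu _ hv _ hw (e.injective.ne h1) (e.injective.ne h2)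
    (Iso.reachable_iff.2 r1) (Iso.reachable_iff.2 r2) ?_
  rw [dist_iso, dist_iso, dist_iso, hd]

theorem card_mem_positionOrders [Finite V] (G : SimpleGraph V) :
    Nat.card V ∈ positionOrders G.mpNumber G.gpNumber := by
  let e := Finite.equivFin V
  let H := G.map e.toEmbedding
  let i : G ≃g H := Iso.map e G
  refine ⟨H, ?_, ?_⟩
  · obtain ⟨S, hS, hc⟩ := exists_isMPSet G
    refine mpNumber_eq (hS.preimage i.symm) ?_ fun M hM => ?_
    · rw [Set.ncard_preimage_of_injective_subset_range i.symm.injective, hc]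
      simp [i.symm.surjective.range_eq]
    · have := (hM.preimage i).ncard_le
      rwa [Set.ncard_preimage_of_injective_subset_range i.injective] at this
      simp [i.surjective.range_eq]
  · obtain ⟨S, hS, hc⟩ := exists_isGPSet G
    refine gpNumber_eq (hS.preimage i.symm) ?_ fun M hM => ?_
    · rw [Set.ncard_preimage_of_injective_subset_range i.symm.injective, hc]
      simp [i.symm.surjective.range_eq]
    · have := (hM.preimage i).ncard_le
      rwa [Set.ncard_preimage_of_injective_subset_range i.injective] at this
      simp [i.surjective.range_eq]

end Iso

/-! ### Short geodesics and short induced paths -/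

theorem dist_eq_two {u v w : V} (h1 : G.Adj u v) (h2 : G.Adj v w) (h : u ≠ w) (h3 : ¬ G.Adj u w) :
    G.dist u w = 2 := by
  have a := dist_le (Walk.cons h1 (Walk.cons h2 .nil))
  have b := (h1.reachable.trans h2.reachable).one_lt_dist_of_ne_of_not_adj h h3
  simp at a
  omega

theorem IsGPSet.adj_of_adj_adj {S : Set V} (h : G.IsGPSet S) {u v w : V} (hu : u ∈ S) (hv : v ∈ S)
    (hw : w ∈ S) (h1 : G.Adj u v) (h2 : G.Adj v w) (huw : u ≠ w) : G.Adj u w := by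
  by_contra h3
  refine isGPSet_iff.1 h u hu v hv w hw h1.ne h2.ne h1.reachable h2.reachable ?_
  rw [dist_eq_two h1 h2 huw h3, dist_eq_one_iff_adj.2 h1, dist_eq_one_iff_adj.2 h2]

/-- If `u ~ v`, `v ~ t ~ w`, and `u`, `w` have no common neighbour, then `v` lies on a geodesic
from `u` to `w`. -/
theorem IsGPSet.exists_common_neighbor {S : Set V} (h : G.IsGPSet S) {u v t w : V} (hu : u ∈ S)
    (hv : v ∈ S) (hw : w ∈ S) (h1 : G.Adj u v) (h2 : G.Adj v t) (h3 : G.Adj t w)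
    (huw : u ≠ w) (h4 : ¬ G.Adj u w) (hvw : v ≠ w) (h5 : ¬ G.Adj v w) :
    ∃ y, G.Adj u y ∧ G.Adj y w := by
  have a := dist_le (Walk.cons h1 (Walk.cons h2 (Walk.cons h3 .nil)))
  have r2 := h2.reachable.trans h3.reachable
  have r := h1.reachable.trans r2
  have b := r.one_lt_dist_of_ne_of_not_adj huw h4
  have c := isGPSet_iff.1 h u hu v hv w hw h1.ne hvw h1.reachable r2
  rw [dist_eq_two h2 h3 hvw h5, dist_eq_one_iff_adj.2 h1] at c
  simp at a
  obtain ⟨p, hp⟩ := r.exists_walk_length_eq_dist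
  have hp2 : p.length = 2 := by omega
  refine ⟨p.getVert 1, ?_, ?_⟩
  · simpa using p.adj_getVert_succ (i := 0) (by omega)
  · have := p.adj_getVert_succ (i := 1) (by omega)
    rwa [p.getVert_of_length_le (i := 1 + 1) (by omega)] at this

/-- A set of vertices with pairwise distances at most two is in general position as soon as it
contains no induced path on three vertices. -/
theorem isGPSet_of_dist_le_two {S : Set V}
    (hd : ∀ u ∈ S, ∀ w ∈ S, u ≠ w → ¬ G.Adj u w → ∃ v, G.Adj u v ∧ G.Adj v w)
    (h3 : ∀ u ∈ S, ∀ v ∈ S, ∀ w ∈ S, G.Adj u v → G.Adj v w → u ≠ w → G.Adj u w) :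
    G.IsGPSet S := by
  have hd' : ∀ u ∈ S, ∀ w ∈ S, G.dist u w ≤ 2 := by
    intro u hu w hw
    by_cases e : u = w
    · subst e; simp
    by_cases ha : G.Adj u w
    · rw [dist_eq_one_iff_adj.2 ha]; omega
    · obtain ⟨v, h1, h2⟩ := hd u hu w hw e ha
      rw [dist_eq_two h1 h2 e ha]
  refine isGPSet_iff.2 fun u hu v hv w hw huv hvw r1 r2 e => ?_
  have a := hd' u hu w hw
  have b := r1.pos_dist_of_ne huv
  have c := r2.pos_dist_of_ne hvw
  have h1 : G.Adj u v := dist_eq_one_iff_adj.1 (by omega)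
  have h2 : G.Adj v w := dist_eq_one_iff_adj.1 (by omega)
  by_cases huw : u = w
  · subst huw; simp at e; omega
  · have := dist_eq_one_iff_adj.2 (h3 u hu v hv w hw h1 h2 huw)
    omega

/-- A list of vertices that is an induced path, in a form that unfolds by `simp`. -/
def IsInducedList (G : SimpleGraph V) : List V → Prop
  | [] => True
  | [_] => True
  | x :: y :: L => G.Adj x y ∧ (∀ z ∈ L, x ≠ z ∧ ¬ G.Adj x z) ∧ IsInducedList G (y :: L)

instance decidableIsInducedList [DecidableEq V] [DecidableRel G.Adj] :
    (L : List V) → Decidable (G.IsInducedList L)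
  | [] => .isTrue trivial
  | [_] => .isTrue trivial
  | _ :: y :: L =>
    have := decidableIsInducedList (y :: L)
    inferInstanceAs (Decidable (_ ∧ _ ∧ _))

theorem IsInducedList.isInducedSeq [Inhabited V] {L : List V} (h : G.IsInducedList L) :
    G.IsInducedSeq (fun i => L.getD i default) (L.length - 1) := by
  match L, h with
  | [], _ => rintro i hi j hj; simp at hi hj; simp [hi, hj]
  | [_], _ => rintro i hi j hj; simp at hi hj; simp [hi, hj]
  | x :: y :: L, h =>
    obtain ⟨h1, h2, h3⟩ := h
    have ih := h3.isInducedSeq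
    have h0 : ∀ i ≤ L.length, x ≠ (y :: L).getD i default ∧
        (G.Adj x ((y :: L).getD i default) ↔ i = 0) := by
      intro i hi
      cases i with
      | zero => simpa using ⟨h1.ne, h1⟩
      | succ i =>
        have := h2 (L.getD i default) (by
          rw [List.getD_eq_getElem L default (show i < L.length by omega)]
          exact List.getElem_mem _)
        simpa using this
    intro i hi j hj
    simp only [List.length_cons] at hi hj
    cases i with
    | zero =>
      cases j with
      | zero => simp
      | succ j =>
        have := h0 j (by omega)
        refine ⟨fun e => (this.1 e).elim, this.2.trans (by omega)⟩
    | succ i =>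
      cases j with
      | zero =>
        have := h0 i (by omega)
        refine ⟨fun e => (this.1 e.symm).elim, (G.adj_comm _ _).trans (this.2.trans (by omega))⟩
      | succ j =>
        have := ih i (by simp; omega) j (by simp; omega)
        refine ⟨fun e => by have := this.1 e; omega, this.2.trans (by omega)⟩

theorem IsMPSet.false_of_list {S : Set V} (h : G.IsMPSet S) {L : List V} (hL : G.IsInducedList L)
    {u v w : V} (hu : u ∈ S) (hv : v ∈ S) (hw : w ∈ S) (hu' : u ∈ L) (hv' : v ∈ L) (hw' : w ∈ L)
    (huv : u ≠ v) (huw : u ≠ w) (hvw : v ≠ w) : False := by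
  have : Inhabited V := ⟨u⟩
  have hs := hL.isInducedSeq
  obtain ⟨i, hi, rfl⟩ := List.getElem_of_mem hu'
  obtain ⟨j, hj, rfl⟩ := List.getElem_of_mem hv'
  obtain ⟨k, hk, rfl⟩ := List.getElem_of_mem hw'
  obtain ⟨a, b, c, hab, hbc, ⟨ha, ha'⟩, ⟨hb, hb'⟩, hc, hc'⟩ := exists_lt_lt_of_ne
    (P := fun i => L.getD i default ∈ S ∧ i < L.length) (i := i) (j := j) (k := k)
    (by simpa [hi] using hu) (by simpa [hj] using hv) (by simpa [hk] using hw)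
    (fun e => huv (by simp [e])) (fun e => huw (by simp [e])) (fun e => hvw (by simp [e]))
  exact isMPSet_iff.1 h _ ha _ hb _ hc (hs.between hab hbc (by omega))

end SimpleGraph

end

section

namespace SimpleGraph

variable {V : Type*} {G : SimpleGraph V}

/-! ### Orders of graphs: general bounds and the graphs of small order -/

theorem isGPSet_top : (⊤ : SimpleGraph V).IsGPSet Set.univ :=
  isGPSet_of_dist_le_two (fun _ _ _ _ h h' => (h' h).elim) fun _ _ _ _ _ _ _ _ h => h

theorem isMPSet_top : (⊤ : SimpleGraph V).IsMPSet Set.univ := by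
  refine isMPSet_iff.2 ?_
  rintro _ - _ - _ - ⟨f, n, j, hf, h0, hn, rfl, rfl, rfl⟩
  have h : f 0 ≠ f n := fun e => by have := (hf 0 (by omega) n le_rfl).1 e; omega
  have := (hf 0 (by omega) n le_rfl).2.1 h
  omega

theorem self_mem_positionOrders (a : ℕ) : a ∈ positionOrders a a := by
  have h := card_mem_positionOrders (⊤ : SimpleGraph (Fin a))
  rwa [mpNumber_eq isMPSet_top (a := a) (by simp) (fun M _ => by simpa using Set.ncard_le_card M),
    gpNumber_eq isGPSet_top (b := a) (by simp) (fun M _ => by simpa using Set.ncard_le_card M),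
    Nat.card_eq_fintype_card, Fintype.card_fin] at h

theorem le_of_mem_positionOrders {a b n : ℕ} (h : n ∈ positionOrders a b) : a ≤ n := by
  obtain ⟨G, rfl, -⟩ := h
  simpa using mpNumber_le_card G

/-- A set in general position that misses at most one vertex is in monophonic position. Any three
consecutive vertices of an induced path form a geodesic, so a path through three vertices of the
set has four consecutive vertices of which exactly one interior vertex is outside the set. -/
theorem IsGPSet.isMPSet_of_subsingleton_compl {S : Set V} (h : G.IsGPSet S)
    (hS : Sᶜ.Subsingleton) : G.IsMPSet S := by
  refine isMPSet_iff.2 ?_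
  rintro _ h0S _ hjS _ hnS ⟨f, n, j, hf, h0, hn, rfl, rfl, rfl⟩
  have hout : ∀ a ≤ n, ∀ b ≤ n, f a ∉ S → f b ∉ S → a = b := fun a ha b hb h1 h2 =>
    (hf a ha b hb).1 (hS h1 h2)
  have three : ∀ a, a + 2 ≤ n → f a ∈ S → f (a + 1) ∈ S → f (a + 2) ∈ S → False := by
    intro a ha h1 h2 h3
    have := h.adj_of_adj_adj h1 h2 h3 ((hf a (by omega) (a + 1) (by omega)).2.2 (by omega))
      ((hf (a + 1) (by omega) (a + 2) (by omega)).2.2 (by omega))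
      (fun e => by have := (hf a (by omega) (a + 2) ha).1 e; omega)
    have := (hf a (by omega) (a + 2) ha).2.1 this
    omega
  -- The four vertices `u, v, t, w` are consecutive and only `t` is outside `S`.
  have four : ∀ u ∈ S, ∀ v ∈ S, ∀ w ∈ S, ∀ t, t ∉ S → G.Adj u v → G.Adj v t → G.Adj t w →
      ¬ G.Adj u t → ¬ G.Adj u w → ¬ G.Adj v w → u ≠ w → v ≠ w → False := by
    intro u hu v hv w hw t ht h1 h2 h3 h4 h5 h6 h7 h8
    obtain ⟨y, hy1, hy2⟩ := h.exists_common_neighbor hu hv hw h1 h2 h3 h7 h5 h8 h6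
    by_cases hy : y ∈ S
    · exact h5 (h.adj_of_adj_adj hu hy hw hy1 hy2 h7)
    · exact h4 (hS hy ht ▸ hy1)
  have adj : ∀ a ≤ n, ∀ b ≤ n, (G.Adj (f a) (f b) ↔ a + 1 = b ∨ b + 1 = a) :=
    fun a ha b hb => (hf a ha b hb).2
  have ne : ∀ a ≤ n, ∀ b ≤ n, a ≠ b → f a ≠ f b := fun a ha b hb hab e =>
    hab ((hf a ha b hb).1 e)
  have right : ∀ a, a + 3 ≤ n → f a ∈ S → f (a + 1) ∈ S → f (a + 2) ∉ S → f (a + 3) ∈ S →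
      False := by
    intro a ha h1 h2 h3 h4
    refine four _ h1 _ h2 _ h4 _ h3 ?_ ?_ ?_ ?_ ?_ ?_ ?_ ?_
    all_goals first
      | rw [adj _ (by omega) _ (by omega)]; omega
      | exact ne _ (by omega) _ (by omega) (by omega)
  have left : ∀ a, a + 3 ≤ n → f a ∈ S → f (a + 1) ∉ S → f (a + 2) ∈ S → f (a + 3) ∈ S →
      False := by
    intro a ha h1 h2 h3 h4
    refine four _ h4 _ h3 _ h1 _ h2 ?_ ?_ ?_ ?_ ?_ ?_ ?_ ?_
    all_goals first
      | rw [adj _ (by omega) _ (by omega)]; omega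
      | exact ne _ (by omega) _ (by omega) (by omega)
  by_cases h1 : f 1 ∈ S
  · have h2 : f 2 ∉ S := fun h2 => three 0 (by omega) h0S h1 h2
    have hn2 : n ≠ 2 := fun e => h2 (e ▸ hnS)
    have h3 : f 3 ∈ S := by
      by_contra h3
      have := hout 2 (by omega) 3 (by omega) h2 h3
      omega
    exact right 0 (by omega) h0S h1 h2 h3
  · have in' : ∀ a ≤ n, a ≠ 1 → f a ∈ S := by
      intro a ha h2
      by_contra h3
      exact h2 (hout a ha 1 (by omega) h3 h1)
    have hj1 : j ≠ 1 := fun e => h1 (e ▸ hjS)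
    exact left 0 (by omega) h0S h1 (in' 2 (by omega) (by omega)) (in' 3 (by omega) (by omega))

theorem add_two_le_of_mem_positionOrders {a b n : ℕ} (hab : a < b)
    (h : n ∈ positionOrders a b) : b + 2 ≤ n := by
  obtain ⟨G, rfl, rfl⟩ := h
  by_contra! hn
  obtain ⟨S, hS, hc⟩ := exists_isGPSet G
  have h1 : Sᶜ.ncard ≤ 1 := by
    have := Set.ncard_add_ncard_compl S
    simp at this
    omega
  have := (hS.isMPSet_of_subsingleton_compl (Set.ncard_le_one_iff_subsingleton.1 h1)).ncard_le
  omega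

theorem mpNumber_eq_two [Finite V] (hV : 2 ≤ Nat.card V)
    (h : ∀ M : Set V, G.IsMPSet M → ∀ u ∈ M, ∀ v ∈ M, ∀ w ∈ M, u ≠ v → u ≠ w → v ≠ w → False) :
    G.mpNumber = 2 := by
  have : Nontrivial V := (Finite.one_lt_card_iff_nontrivial).1 (by omega)
  obtain ⟨x, y, hxy⟩ := exists_pair_ne V
  refine mpNumber_eq (S := {x, y}) (fun u v p _ => ?_) (Set.ncard_pair hxy) fun M hM => ?_
  · exact (Set.ncard_le_ncard Set.inter_subset_left).trans (Set.ncard_pair hxy).le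
  · by_contra! hc
    obtain ⟨u, v, w, hu, hv, hw, h1, h2, h3⟩ := (Set.two_lt_ncard_iff).1 hc
    exact h M hM u hu v hv w hw h1 h2 h3

/-- The cycle of order five. -/
def pentagon : SimpleGraph (Fin 5) where
  Adj i j := i = j + 1 ∨ j = i + 1
  symm := ⟨fun _ _ h => h.symm⟩
  loopless := ⟨by decide⟩

instance : DecidableRel pentagon.Adj := fun _ _ => inferInstanceAs (Decidable (_ ∨ _))

/-- The cube graph with one vertex deleted: its vertices `3, 4, 5, 6` are the subsets of
`{0, 1, 2}` with at least two elements. -/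
def cubeMinusVertex : SimpleGraph (Fin 7) where
  Adj i j := (i, j) ∈ [(0, 3), (1, 3), (2, 3), (1, 4), (2, 4), (0, 5), (2, 5), (0, 6), (1, 6)] ∨
    (j, i) ∈ [(0, 3), (1, 3), (2, 3), (1, 4), (2, 4), (0, 5), (2, 5), (0, 6), (1, 6)]
  symm := ⟨fun _ _ h => h.symm⟩
  loopless := ⟨by decide⟩

instance : DecidableRel cubeMinusVertex.Adj := fun _ _ => inferInstanceAs (Decidable (_ ∨ _))

theorem gpNumber_eq_of_finset {n : ℕ} {G : SimpleGraph (Fin n)} {b : ℕ} {S : Set (Fin n)}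
    (hS : G.IsGPSet S) (hb : S.ncard = b)
    (h : ∀ M : Finset (Fin n), b < M.card → ∃ u ∈ M, ∃ v ∈ M, ∃ w ∈ M, G.Adj u v ∧ G.Adj v w ∧
      u ≠ w ∧ ¬ G.Adj u w) : G.gpNumber = b := by
  classical
  refine gpNumber_eq hS hb fun M hM => ?_
  by_contra! hc
  rw [Set.ncard_eq_toFinset_card'] at hc
  obtain ⟨u, hu, v, hv, w, hw, h1, h2, h3, h4⟩ := h _ hc
  simp only [Set.mem_toFinset] at hu hv hw
  exact h4 (hM.adj_of_adj_adj hu hv hw h1 h2 h3)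

theorem five_mem_positionOrders : 5 ∈ positionOrders 2 3 := by
  have h := card_mem_positionOrders pentagon
  have h2 : pentagon.mpNumber = 2 := by
    refine mpNumber_eq_two (by simp) fun M hM u hu v hv w hw h1 h2 h3 => ?_
    have key : ∀ u v w : Fin 5, u ≠ v → u ≠ w → v ≠ w → ∃ i : Fin 5,
        pentagon.IsInducedList [i, i + 1, i + 2, i + 3] ∧ u ∈ [i, i + 1, i + 2, i + 3] ∧
        v ∈ [i, i + 1, i + 2, i + 3] ∧ w ∈ [i, i + 1, i + 2, i + 3] := by decide +kernel
    obtain ⟨i, hi, h4, h5, h6⟩ := key u v w h1 h2 h3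
    exact hM.false_of_list hi hu hv hw h4 h5 h6 h1 h2 h3
  have h3 : pentagon.gpNumber = 3 := by
    refine gpNumber_eq_of_finset (S := ↑({0, 1, 3} : Finset (Fin 5))) ?_ ?_ ?_
    · refine isGPSet_of_dist_le_two ?_ ?_ <;> simp only [Finset.mem_coe] <;> decide +kernel
    · rw [Set.ncard_coe_finset]; rfl
    · decide +kernel
  rwa [h2, h3, Nat.card_eq_fintype_card, Fintype.card_fin] at h

theorem seven_mem_positionOrders : 7 ∈ positionOrders 2 4 := by
  have h := card_mem_positionOrders cubeMinusVertex
  have h2 : cubeMinusVertex.mpNumber = 2 := by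
    refine mpNumber_eq_two (by simp) fun M hM u hu v hv w hw h1 h2 h3 => ?_
    have key : ∀ u v w : Fin 7, u ≠ v → u ≠ w → v ≠ w →
        ∃ L ∈ ([[0, 5, 2, 4, 1], [4, 2, 3, 0, 6], [5, 2, 3, 1, 6], [4, 1, 3, 0, 5],
          [4, 1, 6, 0, 5]] : List (List (Fin 7))),
          cubeMinusVertex.IsInducedList L ∧ u ∈ L ∧ v ∈ L ∧ w ∈ L := by decide +kernel
    obtain ⟨L, -, hi, h4, h5, h6⟩ := key u v w h1 h2 h3
    exact hM.false_of_list hi hu hv hw h4 h5 h6 h1 h2 h3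
  have h3 : cubeMinusVertex.gpNumber = 4 := by
    refine gpNumber_eq_of_finset (S := ↑({3, 4, 5, 6} : Finset (Fin 7))) ?_ ?_ ?_
    · refine isGPSet_of_dist_le_two ?_ ?_ <;> simp only [Finset.mem_coe] <;> decide +kernel
    · rw [Set.ncard_coe_finset]; rfl
    · decide +kernel
  rwa [h2, h3, Nat.card_eq_fintype_card, Fintype.card_fin] at h

end SimpleGraph

end

section

namespace SimpleGraph

/-! ### The pagoda graphs -/

/-- Vertices of the pagoda graph: an apex, a lower layer indexed by `Fin m`, and a middle layer
consisting of one vertex `mid true i` for each `i : Fin m` and one vertex `mid false i` for each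
`i < k`. -/
inductive PagodaVertex (m k : ℕ)
  | apex : PagodaVertex m k
  | mid (t : Bool) (i : Fin m) (h : t = true ∨ i.1 < k) : PagodaVertex m k
  | low (i : Fin m) : PagodaVertex m k

namespace PagodaVertex

variable {m k : ℕ}

/-- The middle layer of the pagoda graph as a type of pairs. -/
abbrev Middle (m k : ℕ) := {z : Bool × Fin m // z.1 = true ∨ z.2.1 < k}

/-- The pagoda vertices, sorted by layer. -/
def equivSum (m k : ℕ) : PagodaVertex m k ≃ Unit ⊕ Middle m k ⊕ Fin m where
  toFun
    | apex => .inl ()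
    | mid t i h => .inr (.inl ⟨(t, i), h⟩)
    | low i => .inr (.inr i)
  invFun
    | .inl _ => apex
    | .inr (.inl z) => mid z.1.1 z.1.2 z.2
    | .inr (.inr i) => low i
  left_inv v := by cases v <;> rfl
  right_inv v := by rcases v with _ | z | _ <;> rfl

instance : Finite (PagodaVertex m k) := .of_equiv _ (equivSum m k).symm

theorem card_middle (hk : k ≤ m) : Nat.card (Middle m k) = m + k := by
  let e : Middle m k ≃ Fin m ⊕ Fin k :=
    { toFun := fun z => match z with
        | ⟨(true, i), _⟩ => .inl i
        | ⟨(false, i), h⟩ => .inr ⟨i.1, by simpa using h⟩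
      invFun := fun s => match s with
        | .inl i => ⟨(true, i), .inl rfl⟩
        | .inr i => ⟨(false, ⟨i.1, by omega⟩), .inr i.2⟩
      left_inv := by rintro ⟨⟨_ | _, i⟩, h⟩ <;> rfl
      right_inv := by rintro (i | i) <;> rfl }
  rw [Nat.card_congr e]; simp

theorem card_eq (hk : k ≤ m) : Nat.card (PagodaVertex m k) = 2 * m + k + 1 := by
  rw [Nat.card_congr (equivSum m k), Nat.card_sum, Nat.card_sum, card_middle hk]
  simp; omega

/-- Adjacency in the pagoda graph: the apex is joined to all `mid true i`, and a middle vertex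
is joined to the lower vertices of different index. -/
def Adj : PagodaVertex m k → PagodaVertex m k → Prop
  | apex, mid t _ _ => t = true
  | mid t _ _, apex => t = true
  | mid _ i _, low j => i ≠ j
  | low j, mid _ i _ => i ≠ j
  | _, _ => False

end PagodaVertex

open PagodaVertex

variable {m k : ℕ}

/-- The pagoda graph. -/
def pagoda (m k : ℕ) : SimpleGraph (PagodaVertex m k) where
  Adj := PagodaVertex.Adj
  symm := ⟨fun u v h => by cases u <;> cases v <;> exact h⟩
  loopless := ⟨fun u h => by cases u <;> exact h⟩

@[simp] theorem pagoda_adj (u v : PagodaVertex m k) : (pagoda m k).Adj u v ↔ u.Adj v := Iff.rfl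

/-- The middle layer of the pagoda graph. -/
def pagodaMiddle (m k : ℕ) : Set (PagodaVertex m k) := {v | ∃ t i h, v = mid t i h}

theorem ncard_pagodaMiddle (hk : k ≤ m) : (pagodaMiddle m k).ncard = m + k := by
  rw [← card_middle hk, ← Set.ncard_univ, ← Set.ncard_image_of_injective (f := fun z : Middle m k =>
    (mid z.1.1 z.1.2 z.2 : PagodaVertex m k)) Set.univ (fun a b h => by
      obtain ⟨⟨_, _⟩, _⟩ := a
      obtain ⟨⟨_, _⟩, _⟩ := b
      simpa using h)]
  congr 1
  ext v
  simp only [pagodaMiddle, Set.mem_ofPred_eq, Set.image_univ, Set.mem_range]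
  constructor
  · rintro ⟨t, i, h, rfl⟩; exact ⟨⟨(t, i), h⟩, rfl⟩
  · rintro ⟨z, rfl⟩; exact ⟨_, _, z.2, rfl⟩

theorem exists_ne_ne (hm : 3 ≤ m) (i j : Fin m) : ∃ l, i ≠ l ∧ j ≠ l := by
  by_contra! h
  have h0 := h ⟨0, by omega⟩
  have h1 := h ⟨1, by omega⟩
  have h2 := h ⟨2, by omega⟩
  simp only [ne_eq, Fin.ext_iff] at h0 h1 h2
  omega

theorem isGPSet_pagodaMiddle (hm : 3 ≤ m) : (pagoda m k).IsGPSet (pagodaMiddle m k) := by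
  refine isGPSet_of_dist_le_two ?_ ?_
  · rintro _ ⟨t, i, h, rfl⟩ _ ⟨t', i', h', rfl⟩ - -
    obtain ⟨l, h1, h2⟩ := exists_ne_ne hm i i'
    exact ⟨low l, h1, h2⟩
  · rintro _ ⟨t, i, h, rfl⟩ _ ⟨t', i', h', rfl⟩ w - h1
    exact h1.elim

/-- Three vertices lie on a common induced path, given as a list. -/
def Covered {V : Type*} (G : SimpleGraph V) (u v w : V) : Prop :=
  ∃ L, G.IsInducedList L ∧ u ∈ L ∧ v ∈ L ∧ w ∈ L

theorem Covered.swap {V : Type*} {G : SimpleGraph V} {u v w : V} (h : G.Covered u v w) :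
    G.Covered v u w := by
  obtain ⟨L, h, h1, h2, h3⟩ := h; exact ⟨L, h, h2, h1, h3⟩

theorem Covered.rotate {V : Type*} {G : SimpleGraph V} {u v w : V} (h : G.Covered u v w) :
    G.Covered v w u := by
  obtain ⟨L, h, h1, h2, h3⟩ := h; exact ⟨L, h, h2, h3, h1⟩

theorem covered_mid_mid_mid_of_ne {t₁ t₂ t₃ : Bool} {i₁ i₂ i₃ : Fin m} (h₁ h₂ h₃) (h12 : i₁ ≠ i₂)
    (h13 : i₁ ≠ i₃) (h23 : i₂ ≠ i₃) :
    (pagoda m k).Covered (mid t₁ i₁ h₁) (mid t₂ i₂ h₂) (mid t₃ i₃ h₃) := by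
  refine ⟨[mid t₁ i₁ h₁, low i₃, mid t₂ i₂ h₂, low i₁, mid t₃ i₃ h₃], ?_, by simp, by simp,
    by simp⟩
  simp [IsInducedList, PagodaVertex.Adj, *, Ne.symm]

theorem covered_mid_mid_mid_of_eq {i j : Fin m} {t : Bool} (h₁ h₂ h₃) (hij : i ≠ j) :
    (pagoda m k).Covered (mid true i h₁) (mid false i h₂) (mid t j h₃) := by
  cases t with
  | true =>
    refine ⟨[mid false i h₂, low j, mid true i h₁, apex, mid true j h₃], ?_, by simp, by simp,
      by simp⟩
    simp [IsInducedList, PagodaVertex.Adj, *, Ne.symm]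
  | false =>
    refine ⟨[mid false i h₂, low j, mid true i h₁, apex, mid true j (.inl rfl), low i,
      mid false j h₃], ?_, by simp, by simp, by simp⟩
    simp [IsInducedList, PagodaVertex.Adj, *, Ne.symm]

theorem covered_mid_mid_mid {t₁ t₂ t₃ : Bool} {i₁ i₂ i₃ : Fin m} (h₁ h₂ h₃)
    (h12 : mid t₁ i₁ h₁ ≠ mid t₂ i₂ h₂) (h13 : mid t₁ i₁ h₁ ≠ mid t₃ i₃ h₃)
    (h23 : mid t₂ i₂ h₂ ≠ mid t₃ i₃ h₃) :
    (pagoda m k).Covered (mid t₁ i₁ h₁) (mid t₂ i₂ h₂) (mid t₃ i₃ h₃) := by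
  have key : ∀ {t₁ t₂ t₃ : Bool} {i j : Fin m} (h₁ h₂ h₃), t₁ ≠ t₂ → i ≠ j →
      (pagoda m k).Covered (mid t₁ i h₁) (mid t₂ i h₂) (mid t₃ j h₃) := by
    intro t₁ t₂ t₃ i j h₁ h₂ h₃ ht hij
    cases t₁ <;> cases t₂
    · exact (ht rfl).elim
    · exact (covered_mid_mid_mid_of_eq _ _ _ hij).swap
    · exact covered_mid_mid_mid_of_eq _ _ _ hij
    · exact (ht rfl).elim
  by_cases e12 : i₁ = i₂
  · subst e12
    have ht : t₁ ≠ t₂ := fun e => by subst e; exact h12 rfl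
    have e13 : i₁ ≠ i₃ := fun e => by
      subst e; cases t₁ <;> cases t₂ <;> cases t₃ <;> simp_all
    exact key _ _ _ ht e13
  by_cases e13 : i₁ = i₃
  · subst e13
    have ht : t₁ ≠ t₃ := fun e => by subst e; exact h13 rfl
    exact (key h₁ h₃ h₂ ht e12).rotate.rotate.swap
  by_cases e23 : i₂ = i₃
  · subst e23
    have ht : t₂ ≠ t₃ := fun e => by subst e; exact h23 rfl
    exact (key h₂ h₃ h₁ ht (Ne.symm e12)).rotate.rotate
  exact covered_mid_mid_mid_of_ne _ _ _ e12 e13 e23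

theorem covered_mid_mid_low (hm : 3 ≤ m) {t₁ t₂ : Bool} {i₁ i₂ j : Fin m} (h₁ h₂)
    (h12 : mid t₁ i₁ h₁ ≠ mid t₂ i₂ h₂) :
    (pagoda m k).Covered (mid t₁ i₁ h₁) (mid t₂ i₂ h₂) (low j) := by
  by_cases e1 : i₁ = j <;> by_cases e2 : i₂ = j
  · subst e1
    subst e2
    obtain ⟨l, hl, -⟩ := exists_ne_ne hm i₂ i₂
    have key : ∀ h₁ h₂, (pagoda m k).Covered (mid true i₂ h₁) (mid false i₂ h₂) (low i₂) := by
      intro h₁ h₂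
      refine ⟨[mid false i₂ h₂, low l, mid true i₂ h₁, apex, mid true l (.inl rfl), low i₂], ?_,
        by simp, by simp, by simp⟩
      simp [IsInducedList, PagodaVertex.Adj, *, Ne.symm]
    cases t₁ <;> cases t₂
    · exact (h12 rfl).elim
    · exact (key _ _).swap
    · exact key _ _
    · exact (h12 rfl).elim
  · subst e1
    obtain ⟨l, hl, hl'⟩ := exists_ne_ne hm i₁ i₂
    refine ⟨[mid t₁ i₁ h₁, low l, mid t₂ i₂ h₂, low i₁], ?_, by simp, by simp, by simp⟩
    simp [IsInducedList, PagodaVertex.Adj, *, Ne.symm]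
  · subst e2
    obtain ⟨l, hl, hl'⟩ := exists_ne_ne hm i₁ i₂
    refine ⟨[mid t₂ i₂ h₂, low l, mid t₁ i₁ h₁, low i₂], ?_, by simp, by simp, by simp⟩
    simp [IsInducedList, PagodaVertex.Adj, *, Ne.symm]
  · refine ⟨[mid t₁ i₁ h₁, low j, mid t₂ i₂ h₂], ?_, by simp, by simp, by simp⟩
    simp [IsInducedList, PagodaVertex.Adj, *]

theorem covered_mid_low_low (hm : 3 ≤ m) {t : Bool} {i j l : Fin m} (h) (hjl : j ≠ l) :
    (pagoda m k).Covered (mid t i h) (low j) (low l) := by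
  have key : ∀ {j l : Fin m}, j ≠ l → i = j → (pagoda m k).Covered (mid t i h) (low j) (low l) := by
    rintro j l hjl rfl
    obtain ⟨n, hn, hn'⟩ := exists_ne_ne hm i l
    refine ⟨[low i, mid true n (.inl rfl), low l, mid t i h], ?_, by simp, by simp, by simp⟩
    simp [IsInducedList, PagodaVertex.Adj, *, Ne.symm]
  by_cases e1 : i = j
  · exact key hjl e1
  by_cases e2 : i = l
  · exact (key hjl.symm e2).rotate.swap.rotate.rotate
  · refine ⟨[low j, mid t i h, low l], ?_, by simp, by simp, by simp⟩
    simp [IsInducedList, PagodaVertex.Adj, *]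

theorem covered_low_low_low {i j l : Fin m} (hij : i ≠ j) (hil : i ≠ l) (hjl : j ≠ l) :
    (pagoda m k).Covered (low i) (low j) (low l) := by
  refine ⟨[low i, mid true l (.inl rfl), low j, mid true i (.inl rfl), low l], ?_, by simp,
    by simp, by simp⟩
  simp [IsInducedList, PagodaVertex.Adj, *, Ne.symm]

theorem covered_apex_mid_mid (hm : 3 ≤ m) {t₁ t₂ : Bool} {i j : Fin m} (h₁ h₂)
    (h12 : mid t₁ i h₁ ≠ mid t₂ j h₂) :
    (pagoda m k).Covered apex (mid t₁ i h₁) (mid t₂ j h₂) := by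
  obtain ⟨l, hl, hl'⟩ := exists_ne_ne hm i j
  cases t₁ <;> cases t₂
  · have hij : i ≠ j := fun e => h12 (by subst e; rfl)
    refine ⟨[apex, mid true l (.inl rfl), low j, mid false i h₁, low l, mid false j h₂], ?_,
      by simp, by simp, by simp⟩
    simp [IsInducedList, PagodaVertex.Adj, *, Ne.symm]
  · refine ⟨[apex, mid true j h₂, low l, mid false i h₁], ?_, by simp, by simp, by simp⟩
    simp [IsInducedList, PagodaVertex.Adj, *, Ne.symm]
  · refine ⟨[apex, mid true i h₁, low l, mid false j h₂], ?_, by simp, by simp, by simp⟩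
    simp [IsInducedList, PagodaVertex.Adj, *, Ne.symm]
  · refine ⟨[mid true i h₁, apex, mid true j h₂], ?_, by simp, by simp, by simp⟩
    have hij : i ≠ j := fun e => h12 (by subst e; rfl)
    simp [IsInducedList, PagodaVertex.Adj, *]

theorem covered_apex_mid_low (hm : 3 ≤ m) {t : Bool} {i j : Fin m} (h) :
    (pagoda m k).Covered apex (mid t i h) (low j) := by
  obtain ⟨l, hl, hl'⟩ := exists_ne_ne hm i j
  by_cases e : i = j
  · subst e
    cases t
    · refine ⟨[low i, mid true l (.inl rfl), apex, mid true i (.inl rfl), low l, mid false i h],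
        ?_, by simp, by simp, by simp⟩
      simp [IsInducedList, PagodaVertex.Adj, *, Ne.symm]
    · refine ⟨[mid true i h, apex, mid true l (.inl rfl), low i], ?_, by simp, by simp, by simp⟩
      simp [IsInducedList, PagodaVertex.Adj, *, Ne.symm]
  · cases t
    · refine ⟨[apex, mid true l (.inl rfl), low j, mid false i h], ?_, by simp, by simp, by simp⟩
      simp [IsInducedList, PagodaVertex.Adj, *, Ne.symm]
    · refine ⟨[apex, mid true i h, low j], ?_, by simp, by simp, by simp⟩
      simp [IsInducedList, PagodaVertex.Adj, *]

theorem covered_apex_low_low {i j : Fin m} (hij : i ≠ j) :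
    (pagoda m k).Covered apex (low i) (low j) := by
  refine ⟨[low i, mid true j (.inl rfl), apex, mid true i (.inl rfl), low j], ?_, by simp, by simp,
    by simp⟩
  simp [IsInducedList, PagodaVertex.Adj, *, Ne.symm]

theorem covered_pagoda (hm : 3 ≤ m) {u v w : PagodaVertex m k} (huv : u ≠ v) (huw : u ≠ w)
    (hvw : v ≠ w) : (pagoda m k).Covered u v w := by
  match u, v, w with
  | apex, apex, _ => exact (huv rfl).elim
  | apex, mid .., apex => exact (huw rfl).elim
  | apex, low _, apex => exact (huw rfl).elim
  | mid .., apex, apex => exact (hvw rfl).elim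
  | low _, apex, apex => exact (hvw rfl).elim
  | mid .., mid .., mid .. => exact covered_mid_mid_mid _ _ _ huv huw hvw
  | mid .., mid .., low _ => exact covered_mid_mid_low hm _ _ huv
  | low _, mid .., mid .. => exact (covered_mid_mid_low hm _ _ hvw).rotate.rotate
  | mid .., low _, mid .. => exact (covered_mid_mid_low hm _ _ huw.symm).rotate
  | mid .., low _, low _ => exact covered_mid_low_low hm _ (by simpa using hvw)
  | low _, mid .., low _ => exact (covered_mid_low_low hm _ (by simpa using huw.symm)).rotate.rotate
  | low _, low _, mid .. => exact (covered_mid_low_low hm _ (by simpa using huv)).rotate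
  | low _, low _, low _ =>
    exact covered_low_low_low (by simpa using huv) (by simpa using huw) (by simpa using hvw)
  | apex, mid .., mid .. => exact covered_apex_mid_mid hm _ _ hvw
  | mid .., apex, mid .. => exact (covered_apex_mid_mid hm _ _ huw.symm).rotate.rotate
  | mid .., mid .., apex => exact (covered_apex_mid_mid hm _ _ huv).rotate
  | apex, low _, low _ => exact covered_apex_low_low (by simpa using hvw)
  | low _, apex, low _ => exact (covered_apex_low_low (by simpa using huw.symm)).rotate.rotate
  | low _, low _, apex => exact (covered_apex_low_low (by simpa using huv)).rotate
  | apex, mid .., low _ => exact covered_apex_mid_low hm _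
  | mid .., apex, low _ => exact (covered_apex_mid_low hm _).swap
  | mid .., low _, apex => exact (covered_apex_mid_low hm _).rotate
  | low _, apex, mid .. => exact (covered_apex_mid_low hm _).rotate.rotate
  | apex, low _, mid .. => exact (covered_apex_mid_low hm _).swap.rotate
  | low _, mid .., apex => exact (covered_apex_mid_low hm _).swap.rotate.rotate

theorem mpNumber_pagoda (hm : 3 ≤ m) (hk : k ≤ m) : (pagoda m k).mpNumber = 2 := by
  refine mpNumber_eq_two (by rw [card_eq hk]; omega) fun M hM u hu v hv w hw h1 h2 h3 => ?_
  obtain ⟨L, hL, h4, h5, h6⟩ := covered_pagoda hm h1 h2 h3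
  exact hM.false_of_list hL hu hv hw h4 h5 h6 h1 h2 h3

end SimpleGraph

end

section

namespace SimpleGraph
open PagodaVertex
variable {m k : ℕ}

theorem ncard_setOf_mid_le (j : Fin m) :
    {v : PagodaVertex m k | ∃ t h, v = mid t j h}.ncard ≤ 2 := by
  have h : {v : PagodaVertex m k | ∃ t h, v = mid t j h} ⊆
      (fun t : Bool => if h : t = true ∨ j.1 < k then mid t j h else apex) '' Set.univ := by
    rintro _ ⟨t, h, rfl⟩
    exact ⟨t, trivial, by simp only [h, dif_pos]⟩
  exact (Set.ncard_le_ncard h).trans ((Set.ncard_image_le).trans (by simp))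

/-- A set in general position that contains a lower vertex contains at most one middle vertex of
another index, and one that contains the apex and a vertex `mid true i` contains no other middle
vertex. Hence the middle layer is as large as possible. -/
theorem IsGPSet.ncard_le_of_pagoda (hm : 3 ≤ m) (hk : k ≤ m) (hmk : m ≤ k + 1)
    {M : Set (PagodaVertex m k)} (hM : (pagoda m k).IsGPSet M) : M.ncard ≤ m + k := by
  have F1 : ∀ j t i h t' i' h', low j ∈ M → mid t i h ∈ M → mid t' i' h' ∈ M → i ≠ j → i' ≠ j →
      (mid t i h : PagodaVertex m k) = mid t' i' h' := by
    intro j t i h t' i' h' h1 h2 h3 h4 h5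
    by_contra hne
    exact hM.adj_of_adj_adj h2 h1 h3 h4 h5 hne
  have F2 : ∀ j l t i h, low j ∈ M → low l ∈ M → mid t i h ∈ M → i ≠ j → i ≠ l → j = l := by
    intro j l t i h h1 h2 h3 h4 h5
    by_contra hne
    exact hM.adj_of_adj_adj h1 h3 h2 h4 h5 (by simpa using hne)
  have F3 : ∀ i h t j h', apex ∈ M → mid true i h ∈ M → mid t j h' ∈ M →
      (mid t j h' : PagodaVertex m k) = mid true i h := by
    intro i h t j h' h1 h2 h3
    by_contra hne
    cases t
    · obtain ⟨l, hl, hl'⟩ := exists_ne_ne hm i j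
      obtain ⟨y, hy1, hy2⟩ := hM.exists_common_neighbor h1 h2 h3 (t := low l) rfl hl hl' (by simp)
        (by simp [PagodaVertex.Adj]) (by simp) (by simp [PagodaVertex.Adj])
      cases y
      · exact hy1
      · exact hy2
      · exact hy1
    · exact hM.adj_of_adj_adj h3 h1 h2 rfl rfl hne
  set D := M ∩ pagodaMiddle m k with hD
  set L := M ∩ Set.range low with hL
  have hsub : M ⊆ insert apex (L ∪ D) := by
    intro v hv
    cases v with
    | apex => exact Or.inl rfl
    | mid t i h => exact Or.inr (Or.inr ⟨hv, t, i, h, rfl⟩)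
    | low i => exact Or.inr (Or.inl ⟨hv, i, rfl⟩)
  have hcard : M.ncard ≤ L.ncard + D.ncard + 1 :=
    (Set.ncard_le_ncard hsub).trans ((Set.ncard_insert_le _ _).trans
      (Nat.add_le_add_right (Set.ncard_union_le _ _) 1))
  have hDle : D.ncard ≤ m + k :=
    (Set.ncard_le_ncard Set.inter_subset_right).trans (ncard_pagodaMiddle hk).le
  have hLle : L.ncard ≤ m := by
    refine (Set.ncard_le_ncard Set.inter_subset_right).trans ?_
    rw [← Set.image_univ]
    exact (Set.ncard_image_le).trans (by simp)
  rcases L.eq_empty_or_nonempty with hL0 | ⟨_, hj, j, rfl⟩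
  · by_cases ha : apex ∈ M
    · by_cases hmid : ∃ i h, mid true i h ∈ M
      · obtain ⟨i, h, hi⟩ := hmid
        have : D ⊆ {mid true i h} := by
          rintro _ ⟨hv, t, l, h', rfl⟩
          exact F3 _ _ _ _ _ ha hi hv
        have := Set.ncard_le_ncard this
        rw [Set.ncard_singleton] at this
        rw [hL0, Set.ncard_empty] at hcard
        omega
      · have : D ⊆ pagodaMiddle m k \ {mid true ⟨0, by omega⟩ (.inl rfl)} := by
          intro v hv
          exact ⟨hv.2, fun e => hmid ⟨_, _, e ▸ hv.1⟩⟩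
        have := Set.ncard_le_ncard this
        rw [Set.ncard_sdiff_singleton_of_mem (show _ ∈ pagodaMiddle m k from ⟨_, _, _, rfl⟩),
          ncard_pagodaMiddle hk] at this
        rw [hL0, Set.ncard_empty] at hcard
        omega
    · have : M ⊆ D := by
        intro v hv
        rcases hsub hv with rfl | h | h
        · exact (ha hv).elim
        · simp [hL0] at h
        · exact h
      exact (Set.ncard_le_ncard this).trans hDle
  rcases D.eq_empty_or_nonempty with hD0 | ⟨_, hs, t, i, h, rfl⟩
  · rw [hD0, Set.ncard_empty] at hcard
    omega
  have hout : ∀ j, low j ∈ M → (D \ {v | ∃ t h, v = mid t j h}).ncard ≤ 1 := by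
    intro j hj
    rw [Set.ncard_le_one_iff_subsingleton]
    rintro _ ⟨⟨h1, t, i, h, rfl⟩, h2⟩ _ ⟨⟨h1', t', i', h', rfl⟩, h2'⟩
    exact F1 j _ _ _ _ _ _ hj h1 h1' (by rintro rfl; exact h2 ⟨_, _, rfl⟩)
      (by rintro rfl; exact h2' ⟨_, _, rfl⟩)
  have hsplit : ∀ A : Set (PagodaVertex m k), D.ncard ≤ (D ∩ A).ncard + (D \ A).ncard := fun A =>
    (congrArg Set.ncard (Set.inter_union_sdiff D A)).symm.le.trans (Set.ncard_union_le _ _)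
  by_cases hL1 : ∃ l, low l ∈ M ∧ j ≠ l
  · obtain ⟨l, hl, hjl⟩ := hL1
    have hL2 : L.ncard ≤ 2 := by
      have h1 : (L \ {low i}).ncard ≤ 1 := by
        rw [Set.ncard_le_one_iff_subsingleton]
        rintro _ ⟨⟨h1, a, rfl⟩, h2⟩ _ ⟨⟨h1', a', rfl⟩, h2'⟩
        rw [F2 a a' t i h h1 h1' hs (by rintro rfl; exact h2 rfl) (by rintro rfl; exact h2' rfl)]
      have h2 : L ⊆ insert (low i) (L \ {low i}) := fun v hv =>
        (em (v = low i)).imp id fun e => ⟨hv, e⟩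
      have h3 := (Set.ncard_le_ncard h2).trans (Set.ncard_insert_le _ _)
      omega
    have h1 := hout l hl
    have h2 : (D ∩ {v | ∃ t h, v = mid t l h}).ncard ≤ 1 := by
      refine (Set.ncard_le_ncard ?_).trans (hout j hj)
      rintro _ ⟨hv, t', h', rfl⟩
      refine ⟨hv, ?_⟩
      rintro ⟨t'', h'', e⟩
      simp only [mid.injEq] at e
      exact hjl e.2.symm
    have h3 := hsplit {v | ∃ t h, v = mid t l h}
    omega
  · push Not at hL1
    have hL2 : L.ncard ≤ 1 := by
      rw [Set.ncard_le_one_iff_subsingleton]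
      rintro _ ⟨h1, a, rfl⟩ _ ⟨h1', a', rfl⟩
      rw [← hL1 a h1, ← hL1 a' h1']
    have h1 := hout j hj
    have h2 := (Set.ncard_le_ncard (Set.inter_subset_right (s := D))).trans
      (ncard_setOf_mid_le (k := k) j)
    have h3 := hsplit {v | ∃ t h, v = mid t j h}
    omega

theorem pagoda_mem_positionOrders {b : ℕ} (hb : 5 ≤ b) :
    (3 * b + 1) / 2 + 1 ∈ positionOrders 2 b := by
  have hm : 3 ≤ (b + 1) / 2 := by omega
  have hk : b / 2 ≤ (b + 1) / 2 := by omega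
  have h := card_mem_positionOrders (pagoda ((b + 1) / 2) (b / 2))
  rw [mpNumber_pagoda hm hk, gpNumber_eq (isGPSet_pagodaMiddle hm) (ncard_pagodaMiddle hk)
    (fun M hM => hM.ncard_le_of_pagoda hm hk (by omega)), card_eq hk] at h
  convert h using 1 <;> first | omega | (congr 1; omega)

end SimpleGraph

end

section

namespace SimpleGraph

/-! ### Spiders with an apex -/

/-- Vertices of a spider with `c + 1` legs. Leg `0` starts in the centre `joint 0` and runs
`joint 0, bone 0 false, bone 0 true, joint 1, bone 1 false, …, bone (r - 1) true`; leg `l + 1`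
consists of `foot l`, followed by `toe l` if `l < q`. -/
inductive SpiderVertex (r c q : ℕ)
  | joint (j : Fin r) : SpiderVertex r c q
  | bone (i : Fin r) (t : Bool) : SpiderVertex r c q
  | foot (l : Fin c) : SpiderVertex r c q
  | toe (l : Fin q) : SpiderVertex r c q

namespace SpiderVertex

variable {r c q : ℕ}

/-- The spider vertices, sorted by kind. -/
def equivSum (r c q : ℕ) : SpiderVertex r c q ≃ Fin r ⊕ (Fin r × Bool) ⊕ Fin c ⊕ Fin q where
  toFun
    | joint j => .inl j
    | bone i t => .inr (.inl (i, t))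
    | foot l => .inr (.inr (.inl l))
    | toe l => .inr (.inr (.inr l))
  invFun
    | .inl j => joint j
    | .inr (.inl z) => bone z.1 z.2
    | .inr (.inr (.inl l)) => foot l
    | .inr (.inr (.inr l)) => toe l
  left_inv v := by cases v <;> rfl
  right_inv v := by rcases v with _ | _ | _ | _ <;> rfl

instance : Finite (SpiderVertex r c q) := .of_equiv _ (equivSum r c q).symm

theorem card_eq (r c q : ℕ) : Nat.card (SpiderVertex r c q) = 3 * r + c + q := by
  rw [Nat.card_congr (equivSum r c q)]
  simp
  omega

/-- The leg of a vertex; the centre is counted to leg `0`. -/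
def leg : SpiderVertex r c q → ℕ
  | joint _ => 0
  | bone _ _ => 0
  | foot l => l.1 + 1
  | toe l => l.1 + 1

/-- The distance of a vertex from the centre within the spider. -/
def pos : SpiderVertex r c q → ℕ
  | joint j => 3 * j.1
  | bone i t => 3 * i.1 + (if t then 2 else 1)
  | foot _ => 1
  | toe _ => 2

theorem pos_joint (j : Fin r) : (joint j : SpiderVertex r c q).pos = 3 * j.1 := rfl

theorem pos_foot (l : Fin c) : (foot l : SpiderVertex r c q).pos = 1 := rfl

theorem leg_foot (l : Fin c) : (foot l : SpiderVertex r c q).leg = l.1 + 1 := rfl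

/-- The length of a leg. -/
def legLength (r q l : ℕ) : ℕ := if l = 0 then 3 * r - 1 else if l ≤ q then 2 else 1

theorem ext_leg_pos {u v : SpiderVertex r c q} (h1 : u.leg = v.leg) (h2 : u.pos = v.pos) :
    u = v := by
  rcases u with ⟨j, _⟩ | ⟨⟨i, _⟩, _ | _⟩ | ⟨l, _⟩ | ⟨l, _⟩ <;>
    rcases v with ⟨j, _⟩ | ⟨⟨i, _⟩, _ | _⟩ | ⟨l, _⟩ | ⟨l, _⟩ <;> simp [leg, pos] at * <;> omega

theorem leg_le (v : SpiderVertex r c q) (hq : q ≤ c) : v.leg ≤ c := by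
  rcases v with ⟨j, _⟩ | ⟨⟨i, _⟩, _ | _⟩ | ⟨l, _⟩ | ⟨l, _⟩ <;> simp [leg] <;> omega

theorem leg_eq_zero_of_pos {v : SpiderVertex r c q} (h : v.pos = 0) : v.leg = 0 := by
  rcases v with ⟨j, _⟩ | ⟨⟨i, _⟩, _ | _⟩ | ⟨l, _⟩ | ⟨l, _⟩ <;> simp [leg, pos] at *

theorem pos_le (v : SpiderVertex r c q) : v.pos ≤ legLength r q v.leg := by
  rcases v with ⟨j, _⟩ | ⟨⟨i, _⟩, _ | _⟩ | ⟨l, _⟩ | ⟨l, _⟩ <;> simp [leg, pos, legLength] <;>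
    (try split_ifs) <;> omega

theorem exists_of_le {l p : ℕ} (hr : 1 ≤ r) (hl : l ≤ c) (hp : p ≤ legLength r q l) :
    ∃ v : SpiderVertex r c q, v.pos = p ∧ (p = 0 ∨ v.leg = l) := by
  by_cases hp0 : p = 0
  · exact ⟨joint ⟨0, by omega⟩, by simp [pos, hp0]⟩
  rw [legLength] at hp
  by_cases hl0 : l = 0
  · rw [if_pos hl0] at hp
    have h3 : p % 3 = 0 ∨ p % 3 = 1 ∨ p % 3 = 2 := by omega
    rcases h3 with h3 | h3 | h3
    · exact ⟨joint ⟨p / 3, by omega⟩, by simp only [pos]; omega, .inr hl0.symm⟩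
    · exact ⟨bone ⟨p / 3, by omega⟩ false, by simp [pos]; omega, .inr hl0.symm⟩
    · exact ⟨bone ⟨p / 3, by omega⟩ true, by simp [pos]; omega, .inr hl0.symm⟩
  · rw [if_neg hl0] at hp
    by_cases hp1 : p = 1
    · exact ⟨foot ⟨l - 1, by omega⟩, by simp [pos, hp1], .inr (by simp only [leg]; omega)⟩
    · split_ifs at hp
      · exact ⟨toe ⟨l - 1, by omega⟩, by simp only [pos]; omega, .inr (by simp only [leg]; omega)⟩
      · omega

end SpiderVertex

open SpiderVertex

variable {r c q : ℕ}

/-- A spider together with an apex `none` that is joined to all vertices except the joints, that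
is, to all vertices whose distance from the centre is not divisible by three. -/
def spider (r c q : ℕ) : SimpleGraph (Option (SpiderVertex r c q)) where
  Adj
    | none, none => False
    | none, some v => v.pos % 3 ≠ 0
    | some v, none => v.pos % 3 ≠ 0
    | some u, some v => (u.pos + 1 = v.pos ∧ (u.leg = v.leg ∨ u.pos = 0)) ∨
        (v.pos + 1 = u.pos ∧ (v.leg = u.leg ∨ v.pos = 0))
  symm := ⟨fun u v h => by
    rcases u with _ | u <;> rcases v with _ | v <;> first | exact h | exact h.symm⟩
  loopless := ⟨fun u h => by rcases u with _ | u; exacts [h, by simp at h]⟩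

theorem spider_adj_some {u v : SpiderVertex r c q} : (spider r c q).Adj (some u) (some v) ↔
    (u.pos + 1 = v.pos ∧ (u.leg = v.leg ∨ u.pos = 0)) ∨
      (v.pos + 1 = u.pos ∧ (v.leg = u.leg ∨ v.pos = 0)) := Iff.rfl

@[simp] theorem spider_adj_none_some {v : SpiderVertex r c q} :
    (spider r c q).Adj none (some v) ↔ v.pos % 3 ≠ 0 := Iff.rfl

@[simp] theorem spider_adj_some_none {v : SpiderVertex r c q} :
    (spider r c q).Adj (some v) none ↔ v.pos % 3 ≠ 0 := Iff.rfl

/-- The neighbourhood of the apex. -/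
def spiderBones (r c q : ℕ) : Set (Option (SpiderVertex r c q)) :=
  {z | ∃ v : SpiderVertex r c q, v.pos % 3 ≠ 0 ∧ z = some v}

theorem exists_eq_joint {v : SpiderVertex r c q} (h : v.pos % 3 = 0) : ∃ j, v = joint j := by
  rcases v with ⟨j, _⟩ | ⟨⟨i, _⟩, _ | _⟩ | ⟨l, _⟩ | ⟨l, _⟩ <;> simp [pos] at *

theorem ncard_range_joint : (Set.range fun j => some (joint j : SpiderVertex r c q)).ncard = r := by
  rw [← Set.image_univ, Set.ncard_image_of_injective _ (fun a b h => by simpa using h)]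
  simp

theorem ncard_spiderBones : (spiderBones r c q).ncard = 2 * r + c + q := by
  have h : (spiderBones r c q)ᶜ = insert none (Set.range fun j => some (joint j)) := by
    ext z
    constructor
    · intro hz
      rcases z with _ | v
      · exact .inl rfl
      · by_cases hv : v.pos % 3 = 0
        · obtain ⟨j, rfl⟩ := exists_eq_joint hv
          exact .inr ⟨j, rfl⟩
        · exact (hz ⟨v, hv, rfl⟩).elim
    · rintro (rfl | ⟨j, rfl⟩) ⟨v, hv, e⟩
      · simp at e
      · simp only [Option.some.injEq] at e
        subst e
        simp [pos] at hv
  have h1 := Set.ncard_add_ncard_compl (spiderBones r c q)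
  rw [h, Set.ncard_insert_of_notMem (by simp), ncard_range_joint, Finite.card_option, card_eq] at h1
  omega

/-- Two legs of the spider form an induced path. -/
theorem exists_two_leg_path (hr : 1 ≤ r) {l l' : ℕ} (hl : l ≤ c) (hl' : l' ≤ c) (hne : l ≠ l') :
    ∃ f n, (spider r c q).IsInducedSeq f n ∧ ∀ v : SpiderVertex r c q, v.leg = l ∨ v.leg = l' →
      ∃ i ≤ n, f i = some v := by
  have hP : ∀ l p : ℕ, ∃ v : SpiderVertex r c q, l ≤ c → p ≤ legLength r q l →
      v.pos = p ∧ (p = 0 ∨ v.leg = l) := by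
    intro l p
    by_cases h : l ≤ c ∧ p ≤ legLength r q l
    · obtain ⟨v, hv⟩ := exists_of_le (c := c) hr h.1 h.2
      exact ⟨v, fun _ _ => hv⟩
    · exact ⟨joint ⟨0, by omega⟩, fun h1 h2 => (h ⟨h1, h2⟩).elim⟩
  choose P hP using hP
  let g : ℕ → SpiderVertex r c q := fun i =>
    if i ≤ legLength r q l then P l (legLength r q l - i) else P l' (i - legLength r q l)
  -- The coordinates of the vertices of the path.
  have hg : ∀ i ≤ legLength r q l + legLength r q l',
      (i < legLength r q l → (g i).pos = legLength r q l - i ∧ (g i).leg = l) ∧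
      (i = legLength r q l → (g i).pos = 0 ∧ (g i).leg = 0) ∧
      (legLength r q l < i → (g i).pos = i - legLength r q l ∧ (g i).leg = l') := by
    intro i hi
    refine ⟨fun h => ?_, fun h => ?_, fun h => ?_⟩
    · simp only [g, if_pos h.le]
      obtain ⟨h1, h2⟩ := hP l (legLength r q l - i) hl (by omega)
      exact ⟨h1, h2.resolve_left (by omega)⟩
    · simp only [g, if_pos h.le]
      obtain ⟨h1, h2⟩ := hP l (legLength r q l - i) hl (by omega)
      have h3 : (P l (legLength r q l - i)).pos = 0 := by omega
      exact ⟨h3, leg_eq_zero_of_pos h3⟩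
    · simp only [g, if_neg (not_le.2 h)]
      obtain ⟨h1, h2⟩ := hP l' (i - legLength r q l) hl' (by omega)
      exact ⟨h1, h2.resolve_left (by omega)⟩
  refine ⟨fun i => some (g i), legLength r q l + legLength r q l', ?_, ?_⟩
  · intro i hi j hj
    have hi' := hg i hi
    have hj' := hg j hj
    constructor
    · intro e
      simp only [Option.some.injEq] at e
      rw [e] at hi'
      omega
    · simp only [spider_adj_some]
      omega
  · intro v hv
    have hpos := v.pos_le
    rcases hv with rfl | rfl
    · refine ⟨legLength r q v.leg - v.pos, by omega, congrArg some ?_⟩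
      obtain ⟨h1, h2, h3⟩ := hg (legLength r q v.leg - v.pos) (by omega)
      by_cases h0 : v.pos = 0
      · have := leg_eq_zero_of_pos h0
        exact ext_leg_pos (by omega) (by omega)
      · exact ext_leg_pos (by omega) (by omega)
    · refine ⟨legLength r q l + v.pos, by omega, congrArg some ?_⟩
      obtain ⟨h1, h2, h3⟩ := hg (legLength r q l + v.pos) (by omega)
      by_cases h0 : v.pos = 0
      · have := leg_eq_zero_of_pos h0
        exact ext_leg_pos (by omega) (by omega)
      · exact ext_leg_pos (by omega) (by omega)

end SimpleGraph

end

section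

namespace SimpleGraph
open SpiderVertex
variable {r c q : ℕ}

theorem not_three_adj {u v w : SpiderVertex r c q} (h1 : (spider r c q).Adj (some u) (some v))
    (h2 : (spider r c q).Adj (some u) (some w)) (h3 : (spider r c q).Adj (some v) (some w)) :
    False := by
  rw [spider_adj_some] at h1 h2 h3
  omega

theorem isGPSet_spiderBones : (spider r c q).IsGPSet (spiderBones r c q) := by
  refine isGPSet_of_dist_le_two ?_ ?_
  · rintro _ ⟨u, hu, rfl⟩ _ ⟨v, hv, rfl⟩ - -
    exact ⟨none, hu, hv⟩
  · rintro _ ⟨u, hu, rfl⟩ _ ⟨v, hv, rfl⟩ _ ⟨w, hw, rfl⟩ h1 h2 hne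
    rw [spider_adj_some] at h1 h2
    exact (hne (congrArg some (ext_leg_pos (by omega) (by omega)))).elim

/-- The first vertices of the legs form a set in monophonic position, since they have the centre
and the apex as common neighbours and lie in different components of the rest. -/
theorem isMPSet_firstVertices (hr : 1 ≤ r) :
    (spider r c q).IsMPSet {z | ∃ v : SpiderVertex r c q, v.pos = 1 ∧ z = some v} := by
  refine isMPSet_iff.2 ?_
  rintro _ ⟨u, hu, rfl⟩ _ ⟨v, hv, rfl⟩ _ ⟨w, hw, rfl⟩ ⟨f, n, j, hf, h0, hn, e0, ej, en⟩
  -- A common neighbour of the three vertices cannot lie on an induced path through them.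
  have hcommon : ∀ z, (spider r c q).Adj z (some u) → (spider r c q).Adj z (some v) →
      (spider r c q).Adj z (some w) → ∀ i ≤ n, f i ≠ z := by
    rintro z hzu hzv hzw i hi rfl
    rw [← e0, (hf i hi 0 (by omega)).2] at hzu
    rw [← ej, (hf i hi j (by omega)).2] at hzv
    rw [← en, (hf i hi n (by omega)).2] at hzw
    omega
  have hapex := hcommon none (by simp [hu]) (by simp [hv]) (by simp [hw])
  have hcentre := hcommon (some (joint ⟨0, hr⟩)) (by simp [spider_adj_some, pos_joint, hu])
    (by simp [spider_adj_some, pos_joint, hv]) (by simp [spider_adj_some, pos_joint, hw])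
  have hleg : ∀ i ≤ j, ∃ x : SpiderVertex r c q, f i = some x ∧ x.leg = u.leg := by
    intro i
    induction i with
    | zero => exact fun _ => ⟨u, e0, rfl⟩
    | succ i ih =>
      intro hi
      obtain ⟨x, hx, hxl⟩ := ih (by omega)
      have hadj := (hf i (by omega) (i + 1) (by omega)).2.2 (.inl rfl)
      have hy := hapex (i + 1) (by omega)
      have hx0 := hcentre i (by omega)
      have hy0 := hcentre (i + 1) (by omega)
      have zero : ∀ x : SpiderVertex r c q, x.pos = 0 → x = joint ⟨0, hr⟩ := fun x h =>
        ext_leg_pos (leg_eq_zero_of_pos h) h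
      rcases hfy : f (i + 1) with _ | y
      · exact (hy hfy).elim
      refine ⟨y, rfl, ?_⟩
      rw [hx, hfy, spider_adj_some] at hadj
      rw [hx] at hx0
      rw [hfy] at hy0
      have h1 : x.pos ≠ 0 := fun h => hx0 (congrArg some (zero x h))
      have h2 : y.pos ≠ 0 := fun h => hy0 (congrArg some (zero y h))
      omega
  obtain ⟨x, hx, hxl⟩ := hleg j le_rfl
  rw [ej, Option.some.injEq] at hx
  subst hx
  have : u = v := ext_leg_pos hxl.symm (by omega)
  have := (hf 0 (by omega) j (by omega)).1 (by rw [e0, ej, this])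
  omega

theorem ncard_firstVertices (hr : 1 ≤ r) :
    {z | ∃ v : SpiderVertex r c q, v.pos = 1 ∧ z = some v}.ncard = c + 1 := by
  have h : {z | ∃ v : SpiderVertex r c q, v.pos = 1 ∧ z = some v} =
      insert (some (bone ⟨0, hr⟩ false)) (Set.range fun l => some (foot l)) := by
    ext z
    constructor
    · rintro ⟨v, hv, rfl⟩
      rcases v with ⟨j, _⟩ | ⟨⟨i, _⟩, _ | _⟩ | l | ⟨l, _⟩
      · simp [pos] at hv
      · simp [pos] at hv; simp [hv]
      · simp [pos] at hv
      · exact .inr ⟨l, rfl⟩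
      · simp [pos] at hv
    · rintro (rfl | ⟨l, rfl⟩)
      · exact ⟨_, by simp [pos], rfl⟩
      · exact ⟨_, by simp [pos], rfl⟩
  rw [h, Set.ncard_insert_of_notMem (by simp), ← Set.image_univ,
    Set.ncard_image_of_injective _ (fun a b h => by simpa using h)]
  simp

/-- The apex and two nonadjacent other vertices lie on an induced path, and the spider has no
triangle. -/
theorem IsMPSet.ncard_le_of_spider_of_apex (hr : 1 ≤ r) (hc : 2 ≤ c)
    {M : Set (Option (SpiderVertex r c q))} (hM : (spider r c q).IsMPSet M) (ha : none ∈ M) :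
    M.ncard ≤ 3 := by
  have hlegs : ∀ l, ∃ l' : Fin c, l ≠ l'.1 + 1 := fun l => by
    by_cases h : l = 1
    · exact ⟨⟨1, by omega⟩, by simp [h]⟩
    · exact ⟨⟨0, by omega⟩, by simpa using h⟩
  -- A vertex at position `p` of leg zero, for `p` within range.
  have hzero : ∀ p, p ≤ 3 * r - 1 → ∃ x : SpiderVertex r c q, x.pos = p ∧ x.leg = 0 := by
    intro p hp
    obtain ⟨x, h1, h2⟩ := exists_of_le (r := r) (q := q) hr (Nat.zero_le c) (p := p)
      (by simpa [legLength] using hp)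
    refine ⟨x, h1, ?_⟩
    rcases h2 with h2 | h2
    · exact leg_eq_zero_of_pos (by omega)
    · exact h2
  have hjoint : ∀ u : SpiderVertex r c q, u.pos % 3 = 0 → u.pos + 2 ≤ 3 * r - 1 ∧ u.leg = 0 := by
    intro u hu
    obtain ⟨j, rfl⟩ := exists_eq_joint hu
    have := j.2
    exact ⟨by simp only [pos]; omega, rfl⟩
  have bone_joint : ∀ u v : SpiderVertex r c q, some u ∈ M → some v ∈ M → u.pos % 3 = 0 →
      v.pos % 3 ≠ 0 → False := by
    intro u v hu hv hu0 hv0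
    have hne : u ≠ v := by rintro rfl; exact hv0 hu0
    obtain ⟨hur, hul⟩ := hjoint u hu0
    by_cases hadj : (spider r c q).Adj (some u) (some v)
    · refine hM.false_of_list (L := [some u, some v, none]) ⟨hadj, ?_, hv0, by simp, trivial⟩ ha
        hu hv (by simp) (by simp) (by simp) (by simp) (by simp) (by simpa using hne)
      simp [hu0]
    obtain ⟨x, hx0, hux, hxv, hxv'⟩ : ∃ x : SpiderVertex r c q, x.pos % 3 ≠ 0 ∧
        (spider r c q).Adj (some u) (some x) ∧ ¬ (spider r c q).Adj (some x) (some v) ∧ x ≠ v := by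
      rw [spider_adj_some] at hadj
      by_cases hp : u.pos = 0
      · obtain ⟨l, hl⟩ := hlegs v.leg
        refine ⟨foot l, by simp [pos], ?_, ?_, ?_⟩
        · rw [spider_adj_some]; rw [pos_foot, leg_foot]; omega
        · rw [spider_adj_some]; rw [pos_foot, leg_foot]; omega
        · rintro rfl; exact hl rfl
      by_cases hlt : v.leg = 0 ∧ u.pos < v.pos
      · obtain ⟨x, hx, hxl⟩ := hzero (u.pos - 1) (by omega)
        refine ⟨x, by omega, ?_, ?_, ?_⟩
        · rw [spider_adj_some]; omega
        · rw [spider_adj_some]; omega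
        · rintro rfl; omega
      · obtain ⟨x, hx, hxl⟩ := hzero (u.pos + 1) (by omega)
        refine ⟨x, by omega, ?_, ?_, ?_⟩
        · rw [spider_adj_some]; omega
        · rw [spider_adj_some]; omega
        · rintro rfl; omega
    refine hM.false_of_list (L := [some u, some x, none, some v]) ⟨hux, ?_, hx0, ?_, hv0, by simp,
      trivial⟩ ha hu hv (by simp) (by simp) (by simp) (by simp) (by simp) (by simpa using hne)
    · simp [hu0, hadj, hne]
    · simpa [hxv] using hxv'
  have joint_joint : ∀ u v : SpiderVertex r c q, some u ∈ M → some v ∈ M → u.pos % 3 = 0 →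
      v.pos % 3 = 0 → u.pos < v.pos → False := by
    intro u v hu hv hu0 hv0 hlt
    obtain ⟨hur, hul⟩ := hjoint u hu0
    obtain ⟨hvr, hvl⟩ := hjoint v hv0
    obtain ⟨y, hy, hyl⟩ := hzero (v.pos + 1) (by omega)
    obtain ⟨x, hx0, hux, hxv, hxy⟩ : ∃ x : SpiderVertex r c q, x.pos % 3 ≠ 0 ∧
        (spider r c q).Adj (some u) (some x) ∧
        (∀ z : SpiderVertex r c q, z = v ∨ z = y → ¬ (spider r c q).Adj (some x) (some z)) ∧
        x ≠ y := by
      by_cases hp : u.pos = 0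
      · obtain ⟨l, -⟩ := hlegs 0
        refine ⟨foot l, by simp [pos], ?_, ?_, ?_⟩
        · rw [spider_adj_some]; rw [pos_foot, leg_foot]; omega
        · rintro z (rfl | rfl) <;> rw [spider_adj_some, pos_foot, leg_foot] <;> omega
        · rintro rfl; rw [pos_foot] at hy; omega
      · obtain ⟨x, hx, hxl⟩ := hzero (u.pos - 1) (by omega)
        refine ⟨x, by omega, ?_, ?_, ?_⟩
        · rw [spider_adj_some]; omega
        · rintro z (rfl | rfl) <;> rw [spider_adj_some] <;> omega
        · rintro rfl; omega
    have hne : u ≠ v := by rintro rfl; omega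
    have huy : ∀ z : SpiderVertex r c q, z = v ∨ z = y → u ≠ z ∧
        ¬ (spider r c q).Adj (some u) (some z) := by
      rintro z (rfl | rfl)
      · exact ⟨hne, by rw [spider_adj_some]; omega⟩
      · exact ⟨by rintro rfl; omega, by rw [spider_adj_some]; omega⟩
    have hxne : x ≠ v := by rintro rfl; exact hx0 hv0
    refine hM.false_of_list (L := [some u, some x, none, some y, some v]) ⟨hux, ?_, hx0, ?_, ?_, ?_,
      ?_, by simp, trivial⟩ ha hu hv (by simp) (by simp) (by simp) (by simp) (by simp)
      (by simpa using hne)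
    · simp [hu0, huy]
    · simp [hxv, hxy, hxne]
    · rw [spider_adj_none_some]; omega
    · simp [hv0]
    · rw [spider_adj_some]; omega
  have adj : ∀ u v : SpiderVertex r c q, some u ∈ M → some v ∈ M → u ≠ v →
      (spider r c q).Adj (some u) (some v) := by
    intro u v hu hv hne
    by_cases hu0 : u.pos % 3 = 0 <;> by_cases hv0 : v.pos % 3 = 0
    · rcases lt_trichotomy u.pos v.pos with h | h | h
      · exact (joint_joint u v hu hv hu0 hv0 h).elim
      · exact (hne (ext_leg_pos (by rw [(hjoint u hu0).2, (hjoint v hv0).2]) h)).elim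
      · exact (joint_joint v u hv hu hv0 hu0 h).elim
    · exact (bone_joint u v hu hv hu0 hv0).elim
    · exact (bone_joint v u hv hu hv0 hu0).elim
    · by_contra hadj
      refine hM.false_of_list (L := [some u, none, some v]) ⟨hu0, ?_, hv0, by simp, trivial⟩ ha
        hu hv (by simp) (by simp) (by simp) (by simp) (by simp) (by simpa using hne)
      simp [hadj, hne]
  by_contra! hcard
  have h1 := Set.ncard_sdiff_singleton_of_mem ha
  obtain ⟨x, y, z, ⟨hx, hx0⟩, ⟨hy, hy0⟩, ⟨hz, hz0⟩, hxy, hxz, hyz⟩ :=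
    (Set.two_lt_ncard_iff (s := M \ {none})).1 (by omega)
  obtain ⟨u, rfl⟩ := Option.ne_none_iff_exists'.1 hx0
  obtain ⟨v, rfl⟩ := Option.ne_none_iff_exists'.1 hy0
  obtain ⟨w, rfl⟩ := Option.ne_none_iff_exists'.1 hz0
  exact not_three_adj (adj u v hx hy (by simpa using hxy)) (adj u w hx hz (by simpa using hxz))
    (adj v w hy hz (by simpa using hyz))

theorem mpNumber_spider (hr : 1 ≤ r) (hc : 2 ≤ c) (hq : q ≤ c) :
    (spider r c q).mpNumber = c + 1 := by
  refine mpNumber_eq (isMPSet_firstVertices hr) (ncard_firstVertices hr) fun M hM => ?_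
  by_cases ha : none ∈ M
  · exact (hM.ncard_le_of_spider_of_apex hr hc ha).trans (by omega)
  by_contra! hcard
  have hsome : ∀ z ∈ M, ∃ v, z = some v := fun z hz =>
    Option.ne_none_iff_exists'.1 fun e => ha (e ▸ hz)
  -- Two elements on the same leg and a third one lie on a path formed by two legs.
  obtain ⟨x, hx, y, hy, hxy, he⟩ := Set.exists_ne_map_eq_of_ncard_lt_of_maps_to
    (s := M) (t := ↑(Finset.range (c + 1))) (f := fun z => z.elim 0 leg)
    (by rw [Set.ncard_coe_finset, Finset.card_range]; omega) (fun z hz => by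
      obtain ⟨v, rfl⟩ := hsome z hz
      simpa [Nat.lt_succ_iff] using v.leg_le hq)
  obtain ⟨u, rfl⟩ := hsome x hx
  obtain ⟨v, rfl⟩ := hsome y hy
  obtain ⟨z, hz, hzu, hzv⟩ : ∃ z ∈ M, z ≠ some u ∧ z ≠ some v := by
    by_contra! h
    have : M ⊆ {some u, some v} := fun z hz => by
      by_cases e : z = some u
      · exact .inl e
      · exact .inr (h z hz e)
    have := (Set.ncard_le_ncard this).trans (Set.ncard_pair hxy).le
    omega
  obtain ⟨w, rfl⟩ := hsome z hz
  simp only [Option.elim_some] at he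
  have hl : ∃ l', l' ≤ c ∧ u.leg ≠ l' ∧ (w.leg = u.leg ∨ w.leg = l') := by
    by_cases h : w.leg = u.leg
    · by_cases h0 : u.leg = 0
      · exact ⟨1, by omega, by omega, .inl h⟩
      · exact ⟨0, by omega, h0, .inl h⟩
    · exact ⟨w.leg, w.leg_le hq, fun e => h e.symm, .inr rfl⟩
  obtain ⟨l', hl', hne, hw⟩ := hl
  obtain ⟨f, n, hf, hcov⟩ := exists_two_leg_path (q := q) hr (u.leg_le hq) hl' hne
  obtain ⟨i, hi, hiu⟩ := hcov u (.inl rfl)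
  obtain ⟨j, hj, hjv⟩ := hcov v (.inl he.symm)
  obtain ⟨k, hk, hkw⟩ := hcov w hw
  obtain ⟨a, b, d, hab, hbd, ha, hb, hd⟩ := exists_lt_lt_of_ne (P := fun i => f i ∈ M ∧ i ≤ n)
    (i := i) (j := j) (k := k) ⟨hiu ▸ hx, hi⟩ ⟨hjv ▸ hy, hj⟩ ⟨hkw ▸ hz, hk⟩
    (fun e => hxy (by rw [← hiu, ← hjv, e])) (fun e => hzu (by rw [← hiu, ← hkw, e]))
    (fun e => hzv (by rw [← hjv, ← hkw, e]))
  exact isMPSet_iff.1 hM _ ha.1 _ hb.1 _ hd.1 (hf.between hab hbd hd.2)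

end SimpleGraph

end

section

namespace SimpleGraph
open SpiderVertex
variable {r c q : ℕ}

/-- If a set in general position contains a joint and a neighbour of it, then its elements adjacent
to the apex lie on different legs, or there are at most two of them. -/
theorem IsGPSet.ncard_inter_spiderBones_le (hc : 2 ≤ c) (hq : q ≤ c)
    {M : Set (Option (SpiderVertex r c q))} (hM : (spider r c q).IsGPSet M)
    {u v : SpiderVertex r c q} (hu : some u ∈ M) (hv : some v ∈ M) (hu0 : u.pos % 3 = 0)
    (huv : (spider r c q).Adj (some u) (some v)) : (M ∩ spiderBones r c q).ncard ≤ c + 1 := by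
  have hv0 : v.pos % 3 ≠ 0 := by rw [spider_adj_some] at huv; omega
  have key : ∀ w : SpiderVertex r c q, some w ∈ M → w.pos % 3 ≠ 0 → w ≠ v →
      (¬ (spider r c q).Adj (some v) (some w)) ∧ w.pos ≠ 0 ∧
      ∃ x : SpiderVertex r c q, (spider r c q).Adj (some u) (some x) ∧
        (spider r c q).Adj (some x) (some w) := by
    intro w hw hw0 hne
    have h1 : ¬ (spider r c q).Adj (some v) (some w) := fun h => by
      have := hM.adj_of_adj_adj hu hv hw huv h (by rintro e; simp at e; subst e; exact hw0 hu0)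
      exact not_three_adj huv this h
    have h2 : ¬ (spider r c q).Adj (some u) (some w) := fun h =>
      h1 (hM.adj_of_adj_adj hv hu hw huv.symm h (by simpa using hne.symm))
    obtain ⟨y, hy1, hy2⟩ := hM.exists_common_neighbor hu hv hw huv (t := none) hv0 hw0
      (by simp; rintro rfl; exact hw0 hu0) h2 (by simpa using hne.symm) h1
    rcases y with _ | y
    · exact (hy1 hu0).elim
    · exact ⟨h1, by omega, y, hy1, hy2⟩
  by_cases hp : u.pos = 0
  -- All elements other than `v` have distance two from the centre.
  · by_contra! hcard
    obtain ⟨_, ⟨hx, x, hx0, rfl⟩, _, ⟨hy, y, hy0, rfl⟩, hxy, he⟩ :=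
      Set.exists_ne_map_eq_of_ncard_lt_of_maps_to
      (s := M ∩ spiderBones r c q) (t := ↑(Finset.range (c + 1))) (f := fun z => z.elim 0 leg)
      (by rw [Set.ncard_coe_finset, Finset.card_range]; omega) (fun z hz => by
        obtain ⟨-, v, -, rfl⟩ := hz
        simpa [Nat.lt_succ_iff] using v.leg_le hq)
    simp only [Option.elim_some] at he
    have hne : x ≠ y := fun e => hxy (congrArg some e)
    have hpos : x.pos ≠ y.pos := fun e => hne (ext_leg_pos he e)
    rw [spider_adj_some] at huv
    have pos2 : ∀ w : SpiderVertex r c q, some w ∈ M → w.pos % 3 ≠ 0 → w ≠ v → w.pos = 2 ∧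
        w.leg ≠ v.leg := by
      intro w hw hw0 hne
      obtain ⟨h1, h2, t, h3, h4⟩ := key w hw hw0 hne
      rw [spider_adj_some] at h1 h3 h4
      omega
    by_cases ex : x = v
    · subst ex
      have := pos2 y hy hy0 hne.symm
      omega
    · by_cases ey : y = v
      · subst ey
        have := pos2 x hx hx0 hne
        omega
      · have h1 := pos2 x hx hx0 ex
        have h2 := pos2 y hy hy0 ey
        omega
  · have hul : u.leg = 0 := by
      obtain ⟨j, rfl⟩ := exists_eq_joint hu0
      rfl
    have opposite : ∀ w : SpiderVertex r c q, some w ∈ M → w.pos % 3 ≠ 0 → w ≠ v → w.leg = 0 ∧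
        w.pos + 2 * v.pos = 3 * u.pos := by
      intro w hw hw0 hne
      obtain ⟨h1, h2, x, h3, h4⟩ := key w hw hw0 hne
      rw [spider_adj_some] at h1 h3 h4 huv
      have hx : x.leg = 0 := by omega
      have hvl : v.leg = 0 := by omega
      have hwl : w.leg = 0 := by omega
      have hvw : v.pos ≠ w.pos := fun e => hne (ext_leg_pos (by omega) e.symm)
      refine ⟨hwl, ?_⟩
      simp only [hx, hvl, hwl, hul, true_or, and_true] at h1 h3 h4 huv
      omega
    have hsub : ((M ∩ spiderBones r c q) \ {some v}).ncard ≤ 1 := by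
      rw [Set.ncard_le_one_iff_subsingleton]
      rintro _ ⟨⟨hx, x, hx0, rfl⟩, hxv⟩ _ ⟨⟨hy, y, hy0, rfl⟩, hyv⟩
      have h1 := opposite x hx hx0 fun e => hxv (congrArg some e)
      have h2 := opposite y hy hy0 fun e => hyv (congrArg some e)
      exact congrArg some (ext_leg_pos (by omega) (by omega))
    have h1 := Set.ncard_le_ncard (s := M ∩ spiderBones r c q)
      (t := insert (some v) ((M ∩ spiderBones r c q) \ {some v})) fun z hz =>
        (em (z = some v)).imp id fun e => ⟨hz, e⟩
    have h2 := Set.ncard_insert_le (some v) ((M ∩ spiderBones r c q) \ {some v})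
    omega

/-- With the apex, a set in general position contains at most two of its neighbours; with two
adjacent vertices other than the apex of which one is a joint, `IsGPSet.ncard_inter_spiderBones_le`
applies; otherwise each joint in the set may be replaced by its successor on leg zero. -/
theorem IsGPSet.ncard_le_of_spider (hr : 1 ≤ r) (hc : 2 ≤ c) (hq : q ≤ c)
    {M : Set (Option (SpiderVertex r c q))} (hM : (spider r c q).IsGPSet M) :
    M.ncard ≤ 2 * r + c + q := by
  have hsub : M ⊆ insert none ((Set.range fun j => some (joint j)) ∪ (M ∩ spiderBones r c q)) := by
    rintro (_ | v) hv
    · exact .inl rfl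
    · by_cases h : v.pos % 3 = 0
      · obtain ⟨j, rfl⟩ := exists_eq_joint h
        exact .inr (.inl ⟨j, rfl⟩)
      · exact .inr (.inr ⟨hv, v, h, rfl⟩)
  have hunion : ((Set.range fun j => some (joint j : SpiderVertex r c q)) ∪
      (M ∩ spiderBones r c q)).ncard ≤ r + (M ∩ spiderBones r c q).ncard :=
    (Set.ncard_union_le _ _).trans (by rw [ncard_range_joint])
  by_cases ha : none ∈ M
  · have h2 : (M ∩ spiderBones r c q).ncard ≤ 2 := by
      by_contra! hcard
      obtain ⟨_, _, _, ⟨hx, x, hx0, rfl⟩, ⟨hy, y, hy0, rfl⟩, ⟨hz, z, hz0, rfl⟩, hxy, hxz, hyz⟩ :=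
        (Set.two_lt_ncard_iff (s := M ∩ spiderBones r c q)).1 hcard
      exact not_three_adj (hM.adj_of_adj_adj hx ha hy hx0 hy0 hxy)
        (hM.adj_of_adj_adj hx ha hz hx0 hz0 hxz) (hM.adj_of_adj_adj hy ha hz hy0 hz0 hyz)
    have h1 := (Set.ncard_le_ncard hsub).trans (Set.ncard_insert_le _ _)
    omega
  have hsub' : M ⊆ (Set.range fun j => some (joint j)) ∪ (M ∩ spiderBones r c q) := fun z hz =>
    (hsub hz).resolve_left fun e => ha (e ▸ hz)
  by_cases hadj : ∃ u v : SpiderVertex r c q, some u ∈ M ∧ some v ∈ M ∧ u.pos % 3 = 0 ∧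
      (spider r c q).Adj (some u) (some v)
  · obtain ⟨u, v, hu, hv, hu0, huv⟩ := hadj
    have h1 := hM.ncard_inter_spiderBones_le hc hq hu hv hu0 huv
    have h2 := Set.ncard_le_ncard hsub'
    omega
  -- Replacing each joint by its successor on leg zero maps `M` injectively to the bones.
  · rw [← ncard_spiderBones]
    let τ : Option (SpiderVertex r c q) → Option (SpiderVertex r c q)
      | some (joint j) => some (bone j false)
      | z => z
    refine Set.ncard_le_ncard_of_injOn τ ?_ ?_
    · rintro z hz
      rcases hsub' hz with ⟨j, rfl⟩ | ⟨-, v, hv, rfl⟩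
      · exact ⟨bone j false, by simp [pos], rfl⟩
      · rcases v with j | _ | _ | _
        · simp [pos] at hv
        all_goals exact ⟨_, hv, rfl⟩
    · have hout : ∀ j : Fin r, some (joint j) ∈ M → some (bone j false) ∉ M := fun j h1 h2 =>
        hadj ⟨_, _, h1, h2, by simp [pos], by rw [spider_adj_some]; simp [pos, leg]⟩
      rintro (_ | u) hu (_ | v) hv e
      · rfl
      · exact (ha hu).elim
      · exact (ha hv).elim
      · rcases u with j | _ | _ | _ <;> rcases v with j' | _ | _ | _ <;>
          simp only [τ, Option.some.injEq, bone.injEq, reduceCtorEq] at e ⊢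
        · exact congrArg joint e.1
        · obtain ⟨rfl, rfl⟩ := e; exact (hout _ hu hv).elim
        · obtain ⟨rfl, rfl⟩ := e; exact (hout _ hv hu).elim
        all_goals simpa using e

theorem spider_mem_positionOrders (hr : 1 ≤ r) (hc : 2 ≤ c) (hq : q ≤ c) :
    3 * r + c + q + 1 ∈ positionOrders (c + 1) (2 * r + c + q) := by
  have h := card_mem_positionOrders (spider r c q)
  rwa [mpNumber_spider hr hc hq, gpNumber_eq isGPSet_spiderBones ncard_spiderBones
    (fun M hM => hM.ncard_le_of_spider hr hc hq), Finite.card_option, SpiderVertex.card_eq] at h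

theorem add_two_mem_positionOrders {a b : ℕ} (ha : 3 ≤ a) (hab : a < b) (hb : b ≤ 2 * a) :
    b + 2 ∈ positionOrders a b := by
  have h := spider_mem_positionOrders (r := 1) (c := a - 1) (q := b - a - 1) le_rfl (by omega)
    (by omega)
  convert h using 1 <;> first | omega | (congr 1 <;> omega)

theorem mem_positionOrders_of_two_mul_lt {a b : ℕ} (ha : 3 ≤ a) (hb : 2 * a < b) :
    b - a + 2 + (b + 1) / 2 ∈ positionOrders a b := by
  have h := spider_mem_positionOrders (r := (b + 1) / 2 - a + 1) (c := a - 1)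
    (q := a - 1 - b % 2) (by omega) (by omega) (by omega)
  convert h using 1 <;> first | omega | (congr 1 <;> omega)

end SimpleGraph

end

section

namespace SimpleGraph

/-! ### A search through families of neighbourhoods -/

/-- The set difference of two sets of natural numbers encoded by their binary digits. -/
def bitDiff (a b : ℕ) : ℕ := a ^^^ (a &&& b)

theorem testBit_bitDiff (a b i : ℕ) :
    (bitDiff a b).testBit i = (a.testBit i && !b.testBit i) := by
  rw [bitDiff, Nat.testBit_xor, Nat.testBit_and]
  cases a.testBit i <;> cases b.testBit i <;> rfl

/-- Two subsets of `{0, 1, 2, 3}` are nonempty and not the same singleton, that is, they have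
distinct representatives. -/
def distinctReps (a b : ℕ) : Bool :=
  a != 0 && b != 0 && !(a == b && (a == 1 || a == 2 || a == 4 || a == 8))

theorem ne_zero_of_testBit {a i : ℕ} (h : a.testBit i) : a ≠ 0 := by
  rintro rfl; simp at h

theorem distinctReps_of_testBit {a b i j : ℕ} (hi : a.testBit i) (hj : b.testBit j) (hij : i ≠ j) :
    distinctReps a b = true := by
  have key : ∀ n, ¬ (a = b ∧ a = 2 ^ n) := by
    rintro n ⟨rfl, rfl⟩
    rw [Nat.testBit_two_pow] at hi hj
    simp only [decide_eq_true_eq] at hi hj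
    omega
  have h0 := key 0
  have h1 := key 1
  have h2 := key 2
  have h3 := key 3
  have := ne_zero_of_testBit hi
  have := ne_zero_of_testBit hj
  simp only [distinctReps, Bool.and_eq_true, bne_iff_ne, Bool.not_eq_true', Bool.and_eq_false_iff,
    beq_eq_false_iff_ne, Bool.or_eq_false_iff]
  norm_num at h0 h1 h2 h3
  grind

/-- A necessary condition for three vertices with neighbourhoods `a`, `b`, `c` in a set of at most
four vertices, and with no neighbours elsewhere, to lie in this order on an induced path. -/
def middleOk (a b c : ℕ) : Bool :=
  distinctReps (bitDiff b c) (bitDiff b a) && bitDiff a c != 0 && bitDiff c a != 0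

/-- The condition that `a`, `c` are not disjoint subsets of `b`. If they were, the vertices with
these neighbourhoods would lie on a geodesic. -/
def containOk (a b c : ℕ) : Bool :=
  bitDiff a b != 0 || bitDiff c b != 0 || a &&& c != 0

/-- A necessary condition for three pairwise nonadjacent vertices of a set in general position,
with neighbourhoods `a`, `b`, `c`, to lie on an induced path. -/
def tripleOk (a b c : ℕ) : Bool :=
  (middleOk a b c && containOk a b c) || (middleOk b a c && containOk b a c) ||
    (middleOk a c b && containOk a c b)

/-- A necessary condition for three vertices to lie on an induced path, where the vertices have
neighbourhoods `p`, `b`, `c`, and the first one has a further neighbour with neighbourhood `p'`. -/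
def pairTripleOk (p p' b c : ℕ) : Bool :=
  (distinctReps (bitDiff b c) (bitDiff b p) && bitDiff c p != 0) ||
    (distinctReps (bitDiff c b) (bitDiff c p) && bitDiff b p != 0) ||
    (distinctReps (bitDiff p c) (bitDiff p b) && bitDiff b c != 0 && bitDiff c b != 0) ||
    (bitDiff p b != 0 && bitDiff (bitDiff c b) p' != 0 && bitDiff b c != 0) ||
    (bitDiff p c != 0 && bitDiff (bitDiff b c) p' != 0 && bitDiff c b != 0)

/-- `noFamily ok n ch cand` says that `ch` has no extension by `n` elements of `cand` such that
each added element is compatible, in the sense of `ok`, with the elements chosen before it. -/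
def noFamily (ok : ℕ → List ℕ → Bool) : ℕ → List ℕ → List ℕ → Bool
  | 0, _, _ => false
  | _ + 1, _, [] => true
  | n + 1, ch, c :: cs => decide (cs.length < n) ||
      (noFamily ok (n + 1) ch cs && (!ok c ch || noFamily ok n (c :: ch) cs))

theorem length_lt_of_noFamily {ok : ℕ → List ℕ → Bool} {F : ℕ → Prop}
    (hok : ∀ c ch, F c → (∀ a ∈ ch, F a ∧ a ≠ c) → ok c ch = true) {cand : List ℕ} :
    ∀ {n : ℕ} {ch L : List ℕ}, noFamily ok n ch cand = true → L.Sublist cand → cand.Nodup →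
      (∀ a ∈ ch, F a ∧ a ∉ cand) → (∀ a ∈ L, F a) → L.length < n := by
  induction cand with
  | nil =>
    intro n ch L h hL _ _ _
    rw [List.sublist_nil.1 hL]
    cases n
    · simp [noFamily] at h
    · simp
  | cons c cs ih =>
    intro n ch L h hL hnd hch hF
    cases n with
    | zero => simp [noFamily] at h
    | succ n =>
      rw [noFamily, Bool.or_eq_true, decide_eq_true_eq, Bool.and_eq_true, Bool.or_eq_true] at h
      obtain ⟨hc, hnd⟩ := List.nodup_cons.1 hnd
      rcases h with h | ⟨h1, h2⟩
      · have := hL.length_le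
        simp at this
        omega
      cases hL with
      | cons _ hL =>
        exact ih h1 hL hnd (fun a ha => ⟨(hch a ha).1, fun h => (hch a ha).2 (by simp [h])⟩) hF
      | cons_cons _ hL =>
        rename_i L
        have hFc := hF c (by simp)
        rcases h2 with h2 | h2
        · rw [hok c ch hFc fun a ha => ⟨(hch a ha).1, fun e => (hch a ha).2 (by simp [e])⟩] at h2
          simp at h2
        · have := ih (n := n) (ch := c :: ch) h2 hL hnd (fun a ha => by
            rcases List.mem_cons.1 ha with rfl | ha
            · exact ⟨hFc, hc⟩
            · exact ⟨(hch a ha).1, fun h => (hch a ha).2 (by simp [h])⟩)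
            fun a ha => hF a (by simp [ha])
          simp only [List.length_cons]
          omega

/-- Compatibility in a family of neighbourhoods of pairwise nonadjacent vertices. -/
def familyOk (c : ℕ) (ch : List ℕ) : Bool :=
  ch.all fun a => ch.all fun b => a == b || tripleOk a b c

/-- Compatibility in a family of neighbourhoods of pairwise nonadjacent vertices, in the presence of
two adjacent vertices with neighbourhoods `p` and `p'`. -/
def pairFamilyOk (p p' : ℕ) (c : ℕ) (ch : List ℕ) : Bool :=
  (ch.all fun a => pairTripleOk p p' a c && pairTripleOk p' p a c) && familyOk c ch

/-- A bound on the size of a set in general position whose complement has `t` vertices, where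
`2 ≤ t ≤ 4`, in a graph with monophonic position number two. -/
def complBound (t : ℕ) : ℕ := if t = 4 then 6 else t + 1

theorem noFamily_check : ∀ t ∈ [2, 3, 4],
    noFamily familyOk (complBound t + 1) [] (List.range' 1 (2 ^ t - 1)) = true := by
  decide +kernel

theorem noFamily_pair_check : ∀ t ∈ [2, 3, 4], ∀ p ∈ List.range' 1 (2 ^ t - 1),
    ∀ p' ∈ List.range' 1 (2 ^ t - 1), p &&& p' = 0 →
    noFamily (pairFamilyOk p p') (complBound t - 1) []
      ((List.range' 1 (2 ^ t - 1)).filter fun c => (c &&& p == 0) == (c &&& p' == 0)) = true := by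
  decide +kernel

end SimpleGraph

end

section

namespace SimpleGraph

variable {V : Type*} {G : SimpleGraph V} {S : Set V} {u v w s s' : V}

/-! ### Graphs with monophonic position number two -/

/-- Any three vertices of `G` lie on a common induced path. For a finite graph with more than one
vertex this means that the monophonic position number is two. -/
def TriplesOnPaths (G : SimpleGraph V) : Prop :=
  ∀ ⦃u v w : V⦄, u ≠ v → u ≠ w → v ≠ w → G.Between u v w ∨ G.Between v u w ∨ G.Between u w v

theorem Between.not_adj (h : G.Between u v w) : ¬ G.Adj u w := by
  obtain ⟨f, n, j, h, h0, hn, rfl, rfl, rfl⟩ := h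
  have := h 0 (by omega) n le_rfl
  intro e
  have := this.2.1 e
  omega

theorem Between.ne_left (h : G.Between u v w) : u ≠ v := by
  obtain ⟨f, n, j, h, h0, hn, rfl, rfl, rfl⟩ := h
  intro e
  have := (h 0 (by omega) j hn.le).1 e
  omega

theorem IsInducedSeq.reachable {f : ℕ → V} {n i : ℕ} (h : G.IsInducedSeq f n) (hi : i ≤ n) :
    G.Reachable (f 0) (f i) := by
  obtain ⟨p, -⟩ := exists_walk_of_seq (G := G) (f := f) (n := i)
    fun k hk => (h k (by omega) (k + 1) (by omega)).2.2 (Or.inl rfl)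
  exact p.reachable

theorem Between.reachable (h : G.Between u v w) : G.Reachable u v ∧ G.Reachable v w := by
  obtain ⟨f, n, j, h, h0, hn, rfl, rfl, rfl⟩ := h
  exact ⟨h.reachable hn.le, (h.reachable hn.le).symm.trans (h.reachable le_rfl)⟩

theorem triplesOnPaths_of_mpNumber [Finite V] (h : G.mpNumber = 2) : G.TriplesOnPaths := by
  intro u v w huv huw hvw
  by_contra! hc
  have hS : G.IsMPSet ({u, v, w} : Set V) := by
    rw [isMPSet_iff]
    intro a ha b hb c hc' hB
    have h1 := hB.ne_left
    have h2 := hB.symm.ne_left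
    have h3 : a ≠ c := by
      obtain ⟨f, n, j, h, h0, hn, rfl, rfl, rfl⟩ := hB
      intro e
      have := (h 0 (by omega) n le_rfl).1 e
      omega
    have hB' := hB.symm
    rcases ha with rfl | rfl | rfl <;> rcases hb with rfl | rfl | rfl <;>
      rcases hc' with rfl | rfl | rfl <;> simp_all
  have := hS.ncard_le
  rw [Set.ncard_eq_three.2 ⟨u, v, w, huv, huw, hvw, rfl⟩] at this
  omega

theorem TriplesOnPaths.not_triangle (h : G.TriplesOnPaths) (h1 : G.Adj u v) (h2 : G.Adj v w)
    (h3 : G.Adj u w) : False := by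
  rcases h h1.ne h3.ne h2.ne with h | h | h
  exacts [h.not_adj h3, h.not_adj h2, h.not_adj h1]

theorem TriplesOnPaths.reachable (h : G.TriplesOnPaths) (huv : u ≠ v) (huw : u ≠ w) (hvw : v ≠ w) :
    G.Reachable u v := by
  rcases h huv huw hvw with h | h | h
  exacts [h.reachable.1, h.reachable.1.symm, h.reachable.1.trans h.reachable.2]

/-- The vertex set `P` of an induced path from `u` to `w` through `v`, where `v` is adjacent to
neither end: the neighbours `x` of `u` and `z` of `w` and the two neighbours `y`, `y'` of `v` on the
path, the adjacencies between them excluded by inducedness, and the facts that the ends have at most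
one and all vertices at most two neighbours in `P`, and that `P` contains no cycle of length
four. -/
theorem Between.exists_path (h : G.Between u v w) (huv : ¬ G.Adj u v) (hvw : ¬ G.Adj v w) :
    ∃ (P : Set V) (x y y' z : V), (u ∈ P ∧ v ∈ P ∧ w ∈ P ∧ x ∈ P ∧ y ∈ P ∧ y' ∈ P ∧ z ∈ P) ∧
      (G.Adj u x ∧ G.Adj v y ∧ G.Adj v y' ∧ G.Adj w z) ∧ y ≠ y' ∧
      (¬ G.Adj w x ∧ ¬ G.Adj w y ∧ ¬ G.Adj u y' ∧ ¬ G.Adj u z ∧ ¬ G.Adj y z ∧ ¬ G.Adj x y') ∧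
      (∀ a ∈ P, ∀ b ∈ P, G.Adj u a → G.Adj u b → a = b) ∧
      (∀ a ∈ P, ∀ b ∈ P, G.Adj w a → G.Adj w b → a = b) ∧
      (∀ p ∈ P, ∀ a ∈ P, ∀ b ∈ P, ∀ c ∈ P, G.Adj p a → G.Adj p b → G.Adj p c →
        a = b ∨ a = c ∨ b = c) ∧
      (∀ a ∈ P, ∀ b ∈ P, ∀ c ∈ P, ∀ d ∈ P, G.Adj a b → G.Adj b c → G.Adj c d → G.Adj d a →
        a = c ∨ b = d) := by
  obtain ⟨f, n, j, h, h0, hn, rfl, rfl, rfl⟩ := h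
  have adj : ∀ {i k}, i ≤ n → k ≤ n → (G.Adj (f i) (f k) ↔ i + 1 = k ∨ k + 1 = i) :=
    fun {i k} hi hk => (h i hi k hk).2
  rw [adj (by omega) (by omega)] at huv hvw
  refine ⟨f '' Set.Iic n, f 1, f (j - 1), f (j + 1), f (n - 1), ?_, ?_, ?_, ?_, ?_, ?_, ?_, ?_⟩
  · refine ⟨?_, ?_, ?_, ?_, ?_, ?_, ?_⟩ <;> refine Set.mem_image_of_mem f ?_ <;>
      simp only [Set.mem_Iic] <;> omega
  · refine ⟨?_, ?_, ?_, ?_⟩ <;> rw [adj (by omega) (by omega)] <;> omega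
  · intro e
    have := (h (j - 1) (by omega) (j + 1) (by omega)).1 e
    omega
  · refine ⟨?_, ?_, ?_, ?_, ?_, ?_⟩ <;> rw [adj (by omega) (by omega)] <;> omega
  · rintro _ ⟨a, ha, rfl⟩ _ ⟨b, hb, rfl⟩ h1 h2
    rw [adj (by omega) ha] at h1
    rw [adj (by omega) hb] at h2
    congr 1; omega
  · rintro _ ⟨a, ha, rfl⟩ _ ⟨b, hb, rfl⟩ h1 h2
    rw [Set.mem_Iic] at ha hb
    rw [adj (by omega) ha] at h1
    rw [adj (by omega) hb] at h2
    congr 1; omega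
  · rintro _ ⟨p, hp, rfl⟩ _ ⟨a, ha, rfl⟩ _ ⟨b, hb, rfl⟩ _ ⟨c, hc, rfl⟩ h1 h2 h3
    rw [adj hp ha] at h1
    rw [adj hp hb] at h2
    rw [adj hp hc] at h3
    have : a = b ∨ a = c ∨ b = c := by omega
    rcases this with rfl | rfl | rfl <;> simp
  · rintro _ ⟨a, ha, rfl⟩ _ ⟨b, hb, rfl⟩ _ ⟨c, hc, rfl⟩ _ ⟨d, hd, rfl⟩ h1 h2 h3 h4
    rw [adj ha hb] at h1
    rw [adj hb hc] at h2
    rw [adj hc hd] at h3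
    rw [adj hd ha] at h4
    have : a = c ∨ b = d := by omega
    rcases this with rfl | rfl <;> simp

/-! ### Sets in general position in such graphs -/

/-- A set in general position induces a matching. -/
theorem TriplesOnPaths.unique_partner (hG : G.TriplesOnPaths) (hS : G.IsGPSet S) (hs : s ∈ S)
    (hu : u ∈ S) (hv : v ∈ S) (h1 : G.Adj s u) (h2 : G.Adj s v) : u = v := by
  by_contra huv
  exact hG.not_triangle h1 (hS.adj_of_adj_adj hu hs hv h1.symm h2 huv) h2

/-- If `w` has a common neighbour with one end of an edge in `S`, it has one with the other. -/
theorem TriplesOnPaths.exists_common_neighbor (hG : G.TriplesOnPaths) (hS : G.IsGPSet S)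
    (hs : s ∈ S) (hs' : s' ∈ S) (hw : w ∈ S) (h : G.Adj s s') (hws : w ≠ s) (hws' : w ≠ s')
    (hc : ∃ y, G.Adj s y ∧ G.Adj w y) : ∃ y, G.Adj s' y ∧ G.Adj w y := by
  obtain ⟨y, h1, h2⟩ := hc
  obtain ⟨z, h3, h4⟩ := hS.exists_common_neighbor hs' hs hw h.symm h1 h2.symm hws'.symm
    (fun e => hws (hG.unique_partner hS hs' hw hs e h.symm)) hws.symm
    (fun e => hws' (hG.unique_partner hS hs hw hs' e h))
  exact ⟨z, h3, h4.symm⟩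

/-- Otherwise `s'` would lie on a geodesic from `s` to `w`. -/
theorem TriplesOnPaths.exists_adj_ne (hG : G.TriplesOnPaths) (hS : G.IsGPSet S)
    (hs : s ∈ S) (hs' : s' ∈ S) (hw : w ∈ S) (h : G.Adj s s') (hws : w ≠ s) (hws' : w ≠ s') :
    ∃ y, G.Adj s y ∧ y ≠ s' := by
  by_contra! hc
  have hr := hG.reachable hws.symm h.ne hws'
  obtain ⟨p, hp⟩ := hr.exists_walk_length_eq_dist
  refine isGPSet_iff.1 hS s hs s' hs' w hw h.ne hws'.symm h.reachable (h.symm.reachable.trans hr) ?_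
  have h1 := dist_eq_one_iff_adj.2 h
  have h2 := h.reachable.dist_triangle_left w
  cases p with
  | nil => exact absurd rfl hws
  | cons hadj q =>
    obtain rfl := hc _ hadj
    have := dist_le q
    simp only [Walk.length_cons] at hp
    omega

/-- Two vertices without neighbours in `S` do not have the same neighbourhood: an induced path
through both and a third element of `S` contains a vertex adjacent to just one of them. -/
theorem TriplesOnPaths.false_of_twins (hG : G.TriplesOnPaths) (hu : ∀ y ∈ S, ¬ G.Adj u y)
    (hv : ∀ y ∈ S, ¬ G.Adj v y) (huS : u ∈ S) (hvS : v ∈ S) (hwS : w ∈ S) (huv : u ≠ v)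
    (huw : u ≠ w) (hvw : v ≠ w) (h : ∀ y, G.Adj u y ↔ G.Adj v y) : False := by
  rcases hG huv huw hvw with hB | hB | hB
  · obtain ⟨P, x, y, y', z, -, ⟨-, -, h3, -⟩, -, ⟨-, -, h5, -⟩, -⟩ :=
      hB.exists_path (hu v hvS) (hv w hwS)
    exact h5 ((h _).2 h3)
  · obtain ⟨P, x, y, y', z, -, ⟨-, -, h3, -⟩, -, ⟨-, -, h5, -⟩, -⟩ :=
      hB.exists_path (hv u huS) (hu w hwS)
    exact h5 ((h _).1 h3)
  · obtain ⟨P, x, y, y', z, -, ⟨h3, -⟩, -, ⟨h5, -⟩, -⟩ :=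
      hB.exists_path (hu w hwS) (fun e => hv w hwS e.symm)
    exact h5 ((h _).1 h3)

/-- If the neighbourhoods of `u` and `w` are disjoint subsets of that of `v`, then `v` is halfway on
a geodesic of length four from `u` to `w`. -/
theorem TriplesOnPaths.false_of_subset (hG : G.TriplesOnPaths) (hS : G.IsGPSet S)
    (huS : u ∈ S) (hvS : v ∈ S) (hwS : w ∈ S) (huv : u ≠ v) (huw : u ≠ w) (hvw : v ≠ w)
    (nuv : ¬ G.Adj u v) (nuw : ¬ G.Adj u w) (nvw : ¬ G.Adj v w)
    (h1 : ∀ y, G.Adj u y → G.Adj v y) (h2 : ∀ y, G.Adj w y → G.Adj v y)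
    (h3 : ∀ y, G.Adj u y → ¬ G.Adj w y) : False := by
  have ruv := hG.reachable huv huw hvw
  have rvw := hG.reachable hvw huv.symm huw.symm
  have key : ∀ {a}, a ≠ v → G.Reachable a v → ∃ y, G.Adj a y := fun {a} hav r => by
    obtain ⟨p⟩ := r
    cases p with
    | nil => exact absurd rfl hav
    | cons h _ => exact ⟨_, h⟩
  obtain ⟨a, ha⟩ := key huv ruv
  obtain ⟨b, hb⟩ := key hvw.symm rvw.symm
  refine isGPSet_iff.1 hS u huS v hvS w hwS huv hvw ruv rvw ?_
  rw [dist_eq_two ha (h1 a ha).symm huv nuv, dist_eq_two (h2 b hb) hb.symm hvw nvw]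
  have hle := dist_le (Walk.cons ha (Walk.cons (h1 a ha).symm
    (Walk.cons (h2 b hb) (Walk.cons hb.symm .nil))))
  simp only [Walk.length_cons, Walk.length_nil] at hle
  obtain ⟨p, hp⟩ := (ruv.trans rvw).exists_walk_length_eq_dist
  match p, hp with
  | .nil, _ => exact absurd rfl huw
  | .cons e1 .nil, _ => exact absurd e1 nuw
  | .cons e1 (.cons e2 .nil), _ => exact absurd e2.symm (h3 _ e1)
  | .cons e1 (.cons e2 (.cons e3 .nil)), _ =>
    exact (hG.not_triangle (h1 _ e1) e2 (h2 _ e3.symm)).elim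
  | .cons e1 (.cons e2 (.cons e3 (.cons e4 q))), hp =>
    simp only [Walk.length_cons] at hp
    omega

end SimpleGraph

end

section

namespace SimpleGraph

variable {V : Type*} {G : SimpleGraph V} {S : Set V} {u v w s s' : V} {t : ℕ} {e : Fin t → V}

/-! ### Sets in general position with at most one edge -/

open Classical in
/-- The set of neighbours of `v` among `e 0, …, e (t - 1)`, encoded by its binary digits. -/
noncomputable def nbrCode (G : SimpleGraph V) (e : Fin t → V) (v : V) : ℕ :=
  Nat.ofBits fun i => decide (G.Adj v (e i))

theorem testBit_nbrCode (i : Fin t) : (G.nbrCode e v).testBit i = true ↔ G.Adj v (e i) := by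
  rw [nbrCode, Nat.testBit_ofBits_lt _ _ i.2]
  simp

theorem nbrCode_lt : G.nbrCode e v < 2 ^ t := Nat.ofBits_lt_two_pow _

theorem exists_of_testBit_nbrCode {i : ℕ} (h : (G.nbrCode e v).testBit i = true) :
    ∃ k : Fin t, (k : ℕ) = i := by
  by_cases hi : i < t
  · exact ⟨⟨i, hi⟩, rfl⟩
  · rw [nbrCode, Nat.testBit_ofBits_ge _ _ (not_lt.1 hi)] at h
    simp at h

theorem bitDiff_nbrCode (i : Fin t) :
    (bitDiff (G.nbrCode e u) (G.nbrCode e v)).testBit i = true ↔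
      G.Adj u (e i) ∧ ¬ G.Adj v (e i) := by
  rw [testBit_bitDiff, Bool.and_eq_true, Bool.not_eq_true', ← Bool.not_eq_true, testBit_nbrCode,
    testBit_nbrCode]

theorem nbrCode_ne_zero (he : ∀ y ∉ S, ∃ i, e i = y) {y : V} (hy : y ∉ S) (h : G.Adj v y) :
    G.nbrCode e v ≠ 0 := by
  obtain ⟨i, rfl⟩ := he y hy
  exact ne_zero_of_testBit ((testBit_nbrCode i).2 h)

theorem bitDiff_nbrCode_ne_zero (he : ∀ y ∉ S, ∃ i, e i = y) {y : V} (hy : y ∉ S)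
    (h : G.Adj u y) (h' : ¬ G.Adj v y) : bitDiff (G.nbrCode e u) (G.nbrCode e v) ≠ 0 := by
  obtain ⟨i, rfl⟩ := he y hy
  exact ne_zero_of_testBit ((bitDiff_nbrCode i).2 ⟨h, h'⟩)

theorem bitDiff_bitDiff_nbrCode_ne_zero (he : ∀ y ∉ S, ∃ i, e i = y) {y : V} (hy : y ∉ S)
    (h : G.Adj u y) (h' : ¬ G.Adj v y) (h'' : ¬ G.Adj w y) :
    bitDiff (bitDiff (G.nbrCode e u) (G.nbrCode e v)) (G.nbrCode e w) ≠ 0 := by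
  obtain ⟨i, rfl⟩ := he y hy
  refine ne_zero_of_testBit (i := i) ?_
  rw [testBit_bitDiff, (bitDiff_nbrCode i).2 ⟨h, h'⟩, Bool.true_and, Bool.not_eq_true',
    ← Bool.not_eq_true, testBit_nbrCode]
  exact h''

theorem distinctReps_nbrCode (he : ∀ y ∉ S, ∃ i, e i = y) {y y' : V} (hy : y ∉ S) (hy' : y' ∉ S)
    (hne : y ≠ y') (h1 : G.Adj v y) (h2 : ¬ G.Adj w y) (h3 : G.Adj v y') (h4 : ¬ G.Adj u y') :
    distinctReps (bitDiff (G.nbrCode e v) (G.nbrCode e w))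
      (bitDiff (G.nbrCode e v) (G.nbrCode e u)) = true := by
  obtain ⟨i, rfl⟩ := he y hy
  obtain ⟨j, rfl⟩ := he y' hy'
  refine distinctReps_of_testBit ((bitDiff_nbrCode i).2 ⟨h1, h2⟩)
    ((bitDiff_nbrCode j).2 ⟨h3, h4⟩) fun h => hne (by rw [Fin.ext h])

theorem nbrCode_and_eq_zero : G.nbrCode e u &&& G.nbrCode e v = 0 ↔
    ∀ i, ¬ (G.Adj u (e i) ∧ G.Adj v (e i)) := by
  constructor
  · intro h i hi
    have : (G.nbrCode e u &&& G.nbrCode e v).testBit i = true := by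
      rw [Nat.testBit_and, (testBit_nbrCode i).2 hi.1, (testBit_nbrCode i).2 hi.2]; rfl
    rw [h] at this
    simp at this
  · intro h
    refine Nat.eq_of_testBit_eq fun i => ?_
    rw [Nat.zero_testBit, Nat.testBit_and, ← Bool.not_eq_true, Bool.and_eq_true]
    rintro ⟨h1, h2⟩
    obtain ⟨k, rfl⟩ := exists_of_testBit_nbrCode h1
    exact h k ⟨(testBit_nbrCode k).1 h1, (testBit_nbrCode k).1 h2⟩

theorem bitDiff_nbrCode_eq_zero (h : bitDiff (G.nbrCode e u) (G.nbrCode e v) = 0) (i : Fin t)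
    (hi : G.Adj u (e i)) : G.Adj v (e i) := by
  by_contra hc
  have := (bitDiff_nbrCode (G := G) (e := e) (u := u) (v := v) i).2 ⟨hi, hc⟩
  rw [h] at this
  simp at this

/-- `v` is a vertex of `S` without neighbours in `S`. -/
def IsIsolatedIn (G : SimpleGraph V) (S : Set V) (v : V) : Prop :=
  v ∈ S ∧ ∀ y ∈ S, ¬ G.Adj v y

theorem IsIsolatedIn.notMem (hv : G.IsIsolatedIn S v) {y : V} (h : G.Adj v y) : y ∉ S :=
  fun hy => hv.2 y hy h

theorem middleOk_nbrCode (hG : G.TriplesOnPaths) (hS : G.IsGPSet S)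
    (he : ∀ y ∉ S, ∃ i, e i = y) (hu : G.IsIsolatedIn S u) (hv : G.IsIsolatedIn S v)
    (hw : G.IsIsolatedIn S w) (huv : u ≠ v) (huw : u ≠ w) (hvw : v ≠ w) (h : G.Between u v w) :
    (middleOk (G.nbrCode e u) (G.nbrCode e v) (G.nbrCode e w) &&
      containOk (G.nbrCode e u) (G.nbrCode e v) (G.nbrCode e w)) = true := by
  obtain ⟨P, x, y, y', z, -, ⟨h1, h2, h3, h4⟩, hne, ⟨h5, h6, h7, h8, -⟩, -⟩ :=
    h.exists_path (hu.2 v hv.1) (hv.2 w hw.1)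
  rw [middleOk, Bool.and_eq_true, Bool.and_eq_true, Bool.and_eq_true]
  refine ⟨⟨⟨distinctReps_nbrCode he (hv.notMem h2) (hv.notMem h3) hne h2 h6 h3 h7, ?_⟩, ?_⟩, ?_⟩
  · exact bne_iff_ne.2 (bitDiff_nbrCode_ne_zero he (hu.notMem h1) h1 h5)
  · exact bne_iff_ne.2 (bitDiff_nbrCode_ne_zero he (hw.notMem h4) h4 h8)
  · by_contra hc
    simp only [containOk, Bool.or_eq_true, not_or, bne_iff_ne, not_not] at hc
    obtain ⟨⟨c1, c2⟩, c3⟩ := hc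
    refine hG.false_of_subset hS hu.1 hv.1 hw.1 huv huw hvw (hu.2 v hv.1) (hu.2 w hw.1)
      (hv.2 w hw.1) ?_ ?_ ?_
    · intro y hy
      obtain ⟨i, rfl⟩ := he y (hu.notMem hy)
      exact bitDiff_nbrCode_eq_zero c1 i hy
    · intro y hy
      obtain ⟨i, rfl⟩ := he y (hw.notMem hy)
      exact bitDiff_nbrCode_eq_zero c2 i hy
    · intro y hy hy'
      obtain ⟨i, rfl⟩ := he y (hu.notMem hy)
      exact nbrCode_and_eq_zero.1 c3 i ⟨hy, hy'⟩

theorem tripleOk_nbrCode (hG : G.TriplesOnPaths) (hS : G.IsGPSet S)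
    (he : ∀ y ∉ S, ∃ i, e i = y) (hu : G.IsIsolatedIn S u) (hv : G.IsIsolatedIn S v)
    (hw : G.IsIsolatedIn S w) (huv : u ≠ v) (huw : u ≠ w) (hvw : v ≠ w) :
    tripleOk (G.nbrCode e u) (G.nbrCode e v) (G.nbrCode e w) = true := by
  rw [tripleOk, Bool.or_eq_true, Bool.or_eq_true, or_assoc]
  refine (hG huv huw hvw).imp ?_ (Or.imp ?_ ?_)
  · exact middleOk_nbrCode hG hS he hu hv hw huv huw hvw
  · exact middleOk_nbrCode hG hS he hv hu hw huv.symm hvw huw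
  · exact middleOk_nbrCode hG hS he hu hw hv huw huv hvw.symm

theorem nbrCode_injOn (hG : G.TriplesOnPaths) (h3 : 3 ≤ S.ncard) (he : ∀ y ∉ S, ∃ i, e i = y) :
    Set.InjOn (G.nbrCode e) {v | G.IsIsolatedIn S v} := by
  intro u hu v hv h
  by_contra huv
  obtain ⟨w, hw, hwn⟩ : ∃ w ∈ S, w ∉ ({u, v} : Set V) := by
    refine Set.exists_mem_notMem_of_ncard_lt_ncard ?_
    rw [Set.ncard_pair huv]
    omega
  simp only [Set.mem_insert_iff, Set.mem_singleton_iff, not_or] at hwn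
  refine hG.false_of_twins hu.2 hv.2 hu.1 hv.1 hw huv (Ne.symm hwn.1) (Ne.symm hwn.2) fun y => ?_
  by_cases hy : y ∈ S
  · exact iff_of_false (hu.2 y hy) (hv.2 y hy)
  · obtain ⟨i, rfl⟩ := he y hy
    rw [← testBit_nbrCode, ← testBit_nbrCode, h]

theorem IsIsolatedIn.nbrCode_ne_zero (hG : G.TriplesOnPaths) (h3 : 3 ≤ S.ncard)
    (he : ∀ y ∉ S, ∃ i, e i = y) (hu : G.IsIsolatedIn S u) : G.nbrCode e u ≠ 0 := by
  obtain ⟨v, hv, hvu⟩ : ∃ v ∈ S, v ∉ ({u} : Set V) := by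
    refine Set.exists_mem_notMem_of_ncard_lt_ncard ?_
    rw [Set.ncard_singleton]
    omega
  obtain ⟨w, hw, hwn⟩ : ∃ w ∈ S, w ∉ ({u, v} : Set V) := by
    refine Set.exists_mem_notMem_of_ncard_lt_ncard ?_
    rw [Set.ncard_pair (Ne.symm hvu)]
    omega
  simp only [Set.mem_insert_iff, Set.mem_singleton_iff, not_or] at hwn hvu
  obtain ⟨p⟩ := hG.reachable (Ne.symm hvu) (Ne.symm hwn.1) (Ne.symm hwn.2)
  cases p with
  | nil => exact absurd rfl hvu
  | cons h _ => exact SimpleGraph.nbrCode_ne_zero he (hu.notMem h) h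

theorem ncard_lt_of_noFamily [Finite V] {W : Set V} (hW : Set.InjOn (G.nbrCode e) W) {n : ℕ}
    {ok : ℕ → List ℕ → Bool} {cand : List ℕ} (h : noFamily ok n [] cand = true)
    (hc : cand.Nodup) (hWc : ∀ v ∈ W, G.nbrCode e v ∈ cand)
    (hok : ∀ c ch, c ∈ G.nbrCode e '' W → (∀ a ∈ ch, a ∈ G.nbrCode e '' W ∧ a ≠ c) →
      ok c ch = true) : W.ncard < n := by
  classical
  have := length_lt_of_noFamily (F := (· ∈ G.nbrCode e '' W)) hok h
    (L := cand.filter (· ∈ G.nbrCode e '' W)) List.filter_sublist hc (by simp) (by simp)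
  refine lt_of_le_of_lt ?_ this
  rw [← hW.ncard_image, ← List.toFinset_card_of_nodup (hc.filter _), ← Set.ncard_coe_finset]
  refine Set.ncard_le_ncard ?_ (Finset.finite_toSet _)
  rintro _ ⟨v, hv, rfl⟩
  simpa using ⟨hWc v hv, v, hv, rfl⟩

theorem familyOk_nbrCode (hG : G.TriplesOnPaths) (hS : G.IsGPSet S) (he : ∀ y ∉ S, ∃ i, e i = y)
    {c : ℕ} {ch : List ℕ} (hc : c ∈ G.nbrCode e '' {v | G.IsIsolatedIn S v})
    (hch : ∀ a ∈ ch, a ∈ G.nbrCode e '' {v | G.IsIsolatedIn S v} ∧ a ≠ c) :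
    familyOk c ch = true := by
  simp only [familyOk, List.all_eq_true, Bool.or_eq_true, beq_iff_eq]
  intro a ha b hb
  rw [or_iff_not_imp_left]
  intro hab
  obtain ⟨w, hw, rfl⟩ := hc
  obtain ⟨⟨u, hu, rfl⟩, h1⟩ := hch a ha
  obtain ⟨⟨v, hv, rfl⟩, h2⟩ := hch b hb
  exact tripleOk_nbrCode hG hS he hu hv hw (fun h => hab (h ▸ rfl)) (fun h => h1 (h ▸ rfl))
    (fun h => h2 (h ▸ rfl))

theorem ncard_le_of_isolated [Finite V] (hG : G.TriplesOnPaths) (hS : G.IsGPSet S)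
    (h3 : 3 ≤ S.ncard) (he : ∀ y ∉ S, ∃ i, e i = y) (ht : t ∈ [2, 3, 4])
    (h : ∀ v ∈ S, ∀ w ∈ S, ¬ G.Adj v w) : S.ncard ≤ complBound t := by
  have hSW : {v | G.IsIsolatedIn S v} = S :=
    Set.ext fun v => ⟨fun hv => hv.1, fun hv => ⟨hv, h v hv⟩⟩
  have := ncard_lt_of_noFamily (nbrCode_injOn hG h3 he) (noFamily_check t ht)
    (List.nodup_range' ..) (fun v hv => ?_) (fun c ch => familyOk_nbrCode hG hS he)
  · rw [hSW] at this
    omega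
  · have h1 := IsIsolatedIn.nbrCode_ne_zero hG h3 he hv
    have h2 := nbrCode_lt (G := G) (e := e) (v := v)
    rw [List.mem_range'_1]
    omega

theorem pairTripleOk_nbrCode (hG : G.TriplesOnPaths) (hS : G.IsGPSet S)
    (he : ∀ y ∉ S, ∃ i, e i = y) (hs : s ∈ S) (hs' : s' ∈ S) (hss : G.Adj s s')
    (hv : G.IsIsolatedIn S v) (hw : G.IsIsolatedIn S w) (hvw : v ≠ w) :
    pairTripleOk (G.nbrCode e s) (G.nbrCode e s') (G.nbrCode e v) (G.nbrCode e w) = true := by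
  have hvs : v ≠ s := by rintro rfl; exact hv.2 _ hs' hss
  have hws : w ≠ s := by rintro rfl; exact hw.2 _ hs' hss
  have hN : ∀ {y}, G.Adj s y → y ≠ s' → y ∉ S := fun h hy hyS =>
    hy (hG.unique_partner hS hs hyS hs' h hss)
  simp only [pairTripleOk, Bool.or_eq_true, Bool.and_eq_true, bne_iff_ne]
  rcases hG hvs.symm hws.symm hvw with h | h | h
  · obtain ⟨P, x, y, y', z, -, ⟨h1, h2, h3, h4⟩, hne, ⟨h5, h6, h7, h8, -⟩, -⟩ :=
      h.exists_path (fun e => hv.2 s hs e.symm) (hv.2 w hw.1)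
    exact .inl (.inl (.inl (.inl ⟨distinctReps_nbrCode he (hv.notMem h2) (hv.notMem h3) hne
      h2 h6 h3 h7, bitDiff_nbrCode_ne_zero he (hw.notMem h4) h4 h8⟩)))
  · obtain ⟨P, x, y, y', z, -, ⟨h1, h2, h3, h4⟩, hne, ⟨h5, h6, h7, h8, h9, h10⟩, -⟩ :=
      h.exists_path (hv.2 s hs) (fun e => hw.2 s hs e.symm)
    have d1 := bitDiff_nbrCode_ne_zero he (hv.notMem h1) h1 h5
    have d2 := bitDiff_nbrCode_ne_zero he (hw.notMem h4) h4 h8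
    by_cases hy : y = s'
    · subst hy
      exact .inl (.inr ⟨⟨bitDiff_nbrCode_ne_zero he (hN h3 hne.symm) h3 h7,
        bitDiff_bitDiff_nbrCode_ne_zero he (hw.notMem h4) h4 h8 h9⟩, d1⟩)
    by_cases hy' : y' = s'
    · subst hy'
      exact .inr ⟨⟨bitDiff_nbrCode_ne_zero he (hN h2 hne) h2 h6,
        bitDiff_bitDiff_nbrCode_ne_zero he (hv.notMem h1) h1 h5 fun e => h10 e.symm⟩, d2⟩
    exact .inl (.inl (.inr ⟨⟨distinctReps_nbrCode he (hN h2 hy) (hN h3 hy') hne h2 h6 h3 h7, d1⟩,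
      d2⟩))
  · obtain ⟨P, x, y, y', z, -, ⟨h1, h2, h3, h4⟩, hne, ⟨h5, h6, h7, h8, -⟩, -⟩ :=
      h.exists_path (fun e => hw.2 s hs e.symm) (hw.2 v hv.1)
    exact .inl (.inl (.inl (.inr ⟨distinctReps_nbrCode he (hw.notMem h2) (hw.notMem h3) hne
      h2 h6 h3 h7, bitDiff_nbrCode_ne_zero he (hv.notMem h4) h4 h8⟩)))

theorem ncard_le_of_pair [Finite V] (hG : G.TriplesOnPaths) (hS : G.IsGPSet S)
    (h3 : 3 ≤ S.ncard) (he : ∀ y ∉ S, ∃ i, e i = y) (ht : t ∈ [2, 3, 4])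
    (hs : s ∈ S) (hs' : s' ∈ S) (hss : G.Adj s s')
    (h : ∀ v ∈ S, v ≠ s → v ≠ s' → G.IsIsolatedIn S v) : S.ncard ≤ complBound t := by
  have hcode : ∀ {a b}, a ∈ S → b ∈ S → G.Adj a b →
      G.nbrCode e a ∈ List.range' 1 (2 ^ t - 1) := by
    intro a b ha hb hab
    obtain ⟨w, hw, hwn⟩ : ∃ w ∈ S, w ∉ ({a, b} : Set V) := by
      refine Set.exists_mem_notMem_of_ncard_lt_ncard ?_
      rw [Set.ncard_pair hab.ne]
      omega
    simp only [Set.mem_insert_iff, Set.mem_singleton_iff, not_or] at hwn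
    obtain ⟨y, hy, hyb⟩ := hG.exists_adj_ne hS ha hb hw hab hwn.1 hwn.2
    have h1 := nbrCode_ne_zero (G := G) he
      (fun hyS => hyb (hG.unique_partner hS ha hyS hb hy hab)) hy
    have h2 := nbrCode_lt (G := G) (e := e) (v := a)
    rw [List.mem_range'_1]
    omega
  have hW := ncard_lt_of_noFamily (nbrCode_injOn hG h3 he)
    (noFamily_pair_check t ht _ (hcode hs hs' hss) _ (hcode hs' hs hss.symm)
      (nbrCode_and_eq_zero.2 fun i hi => hG.not_triangle hss hi.2 hi.1))
    ((List.nodup_range' ..).filter _) (fun v hv => ?_) (fun c ch hc hch => ?_)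
  · have hsub : S ⊆ {v | G.IsIsolatedIn S v} ∪ {s, s'} := by
      intro v hv
      by_cases h1 : v = s
      · simp [h1]
      by_cases h2 : v = s'
      · simp [h2]
      exact Or.inl (h v hv h1 h2)
    have h1 := Set.ncard_le_ncard hsub
    have h2 := Set.ncard_union_le {v | G.IsIsolatedIn S v} {s, s'}
    rw [Set.ncard_pair hss.ne] at h2
    omega
  · have h1 := IsIsolatedIn.nbrCode_ne_zero hG h3 he hv
    have h2 := nbrCode_lt (G := G) (e := e) (v := v)
    have hvs : v ≠ s := by rintro rfl; exact hv.2 _ hs' hss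
    have hvs' : v ≠ s' := by rintro rfl; exact hv.2 _ hs hss.symm
    rw [List.mem_filter, List.mem_range'_1]
    refine ⟨by omega, ?_⟩
    rw [beq_iff_eq, Bool.eq_iff_iff, beq_iff_eq, beq_iff_eq, ← not_iff_not, nbrCode_and_eq_zero,
      nbrCode_and_eq_zero]
    have key : ∀ {a b}, a ∈ S → b ∈ S → G.Adj a b → v ≠ a → v ≠ b →
        (∃ i, G.Adj v (e i) ∧ G.Adj a (e i)) → ∃ i, G.Adj v (e i) ∧ G.Adj b (e i) := by
      rintro a b ha hb hab hva hvb ⟨i, h1, h2⟩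
      obtain ⟨y, h3, h4⟩ := hG.exists_common_neighbor hS ha hb hv.1 hab hva hvb ⟨_, h2, h1⟩
      obtain ⟨j, rfl⟩ := he y (hv.notMem h4)
      exact ⟨j, h4, h3⟩
    push Not
    exact ⟨key hs hs' hss hvs hvs', key hs' hs hss.symm hvs' hvs⟩
  · rw [pairFamilyOk, Bool.and_eq_true, List.all_eq_true]
    refine ⟨fun a ha => ?_, familyOk_nbrCode hG hS he hc hch⟩
    obtain ⟨w, hw, rfl⟩ := hc
    obtain ⟨⟨v, hv, rfl⟩, hvw⟩ := hch a ha
    have hvw : v ≠ w := fun h => hvw (h ▸ rfl)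
    rw [Bool.and_eq_true]
    exact ⟨pairTripleOk_nbrCode hG hS he hs hs' hss hv hw hvw,
      pairTripleOk_nbrCode hG hS he hs' hs hss.symm hv hw hvw⟩

end SimpleGraph

end

section

namespace SimpleGraph

variable {V : Type*} {G : SimpleGraph V} {S : Set V} {u v w : V}

/-! ### Sets in general position with two edges -/

theorem TriplesOnPaths.exists_adj_notMem (hG : G.TriplesOnPaths) (hS : G.IsGPSet S)
    (h3 : 3 ≤ S.ncard) (hv : v ∈ S) : ∃ y ∉ S, G.Adj v y := by
  by_cases hp : ∃ c ∈ S, G.Adj v c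
  · obtain ⟨c, hc, hvc⟩ := hp
    obtain ⟨w, hw, hwn⟩ : ∃ w ∈ S, w ∉ ({v, c} : Set V) := by
      refine Set.exists_mem_notMem_of_ncard_lt_ncard ?_
      rw [Set.ncard_pair hvc.ne]
      omega
    simp only [Set.mem_insert_iff, Set.mem_singleton_iff, not_or] at hwn
    obtain ⟨y, hy, hyc⟩ := hG.exists_adj_ne hS hv hc hw hvc hwn.1 hwn.2
    exact ⟨y, fun hyS => hyc (hG.unique_partner hS hv hyS hc hy hvc), hy⟩
  · push Not at hp
    obtain ⟨u, hu, huv⟩ : ∃ u ∈ S, u ∉ ({v} : Set V) := by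
      refine Set.exists_mem_notMem_of_ncard_lt_ncard ?_
      rw [Set.ncard_singleton]
      omega
    obtain ⟨w, hw, hwn⟩ : ∃ w ∈ S, w ∉ ({v, u} : Set V) := by
      refine Set.exists_mem_notMem_of_ncard_lt_ncard ?_
      rw [Set.ncard_pair (Ne.symm huv)]
      omega
    simp only [Set.mem_insert_iff, Set.mem_singleton_iff, not_or] at hwn huv
    obtain ⟨p⟩ := hG.reachable (Ne.symm huv) (Ne.symm hwn.1) (Ne.symm hwn.2)
    cases p with
    | nil => exact absurd rfl huv
    | cons h _ => exact ⟨_, fun hy => hp _ hy h, h⟩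

/-- Consider vertices `u`, `v`, `w` with a common neighbour `o`, further pairwise common neighbours
`i` of `u'` and `v`, `j` of `u` and `v'`, and so on as listed. No induced path leads from `u` to `w`
through `v`: it avoids `o`, and in each case one of the remaining vertices would have three
neighbours on it. -/
theorem Between.false_of_star {o i j k u' v' w' : V} (h : G.Between u v w) (huv : ¬ G.Adj u v)
    (hvw : ¬ G.Adj v w) (huw : u ≠ w) (hou : G.Adj o u) (hov : G.Adj o v) (how : G.Adj o w)
    (huv' : u' ≠ v') (huw' : u' ≠ w') (hvw' : v' ≠ w')
    (hv : ∀ y, G.Adj v y → y = o ∨ y = i ∨ (y = v' ∧ G.Adj y j ∧ G.Adj y k))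
    (hu : ∀ y, G.Adj u y → y = o ∨ y = j ∨ (y = u' ∧ G.Adj y i ∧ G.Adj y k))
    (hw : ∀ y, G.Adj w y → y = o ∨ y = k ∨ (y = w' ∧ G.Adj y i ∧ G.Adj y j)) : False := by
  have h1 := h.ne_left
  have h2 := h.symm.ne_left
  obtain ⟨P, x, y, y', z, ⟨uP, vP, wP, xP, yP, yP', zP⟩, ⟨ux, vy, vy', wz⟩, hne,
    ⟨n1, n2, n3, n4, -⟩, -, -, h3, -⟩ := h.exists_path huv hvw
  have hoP : o ∉ P := fun ho => by
    rcases h3 o ho u uP v vP w wP hou hov how with e | e | e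
    exacts [h1 e, huw e, h2 e.symm]
  have a1 := hu x ux
  have a2 := hv y vy
  have a3 := hv y' vy'
  have a4 := hw z wz
  have nx : x ≠ o := fun e => hoP (e ▸ xP)
  have ny : y ≠ o := fun e => hoP (e ▸ yP)
  have ny' : y' ≠ o := fun e => hoP (e ▸ yP')
  have nz : z ≠ o := fun e => hoP (e ▸ zP)
  have hxz : x ≠ z := fun e => n4 (e ▸ ux)
  have hvi : i ∈ P ∧ G.Adj v i ∧ v' ∈ P ∧ G.Adj v v' ∧ G.Adj v' j ∧ G.Adj v' k := by grind
  obtain ⟨iP, vi, vP', vv', vj, vk⟩ := hvi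
  have hvx : v ≠ x := fun e => huv (e ▸ ux)
  have hvz : v ≠ z := fun e => hvw (e ▸ wz.symm)
  rcases a1.resolve_left nx with rfl | ⟨rfl, c1, c2⟩
  · rcases a4.resolve_left nz with rfl | ⟨rfl, d1, d2⟩
    · rcases h3 v' vP' v vP x xP z zP vv'.symm vj vk with e | e | e
      exacts [hvx e, hvz e, hxz e]
    · rcases h3 x xP u uP v' vP' z zP ux.symm vj.symm d2.symm with e | e | e
      · exact huv (e ▸ vv'.symm)
      · exact n4 (by rw [← e] at wz; exact absurd wz (fun f => h.not_adj f.symm))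
      · exact hvw' e
  · rcases a4.resolve_left nz with rfl | ⟨rfl, d1, d2⟩
    · rcases h3 z zP w wP v' vP' x xP wz.symm vk.symm c2.symm with e | e | e
      · exact hvw (e ▸ vv')
      · exact n1 (by rw [← e] at ux; exact absurd ux h.not_adj)
      · exact huv' e.symm
    · rcases h3 i iP v vP x xP z zP vi.symm c1.symm d1.symm with e | e | e
      exacts [hvx e, hvz e, huw' e]

/-- Two edges `s₁s₁'` and `s₂s₂'` of a set `S` whose complement consists of one common neighbour of
each end of the first edge and each end of the second. -/
structure IsLinkedPair (G : SimpleGraph V) (S : Set V) (s₁ s₁' s₂ s₂' x y x' y' : V) : Prop where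
  mem₁ : s₁ ∈ S
  mem₁' : s₁' ∈ S
  mem₂ : s₂ ∈ S
  mem₂' : s₂' ∈ S
  nex : x ∉ S
  ney : y ∉ S
  nex' : x' ∉ S
  ney' : y' ∉ S
  adj₁ : G.Adj s₁ s₁'
  adj₂ : G.Adj s₂ s₂'
  ne : s₁ ≠ s₂
  ne' : s₁' ≠ s₂'
  ne₁ : s₁ ≠ s₂'
  ne₂ : s₁' ≠ s₂
  x₁ : G.Adj s₁ x
  x₂ : G.Adj s₂ x
  y₁ : G.Adj s₁ y
  y₂ : G.Adj s₂' y
  x₁' : G.Adj s₁' x'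
  x₂' : G.Adj s₂ x'
  y₁' : G.Adj s₁' y'
  y₂' : G.Adj s₂' y'
  compl : ∀ z ∉ S, z = x ∨ z = y ∨ z = x' ∨ z = y'

namespace IsLinkedPair

variable {s₁ s₁' s₂ s₂' x y x' y' : V}

theorem swap_right (h : G.IsLinkedPair S s₁ s₁' s₂ s₂' x y x' y') :
    G.IsLinkedPair S s₁ s₁' s₂' s₂ y x y' x' :=
  ⟨h.mem₁, h.mem₁', h.mem₂', h.mem₂, h.ney, h.nex, h.ney', h.nex', h.adj₁, h.adj₂.symm, h.ne₁,
    h.ne₂, h.ne, h.ne', h.y₁, h.y₂, h.x₁, h.x₂, h.y₁', h.y₂', h.x₁', h.x₂', fun z hz => by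
      have := h.compl z hz; tauto⟩

theorem swap_left (h : G.IsLinkedPair S s₁ s₁' s₂ s₂' x y x' y') :
    G.IsLinkedPair S s₁' s₁ s₂ s₂' x' y' x y :=
  ⟨h.mem₁', h.mem₁, h.mem₂, h.mem₂', h.nex', h.ney', h.nex, h.ney, h.adj₁.symm, h.adj₂, h.ne₂,
    h.ne₁, h.ne', h.ne, h.x₁', h.x₂', h.y₁', h.y₂', h.x₁, h.x₂, h.y₁, h.y₂, fun z hz => by
      have := h.compl z hz; tauto⟩

theorem flip (h : G.IsLinkedPair S s₁ s₁' s₂ s₂' x y x' y') :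
    G.IsLinkedPair S s₂ s₂' s₁ s₁' x x' y y' :=
  ⟨h.mem₂, h.mem₂', h.mem₁, h.mem₁', h.nex, h.nex', h.ney, h.ney', h.adj₂, h.adj₁, h.ne.symm,
    h.ne'.symm, h.ne₂.symm, h.ne₁.symm, h.x₂, h.x₁, h.x₂', h.x₁', h.y₂, h.y₁, h.y₂', h.y₁',
    fun z hz => by have := h.compl z hz; tauto⟩

theorem eq_of_adj (h : G.IsLinkedPair S s₁ s₁' s₂ s₂' x y x' y') (hG : G.TriplesOnPaths)
    (hS : G.IsGPSet S) {z : V} (hz : G.Adj s₁ z) : z = s₁' ∨ z = x ∨ z = y := by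
  by_cases hzS : z ∈ S
  · exact Or.inl (hG.unique_partner hS h.mem₁ hzS h.mem₁' hz h.adj₁)
  · rcases h.compl z hzS with rfl | rfl | rfl | rfl
    · simp
    · simp
    · exact (hG.not_triangle h.adj₁ h.x₁' hz).elim
    · exact (hG.not_triangle h.adj₁ h.y₁' hz).elim

theorem adj_of_adj (h : G.IsLinkedPair S s₁ s₁' s₂ s₂' x y x' y') (hG : G.TriplesOnPaths)
    (hS : G.IsGPSet S) (hw : w ∈ S) (h1 : w ≠ s₁) (h1' : w ≠ s₁') (h2 : w ≠ s₂) (h2' : w ≠ s₂')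
    (hwx : G.Adj w x) : G.Adj w y' ∨ (G.Adj w y ∧ G.Adj w x') := by
  have hn : ∀ {a c}, a ∈ S → c ∈ S → G.Adj a c → w ≠ c → ¬ G.Adj w a := fun ha hc hac hwc e =>
    hwc (hG.unique_partner hS ha hw hc e.symm hac)
  obtain ⟨z, e1, e2⟩ := hG.exists_common_neighbor hS h.mem₁ h.mem₁' hw h.adj₁ h1 h1' ⟨x, h.x₁, hwx⟩
  obtain ⟨t, e3, e4⟩ := hG.exists_common_neighbor hS h.mem₂ h.mem₂' hw h.adj₂ h2 h2' ⟨x, h.x₂, hwx⟩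
  rcases h.swap_left.eq_of_adj hG hS e1 with rfl | rfl | rfl
  · exact (hn h.mem₁ h.mem₁' h.adj₁ h1' e2).elim
  · rcases h.flip.swap_left.eq_of_adj hG hS e3 with rfl | rfl | rfl
    · exact (hn h.mem₂ h.mem₂' h.adj₂ h2' e4).elim
    · exact Or.inr ⟨e4, e2⟩
    · exact Or.inl e4
  · exact Or.inl e2

theorem diagonal (h : G.IsLinkedPair S s₁ s₁' s₂ s₂' x y x' y') (hG : G.TriplesOnPaths)
    (hS : G.IsGPSet S) (h3 : 3 ≤ S.ncard) (hw : w ∈ S) (h1 : w ≠ s₁) (h1' : w ≠ s₁') (h2 : w ≠ s₂)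
    (h2' : w ≠ s₂') : (G.Adj w x ∧ G.Adj w y') ∨ (G.Adj w y ∧ G.Adj w x') := by
  obtain ⟨z, hz, hwz⟩ := hG.exists_adj_notMem hS h3 hw
  rcases h.compl z hz with rfl | rfl | rfl | rfl
  · have := h.adj_of_adj hG hS hw h1 h1' h2 h2' hwz; tauto
  · have := h.swap_right.adj_of_adj hG hS hw h1 h1' h2' h2 hwz; tauto
  · have := h.swap_left.adj_of_adj hG hS hw h1' h1 h2 h2' hwz; tauto
  · have := h.swap_left.swap_right.adj_of_adj hG hS hw h1' h1 h2' h2 hwz; tauto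

theorem not_adj_of_ne (h : G.IsLinkedPair S s₁ s₁' s₂ s₂' x y x' y') (hG : G.TriplesOnPaths)
    (hS : G.IsGPSet S) (hw : w ∈ S) (hw' : w ≠ s₁') : ¬ G.Adj s₁ w :=
  fun e => hw' (hG.unique_partner hS h.mem₁ hw h.mem₁' e h.adj₁)

/-- A further vertex of `S` is not adjacent to `x` and `y'` only. -/
theorem exists_third (h : G.IsLinkedPair S s₁ s₁' s₂ s₂' x y x' y') (hG : G.TriplesOnPaths)
    (hS : G.IsGPSet S) (h3 : 3 ≤ S.ncard) (hw : w ∈ S) (h1 : w ≠ s₁) (h1' : w ≠ s₁') (h2 : w ≠ s₂)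
    (h2' : w ≠ s₂') (hx : G.Adj w x) (hy' : G.Adj w y') : G.Adj w y ∨ G.Adj w x' := by
  by_contra! hc
  obtain ⟨w', hw1, hw2, hN⟩ : ∃ w', w' ≠ s₁' ∧ w' ≠ s₂' ∧ ∀ z, G.Adj w z →
      z = x ∨ z = y' ∨ (z = w' ∧ G.Adj z y ∧ G.Adj z x') := by
    have hT : ∀ z ∉ S, G.Adj w z → z = x ∨ z = y' := by
      intro z hz hwz
      rcases h.compl z hz with rfl | rfl | rfl | rfl
      · exact Or.inl rfl
      · exact absurd hwz hc.1
      · exact absurd hwz hc.2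
      · exact Or.inr rfl
    by_cases hp : ∃ c ∈ S, G.Adj w c
    · obtain ⟨c, hcS, hwc⟩ := hp
      have c1 : c ≠ s₁ := by
        rintro rfl; exact h1' (hG.unique_partner hS hcS hw h.mem₁' hwc.symm h.adj₁)
      have c1' : c ≠ s₁' := by
        rintro rfl; exact h1 (hG.unique_partner hS hcS hw h.mem₁ hwc.symm h.adj₁.symm)
      have c2 : c ≠ s₂ := by
        rintro rfl; exact h2' (hG.unique_partner hS hcS hw h.mem₂' hwc.symm h.adj₂)
      have c2' : c ≠ s₂' := by
        rintro rfl; exact h2 (hG.unique_partner hS hcS hw h.mem₂ hwc.symm h.adj₂.symm)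
      have hd : G.Adj c y ∧ G.Adj c x' :=
        (h.diagonal hG hS h3 hcS c1 c1' c2 c2').resolve_left
          fun e => hG.not_triangle hwc e.1 hx
      refine ⟨c, c1', c2', fun z hz => ?_⟩
      by_cases hzS : z ∈ S
      · obtain rfl := hG.unique_partner hS hw hzS hcS hz hwc
        exact Or.inr (Or.inr ⟨rfl, hd⟩)
      · exact (hT z hzS hz).imp_right Or.inl
    -- Without a partner of `w` in `S`, any vertex may play its part.
    · push Not at hp
      exact ⟨w, h1', h2', fun z hz => (hT z (fun hzS => hp z hzS hz) hz).imp_right Or.inl⟩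
  have N1 : ∀ z, G.Adj s₁ z → z = x ∨ z = y ∨ (z = s₁' ∧ G.Adj z x' ∧ G.Adj z y') := by
    intro z hz
    rcases h.eq_of_adj hG hS hz with rfl | e | e
    · exact Or.inr (Or.inr ⟨rfl, h.x₁', h.y₁'⟩)
    · exact Or.inl e
    · exact Or.inr (Or.inl e)
  have N2 : ∀ z, G.Adj s₂ z → z = x ∨ z = x' ∨ (z = s₂' ∧ G.Adj z y ∧ G.Adj z y') := by
    intro z hz
    rcases h.flip.eq_of_adj hG hS hz with rfl | e | e
    · exact Or.inr (Or.inr ⟨rfl, h.y₂, h.y₂'⟩)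
    · exact Or.inl e
    · exact Or.inr (Or.inl e)
  have n12 := h.not_adj_of_ne hG hS h.mem₂ h.ne₂.symm
  have n1w := h.not_adj_of_ne hG hS hw h1'
  have n2w := h.flip.not_adj_of_ne hG hS hw h2'
  rcases hG h.ne h1.symm h2.symm with hB | hB | hB
  · exact hB.false_of_star n12 n2w h1.symm h.x₁.symm h.x₂.symm hx.symm h.ne' hw1.symm hw2.symm
      N2 N1 (fun z hz => by have := hN z hz; tauto)
  · exact hB.false_of_star (fun e => n12 e.symm) n1w h2.symm h.x₂.symm h.x₁.symm hx.symm h.ne'.symm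
      hw2.symm hw1.symm N1 N2 (fun z hz => by have := hN z hz; tauto)
  · exact hB.false_of_star n1w (fun e => n2w e.symm) h.ne h.x₁.symm hx.symm h.x₂.symm hw1.symm
      h.ne' hw2 (fun z hz => by have := hN z hz; tauto) (fun z hz => by have := N1 z hz; tauto)
      (fun z hz => by have := N2 z hz; tauto)

end IsLinkedPair
end SimpleGraph

end

section

namespace SimpleGraph

variable {V : Type*} {G : SimpleGraph V} {S : Set V} {u v w : V}

namespace IsLinkedPair

variable {s₁ s₁' s₂ s₂' x y x' y' : V}

/-- A further vertex of `S` is adjacent to at least three of the four vertices outside `S`. -/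
theorem three_adj (h : G.IsLinkedPair S s₁ s₁' s₂ s₂' x y x' y') (hG : G.TriplesOnPaths)
    (hS : G.IsGPSet S) (h3 : 3 ≤ S.ncard) (hw : w ∈ S) (h1 : w ≠ s₁) (h1' : w ≠ s₁') (h2 : w ≠ s₂)
    (h2' : w ≠ s₂') : (G.Adj w x ∧ G.Adj w y' ∧ (G.Adj w y ∨ G.Adj w x')) ∨
      (G.Adj w y ∧ G.Adj w x' ∧ (G.Adj w x ∨ G.Adj w y')) := by
  rcases h.diagonal hG hS h3 hw h1 h1' h2 h2' with ⟨hx, hy'⟩ | ⟨hy, hx'⟩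
  · exact Or.inl ⟨hx, hy', h.exists_third hG hS h3 hw h1 h1' h2 h2' hx hy'⟩
  · exact Or.inr ⟨hy, hx', h.swap_right.exists_third hG hS h3 hw h1 h1' h2' h2 hy hx'⟩

theorem isIsolatedIn (h : G.IsLinkedPair S s₁ s₁' s₂ s₂' x y x' y') (hG : G.TriplesOnPaths)
    (hS : G.IsGPSet S) (h3 : 3 ≤ S.ncard) (hw : w ∈ S) (h1 : w ≠ s₁) (h1' : w ≠ s₁') (h2 : w ≠ s₂)
    (h2' : w ≠ s₂') : G.IsIsolatedIn S w := by
  refine ⟨hw, fun c hc hwc => ?_⟩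
  have c1 : c ≠ s₁ := by
    rintro rfl; exact h1' (hG.unique_partner hS hc hw h.mem₁' hwc.symm h.adj₁)
  have c1' : c ≠ s₁' := by
    rintro rfl; exact h1 (hG.unique_partner hS hc hw h.mem₁ hwc.symm h.adj₁.symm)
  have c2 : c ≠ s₂ := by
    rintro rfl; exact h2' (hG.unique_partner hS hc hw h.mem₂' hwc.symm h.adj₂)
  have c2' : c ≠ s₂' := by
    rintro rfl; exact h2 (hG.unique_partner hS hc hw h.mem₂ hwc.symm h.adj₂.symm)
  have hT : ∀ z, G.Adj w z → ¬ G.Adj c z := fun z e f => hG.not_triangle hwc f e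
  have a := h.three_adj hG hS h3 hw h1 h1' h2 h2'
  have b := h.three_adj hG hS h3 hc c1 c1' c2 c2'
  have := hT x
  have := hT y
  have := hT x'
  have := hT y'
  tauto

/-- An induced path through `s₁`, `v`, `w` avoids `x` and `y`, so `s₁` is an end of it, followed by
`s₁'`. If `v` is interior, its neighbours on the path are `x'` and `y'`, which are adjacent
to `s₁'`. -/
theorem not_between (h : G.IsLinkedPair S s₁ s₁' s₂ s₂' x y x' y') (hG : G.TriplesOnPaths)
    (hS : G.IsGPSet S) (hv : G.IsIsolatedIn S v) (hw : G.IsIsolatedIn S w) (hvw : v ≠ w)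
    (hv' : v ≠ s₁') (hvx : G.Adj v x) (hvy : G.Adj v y) (hwx : G.Adj w x) (hwy : G.Adj w y) :
    ¬ G.Between s₁ v w := by
  intro hB
  have h1 := hB.ne_left
  have h2 : s₁ ≠ w := by rintro rfl; exact hw.2 _ h.mem₁' h.adj₁
  obtain ⟨P, a, b, b', c, ⟨sP, vP, wP, aP, bP, bP', cP⟩, ⟨sa, vb, vb', wc⟩, hne, -, -, -, h3, h4⟩ :=
    hB.exists_path (h.not_adj_of_ne hG hS hv.1 hv') (hv.2 w hw.1)
  have hP : ∀ o, G.Adj s₁ o → G.Adj v o → G.Adj w o → o ∉ P := fun o e1 e2 e3 ho => by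
    rcases h3 o ho _ sP v vP w wP e1.symm e2.symm e3.symm with e | e | e
    exacts [h1 e, h2 e, hvw e]
  have hxP := hP x h.x₁ hvx hwx
  have hyP := hP y h.y₁ hvy hwy
  obtain rfl : a = s₁' := by
    rcases h.eq_of_adj hG hS sa with e | rfl | rfl
    exacts [e, (hxP aP).elim, (hyP aP).elim]
  have key : ∀ z ∈ P, G.Adj v z → G.Adj a z := by
    intro z hz hvz
    rcases h.compl z (hv.notMem hvz) with rfl | rfl | rfl | rfl
    exacts [(hxP hz).elim, (hyP hz).elim, h.x₁', h.y₁']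
  rcases h4 v vP b bP a aP b' bP' vb (key b bP vb).symm (key b' bP' vb') vb'.symm with e | e
  exacts [hv' e, hne e]

theorem false_of_adj (h : G.IsLinkedPair S s₁ s₁' s₂ s₂' x y x' y') (hG : G.TriplesOnPaths)
    (hS : G.IsGPSet S) (hv : G.IsIsolatedIn S v) (hw : G.IsIsolatedIn S w) (hvw : v ≠ w) :
    ¬ (G.Adj v x ∧ G.Adj v y ∧ G.Adj w x ∧ G.Adj w y) := by
  rintro ⟨hvx, hvy, hwx, hwy⟩
  have hv1 : v ≠ s₁ := by rintro rfl; exact hv.2 _ h.mem₁' h.adj₁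
  have hw1 : w ≠ s₁ := by rintro rfl; exact hw.2 _ h.mem₁' h.adj₁
  have hv' : v ≠ s₁' := by rintro rfl; exact hv.2 _ h.mem₁ h.adj₁.symm
  have hw' : w ≠ s₁' := by rintro rfl; exact hw.2 _ h.mem₁ h.adj₁.symm
  rcases hG hv1.symm hw1.symm hvw with hB | hB | hB
  · exact h.not_between hG hS hv hw hvw hv' hvx hvy hwx hwy hB
  · obtain ⟨P, a, b, b', c, ⟨vP, sP, wP, aP, bP, bP', cP⟩, ⟨va, sb, sb', wc⟩, hne, -, -, -, h3,
      -⟩ := hB.exists_path (fun e => hv.2 _ h.mem₁ e) (fun e => hw.2 _ h.mem₁ e.symm)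
    have hP : ∀ o, G.Adj s₁ o → G.Adj v o → G.Adj w o → o ∉ P := fun o e1 e2 e3 ho => by
      rcases h3 o ho _ sP v vP w wP e1.symm e2.symm e3.symm with e | e | e
      exacts [hv1 e.symm, hw1 e.symm, hvw e]
    have hxP := hP x h.x₁ hvx hwx
    have hyP := hP y h.y₁ hvy hwy
    have key : ∀ z ∈ P, G.Adj s₁ z → z = s₁' := by
      intro z hz hsz
      rcases h.eq_of_adj hG hS hsz with e | rfl | rfl
      exacts [e, (hxP hz).elim, (hyP hz).elim]
    exact hne ((key b bP sb).trans (key b' bP' sb').symm)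
  · exact h.not_between hG hS hw hv hvw.symm hw' hwx hwy hvx hvy hB

/-- Three further vertices of `S` are each adjacent to three of the four vertices outside `S`, so
that two of them share both the outside neighbours of some end of the two edges. -/
theorem false_of_three (h : G.IsLinkedPair S s₁ s₁' s₂ s₂' x y x' y') (hG : G.TriplesOnPaths)
    (hS : G.IsGPSet S) (h3 : 3 ≤ S.ncard) {W : Set V} (hW : W = S \ {s₁, s₁', s₂, s₂'})
    (hu : u ∈ W) (hv : v ∈ W) (hw : w ∈ W) (huv : u ≠ v) (huw : u ≠ w) (hvw : v ≠ w) : False := by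
  have key : ∀ z ∈ W, G.IsIsolatedIn S z ∧ ((G.Adj z x ∧ G.Adj z y' ∧ (G.Adj z y ∨ G.Adj z x')) ∨
      (G.Adj z y ∧ G.Adj z x' ∧ (G.Adj z x ∨ G.Adj z y'))) := by
    intro z hz
    rw [hW] at hz
    obtain ⟨hz, hn⟩ := hz
    simp only [Set.mem_insert_iff, Set.mem_singleton_iff, not_or] at hn
    exact ⟨h.isIsolatedIn hG hS h3 hz hn.1 hn.2.1 hn.2.2.1 hn.2.2.2,
      h.three_adj hG hS h3 hz hn.1 hn.2.1 hn.2.2.1 hn.2.2.2⟩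
  have two : ∀ a ∈ W, ∀ b ∈ W, a ≠ b → ¬ (G.Adj a x ∧ G.Adj a y ∧ G.Adj b x ∧ G.Adj b y) ∧
      ¬ (G.Adj a x' ∧ G.Adj a y' ∧ G.Adj b x' ∧ G.Adj b y') ∧
      ¬ (G.Adj a x ∧ G.Adj a x' ∧ G.Adj b x ∧ G.Adj b x') ∧
      ¬ (G.Adj a y ∧ G.Adj a y' ∧ G.Adj b y ∧ G.Adj b y') := fun a ha b hb hab =>
    ⟨h.false_of_adj hG hS (key a ha).1 (key b hb).1 hab,
      h.swap_left.false_of_adj hG hS (key a ha).1 (key b hb).1 hab,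
      h.flip.false_of_adj hG hS (key a ha).1 (key b hb).1 hab,
      h.swap_right.flip.false_of_adj hG hS (key a ha).1 (key b hb).1 hab⟩
  have a1 := (key u hu).2
  have a2 := (key v hv).2
  have a3 := (key w hw).2
  have b1 := two u hu v hv huv
  have b2 := two u hu w hw huw
  have b3 := two v hv w hw hvw
  grind

end IsLinkedPair

/-- Two edges `aa'` and `bb'` of `S` such that neither `a`, `a'` have a common neighbour with `b` or
`b'` do not leave room for three further vertices of `S`, if only four vertices lie outside `S`. -/
theorem TriplesOnPaths.false_of_unlinked (hG : G.TriplesOnPaths) (hS : G.IsGPSet S)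
    (h3 : 3 ≤ S.ncard) {a a' b b' p p' q q' : V} (ha : a ∈ S) (ha' : a' ∈ S) (hb : b ∈ S)
    (hb' : b' ∈ S) (hp : G.Adj a p) (hp' : G.Adj a' p') (hq : G.Adj b q) (hq' : G.Adj b' q')
    (haa : G.Adj a a') (hbb : G.Adj b b') (hT : ∀ z ∉ S, z = p ∨ z = p' ∨ z = q ∨ z = q')
    (n1 : ∀ z, ¬ (G.Adj a z ∧ G.Adj b z)) (n2 : ∀ z, ¬ (G.Adj a z ∧ G.Adj b' z))
    (n3 : ∀ z, ¬ (G.Adj a' z ∧ G.Adj b z)) (n4 : ∀ z, ¬ (G.Adj a' z ∧ G.Adj b' z))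
    {W : Set V} (hW : W = S \ {a, a', b, b'})
    (hu : u ∈ W) (hv : v ∈ W) (hw : w ∈ W) (huv : u ≠ v) (huw : u ≠ w) (hvw : v ≠ w) : False := by
  have ap' : ¬ G.Adj a p' := fun e => hG.not_triangle haa hp' e
  have ap : ¬ G.Adj a' p := fun e => hG.not_triangle haa.symm hp e
  have bq' : ¬ G.Adj b q' := fun e => hG.not_triangle hbb hq' e
  have bq : ¬ G.Adj b' q := fun e => hG.not_triangle hbb.symm hq e
  have hWS : ∀ z ∈ W, z ∈ S ∧ z ≠ a ∧ z ≠ a' ∧ z ≠ b ∧ z ≠ b' := by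
    intro z hz
    rw [hW] at hz
    simpa using hz
  have Na : ∀ z ∉ S, G.Adj a z → z = p := fun z hz e => by
    rcases hT z hz with rfl | rfl | rfl | rfl
    exacts [rfl, (ap' e).elim, (n1 _ ⟨e, hq⟩).elim, (n2 _ ⟨e, hq'⟩).elim]
  have Na' : ∀ z ∉ S, G.Adj a' z → z = p' := fun z hz e => by
    rcases hT z hz with rfl | rfl | rfl | rfl
    exacts [(ap e).elim, rfl, (n3 _ ⟨e, hq⟩).elim, (n4 _ ⟨e, hq'⟩).elim]
  have Nb : ∀ z ∉ S, G.Adj b z → z = q := fun z hz e => by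
    rcases hT z hz with rfl | rfl | rfl | rfl
    exacts [(n1 _ ⟨hp, e⟩).elim, (n3 _ ⟨hp', e⟩).elim, rfl, (bq' e).elim]
  have Nb' : ∀ z ∉ S, G.Adj b' z → z = q' := fun z hz e => by
    rcases hT z hz with rfl | rfl | rfl | rfl
    exacts [(n2 _ ⟨hp, e⟩).elim, (n4 _ ⟨hp', e⟩).elim, (bq e).elim, rfl]
  -- A vertex of `S` with a neighbour in common with one end of an edge in `S` has one in common
  -- with the other end.
  have move : ∀ {s s' p p' z : V}, s ∈ S → s' ∈ S → G.Adj s s' → G.Adj s p → z ∈ S → z ≠ s →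
      z ≠ s' → (∀ t ∉ S, G.Adj s' t → t = p') → G.Adj z p → G.Adj z p' := by
    intro s s' p p' z hs hs' hss hsp hz hzs hzs' hN hzp
    obtain ⟨t, h1, h2⟩ := hG.exists_common_neighbor hS hs hs' hz hss hzs hzs' ⟨p, hsp, hzp⟩
    have ht : t ∉ S := fun htS => by
      obtain rfl := hG.unique_partner hS hs' htS hs h1 hss.symm
      exact hzs' (hG.unique_partner hS htS hz hs' h2.symm hss)
    rwa [hN t ht h1] at h2
  have hpp : ∀ z ∈ W, G.Adj z p ↔ G.Adj z p' := fun z hz =>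
    have ⟨h1, h2, h3, _, _⟩ := hWS z hz
    ⟨move ha ha' haa hp h1 h2 h3 Na', move ha' ha haa.symm hp' h1 h3 h2 Na⟩
  have hqq : ∀ z ∈ W, G.Adj z q ↔ G.Adj z q' := fun z hz =>
    have ⟨h1, _, _, h2, h3⟩ := hWS z hz
    ⟨move hb hb' hbb hq h1 h2 h3 Nb', move hb' hb hbb.symm hq' h1 h3 h2 Nb⟩
  have hne : ∀ z ∈ W, G.Adj z p ∨ G.Adj z q := fun z hz => by
    obtain ⟨t, ht, hzt⟩ := hG.exists_adj_notMem hS h3 (hWS z hz).1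
    rcases hT t ht with rfl | rfl | rfl | rfl
    · exact Or.inl hzt
    · exact Or.inl ((hpp z hz).2 hzt)
    · exact Or.inr hzt
    · exact Or.inr ((hqq z hz).2 hzt)
  have hiso : ∀ z ∈ W, G.IsIsolatedIn S z := fun z hz => by
    obtain ⟨hzS, z1, z2, z3, z4⟩ := hWS z hz
    refine ⟨hzS, fun c hc hzc => ?_⟩
    have ca : c ≠ a := by rintro rfl; exact z2 (hG.unique_partner hS hc hzS ha' hzc.symm haa)
    have cb : c ≠ b := by rintro rfl; exact z4 (hG.unique_partner hS hc hzS hb' hzc.symm hbb)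
    rcases hne z hz with e | e
    · obtain ⟨t, h1, h2⟩ := hG.exists_common_neighbor hS hzS hc ha hzc z1.symm ca.symm ⟨p, e, hp⟩
      have ht : t ∉ S := fun htS => by
        obtain rfl := hG.unique_partner hS ha htS ha' h2 haa
        exact ca (hG.unique_partner hS htS hc ha h1.symm haa.symm)
      rw [Na t ht h2] at h1
      exact hG.not_triangle hzc h1 e
    · obtain ⟨t, h1, h2⟩ := hG.exists_common_neighbor hS hzS hc hb hzc z3.symm cb.symm ⟨q, e, hq⟩
      have ht : t ∉ S := fun htS => by
        obtain rfl := hG.unique_partner hS hb htS hb' h2 hbb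
        exact cb (hG.unique_partner hS htS hc hb h1.symm hbb.symm)
      rw [Nb t ht h2] at h1
      exact hG.not_triangle hzc h1 e
  have hsub : ∀ z₁ ∈ W, ∀ z₂ ∈ W, (G.Adj z₁ p → G.Adj z₂ p) → (G.Adj z₁ q → G.Adj z₂ q) →
      ∀ t, G.Adj z₁ t → G.Adj z₂ t := by
    intro z₁ h1 z₂ h2 e1 e2 t ht
    rcases hT t ((hiso z₁ h1).notMem ht) with rfl | rfl | rfl | rfl
    · exact e1 ht
    · exact (hpp z₂ h2).1 (e1 ((hpp z₁ h1).2 ht))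
    · exact e2 ht
    · exact (hqq z₂ h2).1 (e2 ((hqq z₁ h1).2 ht))
  have twins : ∀ z₁ ∈ W, ∀ z₂ ∈ W, z₁ ≠ z₂ →
      ¬ ((G.Adj z₁ p ↔ G.Adj z₂ p) ∧ (G.Adj z₁ q ↔ G.Adj z₂ q)) := by
    rintro z₁ h1 z₂ h2 h12 ⟨e1, e2⟩
    exact hG.false_of_twins (hiso z₁ h1).2 (hiso z₂ h2).2 (hiso z₁ h1).1 (hiso z₂ h2).1 ha h12
      (hWS z₁ h1).2.1 (hWS z₂ h2).2.1
      fun t => ⟨hsub z₁ h1 z₂ h2 e1.1 e2.1 t, hsub z₂ h2 z₁ h1 e1.2 e2.2 t⟩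
  have contained : ∀ z₁ ∈ W, ∀ z₂ ∈ W, ∀ z₃ ∈ W, z₁ ≠ z₂ → z₁ ≠ z₃ → z₂ ≠ z₃ →
      ¬ (G.Adj z₂ p ∧ G.Adj z₂ q ∧ ¬ (G.Adj z₁ p ∧ G.Adj z₃ p) ∧ ¬ (G.Adj z₁ q ∧ G.Adj z₃ q)) := by
    rintro z₁ h1 z₂ h2 z₃ h3 h12 h13 h23 ⟨e1, e2, e3, e4⟩
    refine hG.false_of_subset hS (hiso z₁ h1).1 (hiso z₂ h2).1 (hiso z₃ h3).1 h12 h13 h23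
      ((hiso z₁ h1).2 _ (hiso z₂ h2).1) ((hiso z₁ h1).2 _ (hiso z₃ h3).1)
      ((hiso z₂ h2).2 _ (hiso z₃ h3).1) (hsub z₁ h1 z₂ h2 (fun _ => e1) (fun _ => e2))
      (hsub z₃ h3 z₂ h2 (fun _ => e1) (fun _ => e2)) ?_
    intro t ht ht'
    rcases hT t ((hiso z₁ h1).notMem ht) with rfl | rfl | rfl | rfl
    · exact e3 ⟨ht, ht'⟩
    · exact e3 ⟨(hpp z₁ h1).2 ht, (hpp z₃ h3).2 ht'⟩
    · exact e4 ⟨ht, ht'⟩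
    · exact e4 ⟨(hqq z₁ h1).2 ht, (hqq z₃ h3).2 ht'⟩
  have t1 := twins u hu v hv huv
  have t2 := twins u hu w hw huw
  have t3 := twins v hv w hw hvw
  have c1 := contained u hu v hv w hw huv huw hvw
  have c2 := contained v hv u hu w hw huv.symm hvw huw
  have c3 := contained u hu w hw v hv huw huv hvw.symm
  have n1 := hne u hu
  have n2 := hne v hv
  have n3 := hne w hw
  clear * - t1 t2 t3 c1 c2 c3 n1 n2 n3
  grind

end SimpleGraph

end

section

namespace SimpleGraph

variable {V : Type*} {G : SimpleGraph V} {S : Set V}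

/-! ### The lower bound -/

theorem four_le_ncard_compl [Finite V] {p q r s : V} (hp : p ∉ S) (hq : q ∉ S) (hr : r ∉ S)
    (hs : s ∉ S) (pq : p ≠ q) (pr : p ≠ r) (ps : p ≠ s) (qr : q ≠ r) (qs : q ≠ s) (rs : r ≠ s) :
    4 ≤ Sᶜ.ncard ∧ (Sᶜ.ncard ≤ 4 → ∀ z ∉ S, z = p ∨ z = q ∨ z = r ∨ z = s) := by
  have hc : ({p, q, r, s} : Set V).ncard = 4 := by
    rw [Set.ncard_insert_of_notMem, Set.ncard_eq_three.2 ⟨q, r, s, qr, qs, rs, rfl⟩]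
    simp [pq, pr, ps]
  have hsub : ({p, q, r, s} : Set V) ⊆ Sᶜ := by
    rintro _ (rfl | rfl | rfl | rfl) <;> assumption
  have := Set.ncard_le_ncard hsub
  refine ⟨by omega, fun h z hz => ?_⟩
  rw [← Set.mem_compl_iff, ← Set.eq_of_subset_of_ncard_le hsub (by omega)] at hz
  simpa using hz

theorem ncard_le_six_of_diff [Finite V] {p q r s : V}
    (h : ∀ u ∈ S \ {p, q, r, s}, ∀ v ∈ S \ {p, q, r, s}, ∀ w ∈ S \ {p, q, r, s},
      u ≠ v → u ≠ w → v ≠ w → False) : S.ncard ≤ 6 := by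
  have h1 : (S \ {p, q, r, s}).ncard ≤ 2 := by
    by_contra! hc
    obtain ⟨u, v, w, hu, hv, hw, huv, huw, hvw⟩ := (Set.two_lt_ncard_iff).1 hc
    exact h u hu v hv w hw huv huw hvw
  have h2 := Set.ncard_le_ncard_sdiff_add_ncard S ({p, q, r, s} : Set V)
  have h3 := Set.ncard_insert_le p ({q, r, s} : Set V)
  have h4 := Set.ncard_insert_le q ({r, s} : Set V)
  have h5 := Set.ncard_insert_le r ({s} : Set V)
  rw [Set.ncard_singleton] at h5
  omega

/-- The bounds for a set with two edges of which one end of the first and one end of the second have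
a common neighbour. Then all four pairs of ends do, which gives four vertices outside the set. -/
theorem TriplesOnPaths.ncard_le_of_linked [Finite V] (hG : G.TriplesOnPaths) (hS : G.IsGPSet S)
    (h3 : 3 ≤ S.ncard) {a a' b b' : V} (ha : a ∈ S) (ha' : a' ∈ S) (hb : b ∈ S) (hb' : b' ∈ S)
    (haa : G.Adj a a') (hbb : G.Adj b b') (hab : a ≠ b) (ha'b : a' ≠ b)
    (h : ∃ z, G.Adj a z ∧ G.Adj b z) : 4 ≤ Sᶜ.ncard ∧ (Sᶜ.ncard ≤ 4 → S.ncard ≤ 6) := by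
  have hab' : a ≠ b' := fun e =>
    ha'b (hG.unique_partner hS ha ha' hb haa (e ▸ hbb.symm))
  have ha'b' : a' ≠ b' := fun e =>
    hab (hG.unique_partner hS ha' ha hb haa.symm (e ▸ hbb.symm))
  obtain ⟨x, ax, bx⟩ := h
  obtain ⟨x', ax', bx'⟩ :=
    hG.exists_common_neighbor hS ha ha' hb haa hab.symm ha'b.symm ⟨x, ax, bx⟩
  obtain ⟨y, by₁, ay⟩ := hG.exists_common_neighbor hS hb hb' ha hbb hab hab' ⟨x, bx, ax⟩
  obtain ⟨y', by', ay'⟩ := hG.exists_common_neighbor hS hb hb' ha' hbb ha'b ha'b' ⟨x', bx', ax'⟩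
  -- A common neighbour in `S` would be the partner of both vertices.
  have hN : ∀ {c d z : V}, c ∈ S → d ∈ S → c ≠ d → G.Adj c z → G.Adj d z → z ∉ S :=
    fun hc hd hcd h1 h2 hz => hcd (hG.unique_partner hS hz hc hd h1.symm h2.symm)
  have hne : ∀ {c d z t : V}, G.Adj c d → G.Adj c z → G.Adj d t → z ≠ t := by
    rintro c d z _ h1 h2 h3 rfl
    exact hG.not_triangle h1 h3 h2
  have nx := hN ha hb hab ax bx
  have ny := hN ha hb' hab' ay by₁
  have nx' := hN ha' hb ha'b ax' bx'
  have ny' := hN ha' hb' ha'b' ay' by'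
  obtain ⟨h4, hT⟩ := four_le_ncard_compl nx ny nx' ny' (hne hbb bx by₁) (hne haa ax ax')
    (hne haa ax ay') (hne haa ay ax') (hne haa ay ay') (hne hbb bx' by')
  refine ⟨h4, fun h4' => ?_⟩
  have D : G.IsLinkedPair S a a' b b' x y x' y' := ⟨ha, ha', hb, hb', nx, ny, nx', ny', haa, hbb,
    hab, ha'b', hab', ha'b, ax, bx, ay, by₁, ax', bx', ay', by', hT h4'⟩
  exact ncard_le_six_of_diff fun u hu v hv w hw huv huw hvw =>
    D.false_of_three hG hS h3 rfl hu hv hw huv huw hvw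

theorem TriplesOnPaths.ncard_le_of_two_edges [Finite V] (hG : G.TriplesOnPaths) (hS : G.IsGPSet S)
    (h3 : 3 ≤ S.ncard) {a a' b b' : V} (ha : a ∈ S) (ha' : a' ∈ S) (hb : b ∈ S) (hb' : b' ∈ S)
    (haa : G.Adj a a') (hbb : G.Adj b b') (hab : a ≠ b) (ha'b : a' ≠ b) :
    4 ≤ Sᶜ.ncard ∧ (Sᶜ.ncard ≤ 4 → S.ncard ≤ 6) := by
  have hab' : a ≠ b' := fun e =>
    ha'b (hG.unique_partner hS ha ha' hb haa (e ▸ hbb.symm))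
  have ha'b' : a' ≠ b' := fun e =>
    hab (hG.unique_partner hS ha' ha hb haa.symm (e ▸ hbb.symm))
  by_cases n1 : ∃ z, G.Adj a z ∧ G.Adj b z
  · exact hG.ncard_le_of_linked hS h3 ha ha' hb hb' haa hbb hab ha'b n1
  by_cases n2 : ∃ z, G.Adj a z ∧ G.Adj b' z
  · exact hG.ncard_le_of_linked hS h3 ha ha' hb' hb haa hbb.symm hab' ha'b' n2
  by_cases n3 : ∃ z, G.Adj a' z ∧ G.Adj b z
  · exact hG.ncard_le_of_linked hS h3 ha' ha hb hb' haa.symm hbb ha'b hab n3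
  by_cases n4 : ∃ z, G.Adj a' z ∧ G.Adj b' z
  · exact hG.ncard_le_of_linked hS h3 ha' ha hb' hb haa.symm hbb.symm ha'b' hab' n4
  push Not at n1 n2 n3 n4
  obtain ⟨p, np, hp⟩ := hG.exists_adj_notMem hS h3 ha
  obtain ⟨p', np', hp'⟩ := hG.exists_adj_notMem hS h3 ha'
  obtain ⟨q, nq, hq⟩ := hG.exists_adj_notMem hS h3 hb
  obtain ⟨q', nq', hq'⟩ := hG.exists_adj_notMem hS h3 hb'
  obtain ⟨h4, hT⟩ := four_le_ncard_compl np np' nq nq'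
    (by rintro rfl; exact hG.not_triangle haa hp' hp) (by rintro rfl; exact n1 _ hp hq)
    (by rintro rfl; exact n2 _ hp hq') (by rintro rfl; exact n3 _ hp' hq)
    (by rintro rfl; exact n4 _ hp' hq') (by rintro rfl; exact hG.not_triangle hbb hq' hq)
  refine ⟨h4, fun h4' => ncard_le_six_of_diff (p := a) (q := a') (r := b) (s := b')
    fun u hu v hv w hw huv huw hvw => ?_⟩
  exact hG.false_of_unlinked hS h3 ha ha' hb hb' hp hp' hq hq' haa hbb (hT h4')
    (fun z h => n1 z h.1 h.2) (fun z h => n2 z h.1 h.2) (fun z h => n3 z h.1 h.2)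
    (fun z h => n4 z h.1 h.2) rfl hu hv hw huv huw hvw

theorem TriplesOnPaths.ncard_le_complBound [Finite V] (hG : G.TriplesOnPaths) (hS : G.IsGPSet S)
    (h3 : 3 ≤ S.ncard) (ht : Sᶜ.ncard ∈ [2, 3, 4]) : S.ncard ≤ complBound Sᶜ.ncard := by
  let f : (Sᶜ : Set V) ≃ Fin Sᶜ.ncard := Finite.equivFinOfCardEq (Nat.card_coe_set_eq _)
  have he : ∀ y ∉ S, ∃ i, (fun i => (f.symm i : V)) i = y := fun y hy => ⟨f ⟨y, hy⟩, by simp⟩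
  by_cases h : ∀ v ∈ S, ∀ w ∈ S, ¬ G.Adj v w
  · exact ncard_le_of_isolated hG hS h3 he ht h
  push Not at h
  obtain ⟨s, hs, s', hs', hss⟩ := h
  by_cases h : ∀ v ∈ S, v ≠ s → v ≠ s' → G.IsIsolatedIn S v
  · exact ncard_le_of_pair hG hS h3 he ht hs hs' hss h
  push Not at h
  obtain ⟨v, hv, hvs, hvs', hi⟩ := h
  simp only [IsIsolatedIn, not_and, not_forall, not_not] at hi
  obtain ⟨w, hw, hvw⟩ := hi hv
  have := hG.ncard_le_of_two_edges hS h3 hs hs' hv hw hss hvw hvs.symm hvs'.symm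
  have h4 : Sᶜ.ncard = 4 := by
    simp only [List.mem_cons, List.not_mem_nil, or_false] at ht
    omega
  rw [h4, complBound, if_pos rfl]
  exact this.2 h4.le

theorem le_of_mem_positionOrders_two {b n : ℕ} (hb : 4 ≤ b) (hb' : b ≤ 8)
    (h : n ∈ positionOrders 2 b) : (3 * b + 1) / 2 + 1 ≤ n := by
  have h2 := add_two_le_of_mem_positionOrders (by omega) h
  obtain ⟨G, h1, rfl⟩ := h
  obtain ⟨S, hS, hc⟩ := exists_isGPSet G
  have hn := Set.ncard_add_ncard_compl S
  rw [Nat.card_fin] at hn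
  by_contra! hlt
  have h4 : Sᶜ.ncard = 2 ∨ Sᶜ.ncard = 3 ∨ Sᶜ.ncard = 4 := by omega
  have := (triplesOnPaths_of_mpNumber h1).ncard_le_complBound hS (by omega)
    (by simpa using h4)
  unfold complBound at this
  split at this <;> omega

end SimpleGraph

end

theorem theorem2p7 :
    -- the number `μ(a,b)` is well defined for `2 ≤ a ≤ b`
    (∀ a b : ℕ, 2 ≤ a → a ≤ b → (SimpleGraph.positionOrders a b).Nonempty) ∧
    (∀ a : ℕ, 2 ≤ a → SimpleGraph.positionMu a a = a) ∧
    SimpleGraph.positionMu 2 3 = 5 ∧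
    (∀ b : ℕ, 4 ≤ b → SimpleGraph.positionMu 2 b ≤ ⌈(3 * b : ℚ) / 2⌉₊ + 1) ∧
    (∀ b : ℕ, 4 ≤ b → b ≤ 8 → SimpleGraph.positionMu 2 b = ⌈(3 * b : ℚ) / 2⌉₊ + 1) ∧
    (∀ a b : ℕ, 3 ≤ a → a < b → b ≤ 2 * a → SimpleGraph.positionMu a b = b + 2) ∧
    (∀ a b : ℕ, 3 ≤ a → 2 * a < b →
      SimpleGraph.positionMu a b ≤ b - a + 2 + ⌈(b : ℚ) / 2⌉₊) := by
  have ceil : ∀ m : ℕ, ⌈(m : ℚ) / 2⌉₊ = (m + 1) / 2 := fun m => by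
    refine eq_of_forall_ge_iff fun k => ?_
    rw [Nat.ceil_le, div_le_iff₀ (by norm_num)]
    norm_cast
    omega
  have ceil' : ∀ b : ℕ, ⌈(3 * b : ℚ) / 2⌉₊ = (3 * b + 1) / 2 := fun b => by
    rw [← ceil]; push_cast; rfl
  have two : ∀ b, 4 ≤ b → (3 * b + 1) / 2 + 1 ∈ SimpleGraph.positionOrders 2 b := fun b hb => by
    rcases hb.eq_or_lt with rfl | hb
    · exact SimpleGraph.seven_mem_positionOrders
    · exact SimpleGraph.pagoda_mem_positionOrders hb
  have eq : ∀ {a b n : ℕ}, n ∈ SimpleGraph.positionOrders a b →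
      (∀ k ∈ SimpleGraph.positionOrders a b, n ≤ k) → SimpleGraph.positionMu a b = n :=
    fun hn h => le_antisymm (Nat.sInf_le hn) (h _ (Nat.sInf_mem ⟨_, hn⟩))
  refine ⟨fun a b ha hab => ?_, fun a _ => ?_, ?_, fun b hb => ?_, fun b hb hb' => ?_,
    fun a b ha hab hb => ?_, fun a b ha hb => ?_⟩
  · rcases hab.eq_or_lt with rfl | hab
    · exact ⟨_, SimpleGraph.self_mem_positionOrders a⟩
    rcases ha.eq_or_lt with rfl | ha
    · rcases hab.nat_succ_le.eq_or_lt with rfl | hb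
      · exact ⟨_, SimpleGraph.five_mem_positionOrders⟩
      · exact ⟨_, two b hb⟩
    rcases le_or_gt b (2 * a) with hb | hb
    · exact ⟨_, SimpleGraph.add_two_mem_positionOrders ha hab hb⟩
    · exact ⟨_, SimpleGraph.mem_positionOrders_of_two_mul_lt ha hb⟩
  · exact eq (SimpleGraph.self_mem_positionOrders a)
      fun _ => SimpleGraph.le_of_mem_positionOrders
  · exact eq SimpleGraph.five_mem_positionOrders
      fun _ => SimpleGraph.add_two_le_of_mem_positionOrders (by norm_num)
  · rw [ceil']
    exact Nat.sInf_le (two b hb)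
  · rw [ceil']
    exact eq (two b hb) fun _ => SimpleGraph.le_of_mem_positionOrders_two hb hb'
  · exact eq (SimpleGraph.add_two_mem_positionOrders ha hab hb)
      fun _ => SimpleGraph.add_two_le_of_mem_positionOrders hab
  · rw [ceil]
    exact Nat.sInf_le (SimpleGraph.mem_positionOrders_of_two_mul_lt ha hb)
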